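/- **Setting.** Let $MU_*$ be the coefficient ring of complex cobordism with its canonical formal group law $F=F^{MU}$; as is standard (Quillen), $(MU_*,F)$ is the universal pair of a commutative ring with a commutative one-dimensional formal group law, i.e. $MU_*$ is the ring generated by the coefficients $a_{ij}$ ($i,j\ge 1$) of $F(X,Y)=X+Y+\sum_{i,j\ge1}a_{ij}X^iY^j$ subject only to the relations expressing commutativity and associativity of $F$, graded by $a_{ij}\in MU_{2(i+j-1)}$. An element $x\in MU_{2n}$ ($n\ge 1$) is called a *polynomial generator* of $MU_*$ if there are $y_i\in MU_{2i}$ ($i\ge1$) with $MU_*=\mathbb Z[y_1,y_2,\dots]$ a polynomial ring and $y_n=x$. Let $MU[1/2]_*=\mathbb Z[1/2]\otimes MU_*$. Let $[-1]_F(X)$ be the series with $F(X,[-1]_F(X))=0$, let $[2]_F(X)=F(X,X)$, and let $[1/2]_F(X)\in MU[1/2]_*[[X]]$ be its compositional inverse. Put $\phi(X)=[1/2]_F\bigl(F(X,[-1]_F(-X))\bigr)=X+\cdots$ and $F'(X,Y)=\phi^{-1}\bigl(F(\phi(X),\phi(Y))\bigr)$. Let $\epsilon_2\colon MU[1/2]_*\to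 MU[1/2]_*$ be the $\mathbb Z[1/2]$-algebra homomorphism extending the homomorphism $MU_*\to MU[1/2]_*$ that classifies the formal group law $F'$, and let ${}^{\mathrm{ev}}MU_*=\operatorname{im}\epsilon_2\subset MU[1/2]_*$. **Theorem.** For each prime $\ell$ there are unique elements $T_{\ell,k}\in MU_*$ ($k\ge1$) such that $$\mathrm v_\ell\mathrm f_\ell(X)={\sum_{\zeta^\ell=1}}^{F}\zeta X={\sum_{k\ge1}}^{F}T_{\ell,k}X^{k\ell},$$ where $\sum^F$ denotes formal group summation, $\zeta$ runs through the $\ell$-th roots of unity, and the equation is between power series over $MU_*[x]/(\Phi_\ell(x))$ ($\Phi_\ell$ the $\ell$-th cyclotomic polynomial). They have the following properties. 1. $T_{\ell,k}\in MU_{2k\ell-2}$. 2. For every prime $\ell$ and $d\ge0$, $T_{\ell,\ell^d}$ is a polynomial generator of $MU_*$. 3. If $n$ is divisible by distinct primes $\ell_1,\ell_2$, then some integral linear combination of $T_{\ell_1,n/\ell_1}$ and $T_{\ell_2,n/\ell_2}$ is a polynomial generator of $MU_*$. 4. Let $X_{n-1}\in MU_{2n-2}$ ($n\ge2$) be any choice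 of elements such that $X_{\ell^{d+1}-1}=T_{\ell,\ell^d}$ for all primes $\ell$ and $d\ge0$ and, whenever $n$ is not a prime power, $X_{n-1}$ is a polynomial generator of $MU_*$ that is an integral linear combination of $T_{\ell_1,n/\ell_1}$ and $T_{\ell_2,n/\ell_2}$ for some distinct primes $\ell_1,\ell_2$ dividing $n$. Then the (images in $MU[1/2]_*$ of the) elements $X_{2m}$, $m\ge1$, form a set of polynomial generators for ${}^{\mathrm{ev}}MU_*$ as a $\mathbb Z[1/2]$-algebra: they are algebraically independent over $\mathbb Z[1/2]$, and ${}^{\mathrm{ev}}MU_*=\mathbb Z[1/2][X_2,X_4,X_6,\dots]$. -/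

import Mathlib

open scoped TensorProduct

noncomputable section

namespace FormalGroup

variable {R : Type*} [CommRing R] {S : Type*} [CommRing S]

instance map_isComm (F : FormalGroup R) [F.IsComm] (f : R →+* S) : (F.map f).IsComm where
  comm := by
    have h : ![(MvPowerSeries.X 1 : MvPowerSeries (Fin 2) S), MvPowerSeries.X 0] =
        fun i => ((![MvPowerSeries.X 1, MvPowerSeries.X 0] :
          Fin 2 → MvPowerSeries (Fin 2) R) i).map f := by
      ext1 i; fin_cases i <;> simp
    simp only [map]
    rw [h, ← MvPowerSeries.map_subst .X_X]
    exact congrArg _ IsComm.comm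

/-- The one-variable power series `c X ^ n` for `n ≥ 1`, as a point of the formal group law `F`,
that is, as a series which can be added with the formal group law. -/
def monomialPoint (F : FormalGroup R) (c : R) (n : ℕ+) : F.Point Unit :=
  ⟨PowerSeries.monomial (n : ℕ) c, PowerSeries.HasSubst.monomial' n.ne_zero c⟩

/-- The infinite formal group sum `x 1 +_F x 2 +_F x 3 +_F ⋯` converges (coefficientwise, i.e.
in the `X`-adic topology) to `s`. -/
def HasFormalSum (F : FormalGroup R) [F.IsComm] (x : ℕ+ → F.Point Unit)
    (s : F.Point Unit) : Prop :=
  ∀ n : ℕ, ∀ᶠ N : ℕ+ in Filter.atTop,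
    PowerSeries.coeff n (∑ k ∈ Finset.Icc 1 N, x k : F.Point Unit).val =
      PowerSeries.coeff n s.val

/-! ### Low order terms of substituted series -/

theorem hasSubst_pair {f g : PowerSeries R} (hf : f.constantCoeff = 0)
    (hg : g.constantCoeff = 0) : MvPowerSeries.HasSubst ![f, g] :=
  MvPowerSeries.hasSubst_of_constantCoeff_zero fun s => by
    fin_cases s
    · exact hf
    · exact hg

theorem constantCoeff_add (F : FormalGroup R) {f g : PowerSeries R} (hf : f.constantCoeff = 0)
    (hg : g.constantCoeff = 0) :
    PowerSeries.constantCoeff (F.toPowerSeries.subst ![f, g] : PowerSeries R) = 0 :=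
  MvPowerSeries.constantCoeff_subst_eq_zero (hasSubst_pair hf hg)
    (fun s => by
      fin_cases s
      · exact hf
      · exact hg) F.zero_constantCoeff

theorem coeff_subst_pair (F : FormalGroup R) {f g : PowerSeries R} (hf : f.constantCoeff = 0)
    (hg : g.constantCoeff = 0) (n : ℕ) :
    PowerSeries.coeff n (F.toPowerSeries.subst ![f, g] : PowerSeries R) =
      finsum fun d : Fin 2 →₀ ℕ => F.toPowerSeries.coeff d *
        PowerSeries.coeff n (f ^ d 0 * g ^ d 1) := by
  rw [PowerSeries.coeff, MvPowerSeries.coeff_subst (hasSubst_pair hf hg)]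
  refine finsum_congr fun d => ?_
  rw [Finsupp.prod_fintype _ _ (by simp)]
  simp [Fin.prod_univ_two]

theorem finite_coeff_subst_pair (F : FormalGroup R) {f g : PowerSeries R}
    (hf : f.constantCoeff = 0) (hg : g.constantCoeff = 0) (n : ℕ) :
    (fun d : Fin 2 →₀ ℕ => F.toPowerSeries.coeff d *
        PowerSeries.coeff n (f ^ d 0 * g ^ d 1)).HasFiniteSupport := by
  convert MvPowerSeries.coeff_subst_finite (hasSubst_pair hf hg) F.toPowerSeries
    (Finsupp.single () n) using 2 with d
  rw [Finsupp.prod_fintype _ _ (by simp)]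
  simp [Fin.prod_univ_two, PowerSeries.coeff]

/-- `F(X, u + δ) ≡ F(X, u) + δ` modulo `X ^ (n + 1)` if `u ≡ 0` modulo `X`
and `δ ≡ 0` modulo `X ^ n`, where `n ≥ 1`. -/
theorem coeff_subst_perturb (F : FormalGroup R) {u δ : PowerSeries R}
    (hu : PowerSeries.X ∣ u) {n : ℕ} (hn : 1 ≤ n) (hδ : PowerSeries.X ^ n ∣ δ)
    {m : ℕ} (hm : m ≤ n) :
    PowerSeries.coeff m (F.toPowerSeries.subst ![PowerSeries.X, u + δ] : PowerSeries R) =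
      PowerSeries.coeff m (F.toPowerSeries.subst ![PowerSeries.X, u] : PowerSeries R) +
        PowerSeries.coeff m δ := by
  have hδ' : PowerSeries.X ∣ δ := (dvd_pow_self _ (by omega)).trans hδ
  have h0 : (PowerSeries.X : PowerSeries R).constantCoeff = 0 := by simp
  have hu0 : u.constantCoeff = 0 := PowerSeries.X_dvd_iff.mp hu
  have hud : (u + δ).constantCoeff = 0 := PowerSeries.X_dvd_iff.mp (dvd_add hu hδ')
  rw [← sub_eq_iff_eq_add', coeff_subst_pair F h0 hud, coeff_subst_pair F h0 hu0,
    ← finsum_sub_distrib (finite_coeff_subst_pair F h0 hud m)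
      (finite_coeff_subst_pair F h0 hu0 m),
    finsum_eq_single _ (Finsupp.single 1 1)]
  · simp [F.lin_coeff_Y]
  · intro d hd
    rw [← mul_sub, ← map_sub, ← mul_sub]
    have key : PowerSeries.X ^ (n + 1) ∣
        (PowerSeries.X : PowerSeries R) ^ d 0 * ((u + δ) ^ d 1 - u ^ d 1) := by
      by_cases hd0 : d 0 = 0
      · rcases hd1 : d 1 with _ | _ | j
        · simp
        · exact absurd (Finsupp.ext fun i => by fin_cases i <;> simp [hd0, hd1]) hd
        · refine Dvd.dvd.mul_left ?_ _
          rw [← (Commute.all (u + δ) u).mul_geom_sum₂ (j + 1 + 1), add_sub_cancel_left, pow_succ]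
          refine mul_dvd_mul hδ (Finset.dvd_sum fun i hi => ?_)
          rcases Nat.eq_zero_or_pos i with rfl | hi0
          · exact Dvd.dvd.mul_left (dvd_pow hu (by omega)) _
          · exact Dvd.dvd.mul_right (dvd_pow (dvd_add hu hδ') (by omega)) _
      · rw [pow_succ']
        refine mul_dvd_mul (dvd_pow_self _ hd0) (hδ.trans ?_)
        simpa using sub_dvd_pow_sub_pow (u + δ) u (d 1)
    rw [PowerSeries.X_pow_dvd_iff.mp key m (by omega), mul_zero]

theorem coeff_one_add (F : FormalGroup R) {f g : PowerSeries R} (hf : f.constantCoeff = 0)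
    (hg : g.constantCoeff = 0) :
    PowerSeries.coeff 1 (F.toPowerSeries.subst ![f, g] : PowerSeries R) =
      PowerSeries.coeff 1 f + PowerSeries.coeff 1 g := by
  classical
  have hX : (Finsupp.single 0 1 : Fin 2 →₀ ℕ) ≠ Finsupp.single 1 1 := by
    intro h; simpa using DFunLike.congr_fun h 0
  rw [coeff_subst_pair F hf hg,
    finsum_eq_sum_of_support_subset (s := {Finsupp.single 0 1, Finsupp.single 1 1})]
  · rw [Finset.sum_pair hX]
    simp [F.lin_coeff_X, F.lin_coeff_Y]
  · intro d hd
    by_contra hd'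
    simp only [Finset.coe_insert, Finset.coe_singleton, Set.mem_insert_iff,
      Set.mem_singleton_iff, not_or] at hd'
    refine hd ?_
    by_cases hz : d = 0
    · have : F.toPowerSeries.coeff 0 = 0 := F.zero_constantCoeff
      simp [hz, this]
    have h2 : 2 ≤ d 0 + d 1 := by
      by_contra h
      have : (d 0 = 0 ∧ d 1 = 0) ∨ (d 0 = 1 ∧ d 1 = 0) ∨ (d 0 = 0 ∧ d 1 = 1) := by omega
      rcases this with ⟨a, b⟩ | ⟨a, b⟩ | ⟨a, b⟩
      · exact hz (Finsupp.ext fun i => by fin_cases i <;> simp [a, b])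
      · exact hd'.1 (Finsupp.ext fun i => by fin_cases i <;> simp [a, b])
      · exact hd'.2 (Finsupp.ext fun i => by fin_cases i <;> simp [a, b])
    have key : PowerSeries.X ^ 2 ∣ f ^ d 0 * g ^ d 1 := by
      refine (pow_dvd_pow _ h2).trans ?_
      rw [pow_add]
      exact mul_dvd_mul (pow_dvd_pow_of_dvd (PowerSeries.X_dvd_iff.mpr hf) _)
        (pow_dvd_pow_of_dvd (PowerSeries.X_dvd_iff.mpr hg) _)
    change _ * _ = _
    rw [PowerSeries.X_pow_dvd_iff.mp key 1 (by omega), mul_zero]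

/-! ### The `[-1]`-series and the `[1/2]`-series -/

/-- Successive approximations to the `[-1]`-series. -/
def negApprox (F : FormalGroup R) : ℕ → PowerSeries R
  | 0 => 0
  | n + 1 => negApprox F n - F.toPowerSeries.subst ![PowerSeries.X, negApprox F n]

theorem negApprox_spec (F : FormalGroup R) (n : ℕ) :
    PowerSeries.X ∣ F.negApprox n ∧ PowerSeries.X ^ (n + 1) ∣
      (F.toPowerSeries.subst ![PowerSeries.X, F.negApprox n] : PowerSeries R) := by
  induction n with
  | zero =>
    refine ⟨by simp [negApprox], ?_⟩
    have := F.Xzero_eq_X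
    simp only [Xzero] at this
    simp [negApprox, this]
  | succ n ih =>
    obtain ⟨h1, h2⟩ := ih
    have h3 : PowerSeries.X ∣
        (F.toPowerSeries.subst ![PowerSeries.X, F.negApprox n] : PowerSeries R) :=
      (dvd_pow_self _ (by omega)).trans h2
    refine ⟨dvd_sub h1 h3, PowerSeries.X_pow_dvd_iff.mpr fun m hm => ?_⟩
    rw [negApprox, sub_eq_add_neg, coeff_subst_perturb F h1 (n := n + 1) (by omega)
      ((dvd_neg).mpr h2) (by omega)]
    simp

theorem exists_neg (F : FormalGroup R) : ∃ i : PowerSeries R, i.constantCoeff = 0 ∧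
    F.toPowerSeries.subst ![PowerSeries.X, i] = (0 : PowerSeries R) := by
  have step : ∀ n, ∀ m ≤ n, PowerSeries.coeff m (F.negApprox n) =
      PowerSeries.coeff m (F.negApprox m) := by
    intro n m hmn
    induction n, hmn using Nat.le_induction with
    | base => rfl
    | succ n hmn ih =>
      rw [negApprox, map_sub, ih,
        PowerSeries.X_pow_dvd_iff.mp (F.negApprox_spec n).2 m (by omega), sub_zero]
  let i : PowerSeries R := PowerSeries.mk fun n => PowerSeries.coeff n (F.negApprox n)
  refine ⟨i, ?_, ?_⟩
  · rw [← PowerSeries.coeff_zero_eq_constantCoeff_apply, PowerSeries.coeff_mk]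
    simp [negApprox]
  ext n
  have hdvd : PowerSeries.X ^ (n + 1) ∣ i - F.negApprox n := by
    refine PowerSeries.X_pow_dvd_iff.mpr fun m hm => ?_
    rw [map_sub, step n m (by omega)]
    simp [i]
  have := coeff_subst_perturb F (F.negApprox_spec n).1 (n := n + 1) (by omega) hdvd
    (m := n) (by omega)
  rw [add_sub_cancel] at this
  rw [this, PowerSeries.X_pow_dvd_iff.mp (F.negApprox_spec n).2 n (by omega),
    PowerSeries.X_pow_dvd_iff.mp hdvd n (by omega)]
  simp

/-- The `[-1]`-series `[-1]_F(X)`: the (unique) power series `i(X)` without constant term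
satisfying `F(X, i(X)) = 0`. -/
def negSeries (F : FormalGroup R) : PowerSeries R := F.exists_neg.choose

theorem constantCoeff_negSeries (F : FormalGroup R) : F.negSeries.constantCoeff = 0 :=
  F.exists_neg.choose_spec.1

theorem subst_negSeries (F : FormalGroup R) :
    F.toPowerSeries.subst ![PowerSeries.X, F.negSeries] = (0 : PowerSeries R) :=
  F.exists_neg.choose_spec.2

theorem coeff_one_negSeries (F : FormalGroup R) : PowerSeries.coeff 1 F.negSeries = -1 := by
  have := coeff_one_add F (f := PowerSeries.X) (by simp) F.constantCoeff_negSeries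
  rw [subst_negSeries] at this
  simp only [map_zero, PowerSeries.coeff_one_X] at this
  exact (neg_eq_of_add_eq_zero_right this.symm).symm

/-- The `[2]`-series `[2]_F(X) = F(X, X)`. -/
def twoSeries (F : FormalGroup R) : PowerSeries R :=
  F.toPowerSeries.subst ![PowerSeries.X, PowerSeries.X]

theorem constantCoeff_twoSeries (F : FormalGroup R) : F.twoSeries.constantCoeff = 0 :=
  F.constantCoeff_add (by simp) (by simp)

theorem coeff_one_twoSeries (F : FormalGroup R) : PowerSeries.coeff 1 F.twoSeries = 2 := by
  rw [twoSeries, coeff_one_add F (by simp) (by simp), PowerSeries.coeff_one_X]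
  norm_num

theorem isUnit_coeff_one_twoSeries (F : FormalGroup R) (h2 : IsUnit (2 : R)) :
    IsUnit (PowerSeries.coeff 1 F.twoSeries) := by
  rwa [coeff_one_twoSeries]

/-- The `[1/2]`-series: the power series `h` with `[2]_F(h(X)) = X`; here `2` is invertible. -/
def halfSeries (F : FormalGroup R) (h2 : IsUnit (2 : R)) : PowerSeries R :=
  F.twoSeries.substInvOfIsUnit (F.isUnit_coeff_one_twoSeries h2)

theorem twoSeries_subst_halfSeries (F : FormalGroup R) (h2 : IsUnit (2 : R)) :
    F.twoSeries.subst (F.halfSeries h2) = PowerSeries.X :=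
  PowerSeries.subst_substInvOfIsUnit_right _ F.constantCoeff_twoSeries _

/-- The series `F(X, [-1]_F(-X))`. -/
def subNegSeries (F : FormalGroup R) : PowerSeries R :=
  F.toPowerSeries.subst ![PowerSeries.X, F.negSeries.subst (-PowerSeries.X : PowerSeries R)]

/-- The series `φ(X) = [1/2]_F (F(X, [-1]_F(-X)))`. -/
def oddCoordinate (F : FormalGroup R) (h2 : IsUnit (2 : R)) : PowerSeries R :=
  (F.halfSeries h2).subst F.subNegSeries

theorem coeff_one_subst {f g : PowerSeries R} (hg : g.constantCoeff = 0) :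
    PowerSeries.coeff 1 (f.subst g) = PowerSeries.coeff 1 f * PowerSeries.coeff 1 g := by
  rw [PowerSeries.coeff_subst' (PowerSeries.HasSubst.of_constantCoeff_zero' hg),
    finsum_eq_single _ 1]
  · simp
  · intro n hn
    rcases n with _ | _ | n
    · simp [PowerSeries.coeff_one]
    · exact absurd rfl hn
    · have : PowerSeries.X ^ 2 ∣ g ^ (n + 1 + 1) :=
        (pow_dvd_pow_of_dvd (PowerSeries.X_dvd_iff.mpr hg) 2).trans (pow_dvd_pow _ (by omega))
      rw [PowerSeries.X_pow_dvd_iff.mp this 1 (by omega), smul_zero]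

theorem constantCoeff_subst_zero {f g : PowerSeries R} (hf : f.constantCoeff = 0)
    (hg : g.constantCoeff = 0) : PowerSeries.constantCoeff (f.subst g) = 0 :=
  PowerSeries.constantCoeff_subst_eq_zero hg f hf

theorem constantCoeff_subNegSeries (F : FormalGroup R) : F.subNegSeries.constantCoeff = 0 :=
  F.constantCoeff_add (by simp) (constantCoeff_subst_zero F.constantCoeff_negSeries (by simp))

theorem constantCoeff_oddCoordinate (F : FormalGroup R) (h2 : IsUnit (2 : R)) :
    (F.oddCoordinate h2).constantCoeff = 0 :=
  constantCoeff_subst_zero (by simp [halfSeries]) F.constantCoeff_subNegSeries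

theorem coeff_one_oddCoordinate (F : FormalGroup R) (h2 : IsUnit (2 : R)) :
    PowerSeries.coeff 1 (F.oddCoordinate h2) = 1 := by
  have h : PowerSeries.coeff 1 F.subNegSeries = 2 := by
    rw [subNegSeries, coeff_one_add F (by simp)
      (constantCoeff_subst_zero F.constantCoeff_negSeries (by simp)),
      coeff_one_subst (by simp), coeff_one_negSeries]
    simp only [PowerSeries.coeff_one_X, map_neg]
    norm_num
  have h' := coeff_one_subst (f := F.twoSeries) (g := F.halfSeries h2) (by simp [halfSeries])
  rw [twoSeries_subst_halfSeries, coeff_one_twoSeries, PowerSeries.coeff_one_X] at h'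
  rw [oddCoordinate, coeff_one_subst F.constantCoeff_subNegSeries, h, mul_comm, ← h']

/-! ### Change of coordinate -/

theorem coeff_subst_X_zero (G : MvPowerSeries (Fin 2) R) (n : ℕ) :
    PowerSeries.coeff n (G.subst ![PowerSeries.X, 0] : PowerSeries R) =
      G.coeff (Finsupp.single 0 n) := by
  rw [PowerSeries.coeff, MvPowerSeries.coeff_subst (hasSubst_pair (by simp) (by simp)),
    finsum_eq_single _ (Finsupp.single 0 n)]
  · rw [Finsupp.prod_fintype _ _ (by simp)]
    simp [Fin.prod_univ_two, ← PowerSeries.coeff_def, PowerSeries.coeff_X_pow]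
  · intro d hd
    rw [Finsupp.prod_fintype _ _ (by simp)]
    by_cases h1 : d 1 = 0
    · have h0 : n ≠ d 0 := fun h =>
        hd (Finsupp.ext fun i => by fin_cases i <;> simp [h, h1])
      simp [Fin.prod_univ_two, ← PowerSeries.coeff_def, PowerSeries.coeff_X_pow, h1, h0]
    · simp [Fin.prod_univ_two, h1]

theorem coeff_subst_zero_X (G : MvPowerSeries (Fin 2) R) (n : ℕ) :
    PowerSeries.coeff n (G.subst ![0, PowerSeries.X] : PowerSeries R) =
      G.coeff (Finsupp.single 1 n) := by
  rw [PowerSeries.coeff, MvPowerSeries.coeff_subst (hasSubst_pair (by simp) (by simp)),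
    finsum_eq_single _ (Finsupp.single 1 n)]
  · rw [Finsupp.prod_fintype _ _ (by simp)]
    simp [Fin.prod_univ_two, ← PowerSeries.coeff_def, PowerSeries.coeff_X_pow]
  · intro d hd
    rw [Finsupp.prod_fintype _ _ (by simp)]
    by_cases h1 : d 0 = 0
    · have h0 : n ≠ d 1 := fun h =>
        hd (Finsupp.ext fun i => by fin_cases i <;> simp [h, h1])
      simp [Fin.prod_univ_two, ← PowerSeries.coeff_def, PowerSeries.coeff_X_pow, h1, h0]
    · simp [Fin.prod_univ_two, h1]

variable {σ : Type*}

theorem hasSubst_pair' {a b : MvPowerSeries σ R} (ha : PowerSeries.HasSubst a)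
    (hb : PowerSeries.HasSubst b) : MvPowerSeries.HasSubst ![a, b] :=
  MvPowerSeries.hasSubst_of_constantCoeff_nilpotent fun s => by
    fin_cases s
    · exact ha
    · exact hb

theorem hasSubst_add (F : FormalGroup R) {a b : MvPowerSeries σ R} (ha : PowerSeries.HasSubst a)
    (hb : PowerSeries.HasSubst b) : PowerSeries.HasSubst (F.toPowerSeries.subst ![a, b]) :=
  MvPowerSeries.IsNilpotent_subst (hasSubst_pair' ha hb) (by
    rw [F.zero_constantCoeff]; exact IsNilpotent.zero)

theorem hasSubst_subst {f : PowerSeries R} (hf : f.constantCoeff = 0) {a : MvPowerSeries σ R}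
    (ha : PowerSeries.HasSubst a) : PowerSeries.HasSubst (f.subst a) :=
  MvPowerSeries.IsNilpotent_subst ha.const (by
    change IsNilpotent (PowerSeries.constantCoeff f)
    rw [hf]; exact IsNilpotent.zero)

theorem subst_subst' {ι : Type*} (f : PowerSeries R) {w : MvPowerSeries ι R}
    (hw : PowerSeries.HasSubst w) {c : ι → MvPowerSeries σ R} (hc : MvPowerSeries.HasSubst c) :
    MvPowerSeries.subst c (f.subst w) = f.subst (MvPowerSeries.subst c w) := by
  rw [PowerSeries.subst, MvPowerSeries.subst_comp_subst_apply hw.const hc, PowerSeries.subst]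

/-- The compositional inverse `f⁻¹` of a series `f(X) = X + ⋯`. -/
def compInv (f : PowerSeries R) (hf : PowerSeries.coeff 1 f = 1) : PowerSeries R :=
  f.substInvOfIsUnit (hf ▸ isUnit_one)

theorem constantCoeff_compInv (f : PowerSeries R) (hf : PowerSeries.coeff 1 f = 1) :
    (compInv f hf).constantCoeff = 0 := by simp [compInv]

theorem subst_compInv {f : PowerSeries R} (hf0 : f.constantCoeff = 0)
    (hf : PowerSeries.coeff 1 f = 1) {a : MvPowerSeries σ R} (ha : PowerSeries.HasSubst a) :
    f.subst ((compInv f hf).subst a) = a := by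
  rw [← PowerSeries.subst_comp_subst_apply
    (PowerSeries.HasSubst.of_constantCoeff_zero' (constantCoeff_compInv f hf)) ha, compInv,
    PowerSeries.subst_substInvOfIsUnit_right _ hf0, PowerSeries.subst_X ha]

theorem compInv_subst {f : PowerSeries R} (hf0 : f.constantCoeff = 0)
    (hf : PowerSeries.coeff 1 f = 1) {a : MvPowerSeries σ R} (ha : PowerSeries.HasSubst a) :
    (compInv f hf).subst (f.subst a) = a := by
  rw [← PowerSeries.subst_comp_subst_apply
    (PowerSeries.HasSubst.of_constantCoeff_zero' hf0) ha, compInv,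
    PowerSeries.subst_substInvOfIsUnit_left _ hf0, PowerSeries.subst_X ha]

/-- The series `f⁻¹(F(f(X), f(Y)))`. -/
def conjSeries (F : FormalGroup R) (f : PowerSeries R) (hf : PowerSeries.coeff 1 f = 1) :
    MvPowerSeries (Fin 2) R :=
  (compInv f hf).subst (F.toPowerSeries.subst
    ![f.subst (MvPowerSeries.X 0 : MvPowerSeries (Fin 2) R),
      f.subst (MvPowerSeries.X 1 : MvPowerSeries (Fin 2) R)])

theorem conjSeries_subst (F : FormalGroup R) {f : PowerSeries R} (hf0 : f.constantCoeff = 0)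
    (hf : PowerSeries.coeff 1 f = 1) {a b : MvPowerSeries σ R} (ha : PowerSeries.HasSubst a)
    (hb : PowerSeries.HasSubst b) :
    (F.conjSeries f hf).subst ![a, b] =
      (compInv f hf).subst (F.toPowerSeries.subst ![f.subst a, f.subst b]) := by
  have hab := hasSubst_pair' ha hb
  have h0 : PowerSeries.HasSubst (f.subst (MvPowerSeries.X 0 : MvPowerSeries (Fin 2) R)) :=
    hasSubst_subst hf0 (PowerSeries.HasSubst.X 0)
  have h1 : PowerSeries.HasSubst (f.subst (MvPowerSeries.X 1 : MvPowerSeries (Fin 2) R)) :=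
    hasSubst_subst hf0 (PowerSeries.HasSubst.X 1)
  rw [conjSeries, subst_subst' _ (F.hasSubst_add h0 h1) hab,
    MvPowerSeries.subst_comp_subst_apply (hasSubst_pair' h0 h1) hab]
  congr 2
  funext i
  fin_cases i
  · exact (subst_subst' f (PowerSeries.HasSubst.X 0) hab).trans
      (by rw [MvPowerSeries.subst_X hab]; rfl)
  · exact (subst_subst' f (PowerSeries.HasSubst.X 1) hab).trans
      (by rw [MvPowerSeries.subst_X hab]; rfl)

/-- The formal group law `F'(X, Y) = f⁻¹(F(f(X), f(Y)))`, for which `f : F' → F` is a strict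
isomorphism. -/
def conj (F : FormalGroup R) (f : PowerSeries R) (hf0 : f.constantCoeff = 0)
    (hf : PowerSeries.coeff 1 f = 1) : FormalGroup R where
  toPowerSeries := F.conjSeries f hf
  zero_constantCoeff :=
    PowerSeries.constantCoeff_subst_eq_zero
      (MvPowerSeries.constantCoeff_subst_eq_zero
        (hasSubst_pair' (hasSubst_subst hf0 (PowerSeries.HasSubst.X 0))
          (hasSubst_subst hf0 (PowerSeries.HasSubst.X 1)))
        (fun i => by
          fin_cases i
          · exact PowerSeries.constantCoeff_subst_eq_zero (by simp) f hf0
          · exact PowerSeries.constantCoeff_subst_eq_zero (by simp) f hf0)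
        F.zero_constantCoeff) _ (constantCoeff_compInv f hf)
  lin_coeff_X := by
    rw [← coeff_subst_X_zero, F.conjSeries_subst hf0 hf PowerSeries.HasSubst.X'
      PowerSeries.HasSubst.zero', PowerSeries.subst_zero_of_constantCoeff_zero hf0,
      F.add_zero (hasSubst_subst hf0 PowerSeries.HasSubst.X'),
      compInv_subst hf0 hf PowerSeries.HasSubst.X', PowerSeries.coeff_one_X]
  lin_coeff_Y := by
    rw [← coeff_subst_zero_X, F.conjSeries_subst hf0 hf PowerSeries.HasSubst.zero'
      PowerSeries.HasSubst.X', PowerSeries.subst_zero_of_constantCoeff_zero hf0,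
      F.zero_add (hasSubst_subst hf0 PowerSeries.HasSubst.X'),
      compInv_subst hf0 hf PowerSeries.HasSubst.X', PowerSeries.coeff_one_X]
  assoc := by
    have hX (i : Fin 3) : PowerSeries.HasSubst (MvPowerSeries.X i : MvPowerSeries (Fin 3) R) :=
      PowerSeries.HasSubst.X i
    have hf' (i : Fin 3) :
        PowerSeries.HasSubst (f.subst (MvPowerSeries.X i : MvPowerSeries (Fin 3) R)) :=
      hasSubst_subst hf0 (hX i)
    have hF (i j : Fin 3) := F.hasSubst_add (hf' i) (hf' j)
    have hF' (i j : Fin 3) := hasSubst_subst (constantCoeff_compInv f hf) (hF i j)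
    rw [F.conjSeries_subst hf0 hf (hX 0) (hX 1), F.conjSeries_subst hf0 hf (hX 1) (hX 2),
      F.conjSeries_subst hf0 hf (hF' 0 1) (hX 2), F.conjSeries_subst hf0 hf (hX 0) (hF' 1 2),
      subst_compInv hf0 hf (hF 0 1), subst_compInv hf0 hf (hF 1 2),
      F.assoc' (hf' 0) (hf' 1) (hf' 2)]

instance conj_isComm (F : FormalGroup R) [F.IsComm] (f : PowerSeries R)
    (hf0 : f.constantCoeff = 0) (hf : PowerSeries.coeff 1 f = 1) : (F.conj f hf0 hf).IsComm where
  comm := by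
    simp only [conj]
    rw [F.conjSeries_subst hf0 hf (PowerSeries.HasSubst.X 1) (PowerSeries.HasSubst.X 0),
      F.comm' (hasSubst_subst hf0 (PowerSeries.HasSubst.X 1))
        (hasSubst_subst hf0 (PowerSeries.HasSubst.X 0))]
    rfl

/-- For a formal group law `F` over a ring in which `2` is invertible: the formal group law
`F'(X, Y) = φ⁻¹(F(φ(X), φ(Y)))`, where `φ(X) = [1/2]_F (F(X, [-1]_F(-X)))`. -/
def oddification (F : FormalGroup R) (h2 : IsUnit (2 : R)) : FormalGroup R :=
  F.conj (F.oddCoordinate h2) (F.constantCoeff_oddCoordinate h2) (F.coeff_one_oddCoordinate h2)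

instance oddification_isComm (F : FormalGroup R) [F.IsComm] (h2 : IsUnit (2 : R)) :
    (F.oddification h2).IsComm := by
  unfold oddification; infer_instance

end FormalGroup

/-! ### The coefficient ring `MU_*` with its universal formal group law -/

namespace Lazard

variable {R : Type*} [CommRing R] {S : Type*} [CommRing S]

/-- For a doubly indexed family `a`, the power series `X + Y + ∑ a (i, j) X ^ (i+1) Y ^ (j+1)`
(the sum is over all `i, j ≥ 0`). -/
def unitalSeries (a : ℕ × ℕ → R) : MvPowerSeries (Fin 2) R := fun e =>
  if e 0 = 0 then (if e 1 = 1 then 1 else 0)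
  else if e 1 = 0 then (if e 0 = 1 then 1 else 0)
  else a (e 0 - 1, e 1 - 1)

theorem coeff_unitalSeries (a : ℕ × ℕ → R) (e : Fin 2 →₀ ℕ) :
    (unitalSeries a).coeff e =
      if e 0 = 0 then (if e 1 = 1 then 1 else 0)
      else if e 1 = 0 then (if e 0 = 1 then 1 else 0)
      else a (e 0 - 1, e 1 - 1) := rfl

theorem map_unitalSeries (f : R →+* S) (a : ℕ × ℕ → R) :
    (unitalSeries a).map f = unitalSeries fun p => f (a p) := by
  ext e
  simp only [MvPowerSeries.coeff_map, coeff_unitalSeries]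
  split_ifs <;> simp

theorem constantCoeff_unitalSeries (a : ℕ × ℕ → R) : (unitalSeries a).constantCoeff = 0 := by
  rw [← MvPowerSeries.coeff_zero_eq_constantCoeff_apply, coeff_unitalSeries]
  simp

/-- `G(Y, X) - G(X, Y)`. -/
def commDefect (G : MvPowerSeries (Fin 2) R) : MvPowerSeries (Fin 2) R :=
  G.subst ![(MvPowerSeries.X 1 : MvPowerSeries (Fin 2) R), MvPowerSeries.X 0] - G

/-- `G(G(X, Y), Z) - G(X, G(Y, Z))`. -/
def assocDefect (G : MvPowerSeries (Fin 2) R) : MvPowerSeries (Fin 3) R :=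
  G.subst ![G.subst ![(MvPowerSeries.X 0 : MvPowerSeries (Fin 3) R), MvPowerSeries.X 1],
      MvPowerSeries.X 2] -
    G.subst ![(MvPowerSeries.X 0 : MvPowerSeries (Fin 3) R),
      G.subst ![(MvPowerSeries.X 1 : MvPowerSeries (Fin 3) R), MvPowerSeries.X 2]]

theorem map_pair {ι : Type*} (f : R →+* S) (g h : MvPowerSeries ι R) :
    (fun i => ((![g, h] : Fin 2 → MvPowerSeries ι R) i).map f) = ![g.map f, h.map f] := by
  ext1 i; fin_cases i <;> simp

theorem map_commDefect (f : R →+* S) (G : MvPowerSeries (Fin 2) R) :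
    (commDefect G).map f = commDefect (G.map f) := by
  rw [commDefect, commDefect, map_sub, MvPowerSeries.map_subst .X_X, map_pair]
  simp

theorem map_assocDefect (f : R →+* S) {G : MvPowerSeries (Fin 2) R}
    (hG : G.constantCoeff = 0) : (assocDefect G).map f = assocDefect (G.map f) := by
  rw [assocDefect, assocDefect, map_sub,
    MvPowerSeries.map_subst (MvPowerSeries.HasSubst.cons_subst_zero_left 0 1 2 hG),
    MvPowerSeries.map_subst (MvPowerSeries.HasSubst.cons_subst_zero_right 0 1 2 hG),
    map_pair, map_pair, MvPowerSeries.map_subst .X_X, MvPowerSeries.map_subst .X_X,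
    map_pair, map_pair]
  simp

/-- The generic unital series over the polynomial ring `ℤ[a i j]`. -/
def genericSeries : MvPowerSeries (Fin 2) (MvPolynomial (ℕ × ℕ) ℤ) :=
  unitalSeries MvPolynomial.X

theorem constantCoeff_genericSeries : genericSeries.constantCoeff = 0 :=
  constantCoeff_unitalSeries _

/-- The ideal of relations which make the generic unital series commutative and associative. -/
def relations : Ideal (MvPolynomial (ℕ × ℕ) ℤ) :=
  Ideal.span (Set.range (fun e => (commDefect genericSeries).coeff e) ∪
    Set.range (fun e => (assocDefect genericSeries).coeff e))

end Lazard

/-- The ring `MU_*`, as the ring carrying the universal commutative one-dimensional formal group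
law: it is generated by the coefficients of a formal group law, subject only to the relations
which express commutativity and associativity. (The coefficient ring of complex cobordism, with the
formal group law of its canonical orientation, is this pair: this is Quillen's theorem.) -/
def MU : Type := MvPolynomial (ℕ × ℕ) ℤ ⧸ Lazard.relations

namespace MU

instance : CommRing MU := inferInstanceAs (CommRing (MvPolynomial (ℕ × ℕ) ℤ ⧸ Lazard.relations))

/-- The quotient map from the polynomial ring on the coefficients. -/
def mk : MvPolynomial (ℕ × ℕ) ℤ →+* MU := Ideal.Quotient.mk Lazard.relations

theorem mk_surjective : Function.Surjective mk := Ideal.Quotient.mk_surjective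

theorem map_mk_commDefect : (Lazard.commDefect Lazard.genericSeries).map mk = 0 := by
  ext e
  rw [MvPowerSeries.coeff_map, map_zero]
  exact Ideal.Quotient.eq_zero_iff_mem.mpr (Ideal.subset_span (Or.inl ⟨e, rfl⟩))

theorem map_mk_assocDefect : (Lazard.assocDefect Lazard.genericSeries).map mk = 0 := by
  ext e
  rw [MvPowerSeries.coeff_map, map_zero]
  exact Ideal.Quotient.eq_zero_iff_mem.mpr (Ideal.subset_span (Or.inr ⟨e, rfl⟩))

/-- The universal formal group law `F^MU` over `MU_*`. -/
def F : FormalGroup MU where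
  toPowerSeries := Lazard.genericSeries.map mk
  zero_constantCoeff := by
    rw [MvPowerSeries.constantCoeff_map, Lazard.genericSeries, Lazard.constantCoeff_unitalSeries,
      map_zero]
  lin_coeff_X := by
    simp [Lazard.genericSeries, Lazard.coeff_unitalSeries]
  lin_coeff_Y := by
    simp [Lazard.genericSeries, Lazard.coeff_unitalSeries]
  assoc := by
    have h := map_mk_assocDefect
    rw [Lazard.map_assocDefect mk Lazard.constantCoeff_genericSeries] at h
    exact sub_eq_zero.mp h

instance : F.IsComm where
  comm := by
    have h := map_mk_commDefect
    rw [Lazard.map_commDefect mk] at h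
    exact (sub_eq_zero.mp h).symm

section classify

variable {R : Type*} [CommRing R]

theorem toPowerSeries_eq_unitalSeries (G : FormalGroup R) :
    G.toPowerSeries = Lazard.unitalSeries fun p =>
      G.toPowerSeries.coeff (Finsupp.single 0 (p.1 + 1) + Finsupp.single 1 (p.2 + 1)) := by
  ext e
  rw [Lazard.coeff_unitalSeries]
  split_ifs with h0 h1 h1 h2
  · have he : e = Finsupp.single 1 1 := Finsupp.ext fun i => by fin_cases i <;> simp [h0, h1]
    rw [he, G.lin_coeff_Y]
  · have he : e = Finsupp.single 1 (e 1) := Finsupp.ext fun i => by fin_cases i <;> simp [h0]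
    rw [he, ← FormalGroup.coeff_subst_zero_X]
    refine (congrArg _ G.zeroX_eq_X).trans ?_
    rw [PowerSeries.coeff_X, if_neg h1]
  · have he : e = Finsupp.single 0 1 := Finsupp.ext fun i => by fin_cases i <;> simp [h1, h2]
    rw [he, G.lin_coeff_X]
  · have he : e = Finsupp.single 0 (e 0) := Finsupp.ext fun i => by fin_cases i <;> simp [h1]
    rw [he, ← FormalGroup.coeff_subst_X_zero]
    refine (congrArg _ G.Xzero_eq_X).trans ?_
    rw [PowerSeries.coeff_X, if_neg h2]
  · congr 1
    refine congrArg _ (Finsupp.ext fun i => ?_)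
    fin_cases i
    · simp; omega
    · simp; omega

/-- Substitution of the coefficients of a formal group law for the generic coefficients. -/
def classifyPoly (G : FormalGroup R) : MvPolynomial (ℕ × ℕ) ℤ →+* R :=
  MvPolynomial.eval₂Hom (Int.castRingHom R) fun p =>
    G.toPowerSeries.coeff (Finsupp.single 0 (p.1 + 1) + Finsupp.single 1 (p.2 + 1))

theorem map_classifyPoly (G : FormalGroup R) :
    Lazard.genericSeries.map (classifyPoly G) = G.toPowerSeries := by
  rw [Lazard.genericSeries, Lazard.map_unitalSeries]
  conv_rhs => rw [toPowerSeries_eq_unitalSeries G]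
  simp [classifyPoly]

theorem classifyPoly_eq_zero (G : FormalGroup R) [G.IsComm] (p : MvPolynomial (ℕ × ℕ) ℤ)
    (hp : p ∈ Lazard.relations) : classifyPoly G p = 0 := by
  suffices h : Lazard.relations ≤ RingHom.ker (classifyPoly G) from h hp
  refine Ideal.span_le.mpr ?_
  rintro _ (⟨e, rfl⟩ | ⟨e, rfl⟩)
  · change classifyPoly G _ = 0
    rw [← MvPowerSeries.coeff_map, Lazard.map_commDefect, map_classifyPoly, Lazard.commDefect,
      ← FormalGroup.IsComm.comm, sub_self, map_zero]
  · change classifyPoly G _ = 0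
    rw [← MvPowerSeries.coeff_map,
      Lazard.map_assocDefect _ Lazard.constantCoeff_genericSeries, map_classifyPoly,
      Lazard.assocDefect, G.assoc, sub_self, map_zero]

/-- The ring homomorphism `MU_* → R` which classifies a commutative formal group law over `R`. -/
def classify (G : FormalGroup R) [G.IsComm] : MU →+* R :=
  Ideal.Quotient.lift Lazard.relations (classifyPoly G) (classifyPoly_eq_zero G)

theorem map_classify (G : FormalGroup R) [G.IsComm] : F.map (classify G) = G := by
  ext1
  have h : (classify G).comp mk = classifyPoly G := Ideal.Quotient.lift_comp_mk _ _ _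
  rw [← map_classifyPoly G, ← h]
  rfl

/-- Universality: the classifying homomorphism is the only one which carries `F^MU` to `G`. -/
theorem eq_classify (G : FormalGroup R) [G.IsComm] (f : MU →+* R) (hf : F.map f = G) :
    f = classify G := by
  have h (g : MU →+* R) (hg : F.map g = G) (p : ℕ × ℕ) : g (mk (MvPolynomial.X p)) =
      G.toPowerSeries.coeff (Finsupp.single 0 (p.1 + 1) + Finsupp.single 1 (p.2 + 1)) := by
    rw [← hg]
    simp [F, Lazard.genericSeries, Lazard.coeff_unitalSeries]
  have key : f.comp mk = (classify G).comp mk :=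
    MvPolynomial.ringHom_ext (by simp) fun p => by
      simp only [RingHom.comp_apply]
      rw [h f hf, h _ (map_classify G)]
  exact (RingHom.cancel_right mk_surjective).mp key

end classify

/-- `x` is homogeneous of (topological) degree `2n`: it lies in `MU_{2n}`. The coefficient of
`X ^ i Y ^ j` in `F^MU(X, Y)` lies in degree `2(i + j - 1)`. -/
def IsHomogeneous (n : ℕ) (x : MU) : Prop :=
  ∃ p : MvPolynomial (ℕ × ℕ) ℤ,
    MvPolynomial.IsWeightedHomogeneous (fun q : ℕ × ℕ => q.1 + q.2 + 1) p n ∧ mk p = x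

/-- `y 1, y 2, y 3, …` with `y n ∈ MU_{2n}` form a system of polynomial generators of `MU_*`,
i.e. `MU_* = ℤ[y 1, y 2, …]`. -/
structure IsPolynomialSystem (y : ℕ+ → MU) : Prop where
  homogeneous : ∀ n : ℕ+, IsHomogeneous n (y n)
  algebraicIndependent : AlgebraicIndependent ℤ y
  adjoin_eq_top : Algebra.adjoin ℤ (Set.range y) = ⊤

/-- `x ∈ MU_{2n}` is a polynomial generator of `MU_*`: it is the member of degree `2n` of some
system of polynomial generators. -/
def IsPolynomialGenerator (n : ℕ+) (x : MU) : Prop :=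
  ∃ y : ℕ+ → MU, IsPolynomialSystem y ∧ y n = x

/-! ### The coefficients of `v_ℓ f_ℓ (X)` -/

/-- `MU_*[ζ]`, where `ζ` is a primitive `ℓ`-th root of unity. -/
abbrev Cyclotomic (ℓ : ℕ+) : Type := AdjoinRoot (Polynomial.cyclotomic ℓ MU)

/-- The formal group law `F^MU` over `MU_*[ζ]`. -/
abbrev cyclotomicF (ℓ : ℕ+) : FormalGroup (Cyclotomic ℓ) :=
  F.map (AdjoinRoot.of (Polynomial.cyclotomic ℓ MU))

/-- The curve `v_ℓ f_ℓ (X)`: the formal group sum of `ζ X` over all `ℓ`-th roots of unity, for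
a prime number `ℓ`. -/
def verschiebungFrobenius (ℓ : ℕ+) : (cyclotomicF ℓ).Point Unit :=
  ∑ i ∈ Finset.range ℓ,
    (cyclotomicF ℓ).monomialPoint (AdjoinRoot.root (Polynomial.cyclotomic ℓ MU) ^ i) 1

/-- The elements `T 1, T 2, …` of `MU_*` are the coefficients of `v_ℓ f_ℓ (X)`:
the formal group sum of the `T k X ^ (kℓ)`, `k ≥ 1`, is `v_ℓ f_ℓ (X)`. -/
def IsVFCoefficients (ℓ : ℕ+) (T : ℕ+ → MU) : Prop :=
  (cyclotomicF ℓ).HasFormalSum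
    (fun k => (cyclotomicF ℓ).monomialPoint (AdjoinRoot.of _ (T k)) (k * ℓ))
    (verschiebungFrobenius ℓ)

/-- `X n ∈ MU_{2n}` are chosen polynomial generators of `MU_*` built from the coefficients `T ℓ k`:
if `n + 1 = ℓ ^ (d + 1)` is a power of a prime number `ℓ`, then `X n` is `T ℓ (ℓ ^ d)`; in all other
cases, `X n` is a polynomial generator which is an integral linear combination of `T ℓ₁ k₁` and
`T ℓ₂ k₂`, where `n + 1 = ℓ₁ k₁ = ℓ₂ k₂` for some distinct prime numbers `ℓ₁`, `ℓ₂`. -/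
structure IsKozmaChoice (T : ℕ+ → ℕ+ → MU) (X : ℕ+ → MU) : Prop where
  primePow : ∀ (ℓ : ℕ+) (d : ℕ) (n : ℕ+), ℓ.Prime → n + 1 = ℓ ^ (d + 1) → X n = T ℓ (ℓ ^ d)
  generator : ∀ n : ℕ+, ¬ IsPrimePow ((n : ℕ) + 1) → IsPolynomialGenerator n (X n)
  combination : ∀ n : ℕ+, ¬ IsPrimePow ((n : ℕ) + 1) → ∃ (ℓ₁ ℓ₂ k₁ k₂ : ℕ+) (a b : ℤ),
    ℓ₁.Prime ∧ ℓ₂.Prime ∧ ℓ₁ ≠ ℓ₂ ∧ n + 1 = ℓ₁ * k₁ ∧ n + 1 = ℓ₂ * k₂ ∧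
      X n = a • T ℓ₁ k₁ + b • T ℓ₂ k₂

/-! ### Inverting two -/

/-- The ring `ℤ[1/2]`. -/
def ZHalf : Type := Localization.Away (2 : ℤ)

instance : CommRing ZHalf := inferInstanceAs (CommRing (Localization.Away (2 : ℤ)))

instance : IsLocalization.Away (2 : ℤ) ZHalf := by
  have h : IsLocalization.Away (2 : ℤ) (Localization.Away (2 : ℤ)) := inferInstance
  have e : (OreLocalization.instAlgebra : Algebra ℤ (Localization.Away (2 : ℤ))) =
    (Ring.toIntAlgebra ZHalf : Algebra ℤ ZHalf) := Subsingleton.elim _ _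
  rw [e] at h
  exact h

/-- `MU[1/2]_* = ℤ[1/2] ⊗ MU_*`. -/
abbrev Half : Type := ZHalf ⊗[ℤ] MU

/-- The canonical homomorphism `MU_* → MU[1/2]_*`. -/
def toHalf : MU →+* Half := (Algebra.TensorProduct.includeRight : MU →ₐ[ℤ] Half).toRingHom

theorem isUnit_two : IsUnit (2 : Half) := by
  have h : IsUnit (2 : ZHalf) := by
    simpa using IsLocalization.Away.algebraMap_isUnit (S := ZHalf) (2 : ℤ)
  have h' := h.map (algebraMap ZHalf Half)
  rwa [map_ofNat] at h'

/-- The formal group law `F'(X, Y) = φ⁻¹(F(φ(X), φ(Y)))` over `MU[1/2]_*`. -/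
def oddF : FormalGroup Half := (F.map toHalf).oddification isUnit_two

instance : oddF.IsComm := FormalGroup.oddification_isComm _ _

/-- The endomorphism `ε₂` of `MU[1/2]_*`, the `ℤ[1/2]`-linear extension of the homomorphism
`MU_* → MU[1/2]_*` which classifies `F'`. -/
def epsilon : Half →ₐ[ZHalf] Half :=
  Algebra.TensorProduct.lift (Algebra.ofId ZHalf Half) (classify oddF).toIntAlgHom
    fun _ _ => Commute.all _ _

/-- The `ℤ[1/2]`-algebra `evMU_*`, the image of `ε₂`. -/
def ev : Subalgebra ZHalf Half := epsilon.range

end MU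

end

/-! Let m_n be the coefficient of X^n in the generic logarithm, so that m_1 = 1 and m_2, m_3, … are
the variables of a polynomial ring. The formal group law with this logarithm is classified by `toLog
ℤ : MU → ℤ[m_2, m_3, …]`, and everything is read off there. The `slope` of an element of degree 2(n
- 1) is the coefficient of m_n in its image, which is all that survives modulo decomposables.

A logarithm turns formal sums into sums, and orthogonality of roots of unity gives log(v_ℓ f_ℓ X) =
∑_{ℓ ∣ n} ℓ m_n X^n. Comparison with ∑ log(T_k X^{kℓ}) yields the recursion ∑_{k ∣ n} m_{n/k}
T_k^{n/k} = ℓ m_{nℓ} (`IsVFCoefficients.toLog_eq`). It determines the T_k, and shows that T_k has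
degree 2(kℓ - 1) and slope ℓ.

Which slopes belong to polynomial generators is Lazard's theorem, proved in the following form.
Homogeneous elements x_k, one in each degree 2(k + 1), generate `MU` if every slope is ±1, or
possibly ±p when k + 2 is a power of the prime p (`mk_mem_of_isWeightedHomogeneous`). Otherwise some
nonzero linear form modulo a prime would vanish on too many indecomposables. Such a form is a
symmetric cocycle, and these are proportional to a reduced binomial cocycle (`exists_coordinate`),
which does not vanish on x_k. Nonzero slopes also make the images algebraically independent
(`algebraicIndependent_of_coeff_ne_zero`), so such a family is a polynomial system and `toLog ℤ` is
injective. Admissible elements exist because the coefficients of v_ℓ f_ℓ descend from MU[ζ] and have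
slope ℓ; when two primes divide k + 2, Bézout gives slope 1. Properties 2 and 3 follow in the same
way.

For property 4, the logarithm of F' is the odd part of that of F. Hence ε₂ becomes the map that
kills m_n for even n (`halfToLog_classify_oddF`). An element of MU_{2n} with n odd has odd weight,
so each of its monomials contains a killed variable. If kℓ is odd, the recursion for T_{ℓ,k}
involves odd indices only. So ε₂ kills X_n for odd n and fixes every X_{2m}, and the latter are part
of a polynomial system. -/

noncomputable section

/-! ### Logarithms of formal group laws. -/

namespace FormalGroup

variable {R : Type*} [CommRing R] {S : Type*} [CommRing S] {σ : Type*}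

/-- `g` is a logarithm of the formal group law `F`: `g(X) = X + ⋯` and
`g(F(X, Y)) = g(X) + g(Y)`. -/
structure IsLog (F : FormalGroup R) (g : PowerSeries R) : Prop where
  constantCoeff : g.constantCoeff = 0
  coeff_one : PowerSeries.coeff 1 g = 1
  subst_eq : g.subst F.toPowerSeries =
    g.subst (MvPowerSeries.X 0 : MvPowerSeries (Fin 2) R) +
      g.subst (MvPowerSeries.X 1 : MvPowerSeries (Fin 2) R)

theorem hasSubst_toPowerSeries (F : FormalGroup R) : PowerSeries.HasSubst F.toPowerSeries :=
  PowerSeries.HasSubst.of_constantCoeff_zero F.zero_constantCoeff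

theorem IsLog.subst_add {F : FormalGroup R} {g : PowerSeries R} (h : F.IsLog g)
    {a b : MvPowerSeries σ R} (ha : PowerSeries.HasSubst a) (hb : PowerSeries.HasSubst b) :
    g.subst (F.toPowerSeries.subst ![a, b]) = g.subst a + g.subst b := by
  have hab := hasSubst_pair' ha hb
  rw [← subst_subst' g F.hasSubst_toPowerSeries hab, h.subst_eq, MvPowerSeries.subst_add hab,
    subst_subst' g (PowerSeries.HasSubst.X 0) hab, subst_subst' g (PowerSeries.HasSubst.X 1) hab,
    MvPowerSeries.subst_X hab, MvPowerSeries.subst_X hab]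
  rfl

theorem IsLog.subst_injective {F : FormalGroup R} {g : PowerSeries R} (h : F.IsLog g)
    {a b : MvPowerSeries σ R} (ha : PowerSeries.HasSubst a) (hb : PowerSeries.HasSubst b)
    (hab : g.subst a = g.subst b) : a = b := by
  rw [← compInv_subst h.constantCoeff h.coeff_one ha, hab,
    compInv_subst h.constantCoeff h.coeff_one hb]

/-- A logarithm has a compositional inverse, so it determines the law. Homomorphisms out of `MU` are
later compared through the logarithms of the laws they classify. -/
theorem IsLog.unique {F G : FormalGroup R} {g : PowerSeries R} (h : F.IsLog g) (h' : G.IsLog g) :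
    F = G :=
  FormalGroup.ext (h.subst_injective F.hasSubst_toPowerSeries G.hasSubst_toPowerSeries
    (h.subst_eq.trans h'.subst_eq.symm))

theorem IsLog.map {F : FormalGroup R} {g : PowerSeries R} (h : F.IsLog g) (f : R →+* S) :
    (F.map f).IsLog (g.map f) where
  constantCoeff := by
    rw [← PowerSeries.coeff_zero_eq_constantCoeff_apply, PowerSeries.coeff_map,
      PowerSeries.coeff_zero_eq_constantCoeff_apply, h.constantCoeff, map_zero]
  coeff_one := by rw [PowerSeries.coeff_map, h.coeff_one, map_one]
  subst_eq := by
    have := congrArg (MvPowerSeries.map f) h.subst_eq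
    rw [map_add, PowerSeries.map_subst F.hasSubst_toPowerSeries,
      PowerSeries.map_subst (PowerSeries.HasSubst.X 0),
      PowerSeries.map_subst (PowerSeries.HasSubst.X 1)] at this
    simpa using this

/-- The formal group law with a given logarithm. -/
def ofLog (g : PowerSeries R) (h0 : g.constantCoeff = 0) (h1 : PowerSeries.coeff 1 g = 1) :
    FormalGroup R :=
  𝔾ₐ.conj g h0 h1

instance (g : PowerSeries R) (h0 : g.constantCoeff = 0) (h1 : PowerSeries.coeff 1 g = 1) :
    (ofLog g h0 h1).IsComm := by
  unfold ofLog; infer_instance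

theorem isLog_ofLog (g : PowerSeries R) (h0 : g.constantCoeff = 0)
    (h1 : PowerSeries.coeff 1 g = 1) : (ofLog g h0 h1).IsLog g where
  constantCoeff := h0
  coeff_one := h1
  subst_eq := by
    have hX (i : Fin 2) :
        PowerSeries.HasSubst (g.subst (MvPowerSeries.X i : MvPowerSeries (Fin 2) R)) :=
      hasSubst_subst h0 (PowerSeries.HasSubst.X i)
    change g.subst (conjSeries 𝔾ₐ g h1) = _
    rw [conjSeries, subst_compInv h0 h1 (𝔾ₐ.hasSubst_add (hX 0) (hX 1))]
    have hab := hasSubst_pair' (hX 0) (hX 1)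
    simp [MvPowerSeries.subst_add hab, MvPowerSeries.subst_X hab]

/-- `F(X, Y) = X + Y + X Y H(X, Y)`. -/
theorem exists_toPowerSeries_eq (F : FormalGroup R) : ∃ H : MvPowerSeries (Fin 2) R,
    F.toPowerSeries = MvPowerSeries.X 0 + MvPowerSeries.X 1 +
      MvPowerSeries.X 0 * MvPowerSeries.X 1 * H := by
  classical
  obtain ⟨H, hH⟩ : ∃ H : MvPowerSeries (Fin 2) R, ∀ e, H.coeff e =
      F.toPowerSeries.coeff (e + Finsupp.single 0 1 + Finsupp.single 1 1) :=
    ⟨fun e => F.toPowerSeries.coeff (e + Finsupp.single 0 1 + Finsupp.single 1 1), fun _ => rfl⟩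
  refine ⟨H, ?_⟩
  ext e
  rw [MU.toPowerSeries_eq_unitalSeries F, Lazard.coeff_unitalSeries, map_add, map_add,
    MvPowerSeries.coeff_X, MvPowerSeries.coeff_X, MvPowerSeries.X, MvPowerSeries.X,
    MvPowerSeries.monomial_mul_monomial, MvPowerSeries.coeff_monomial_mul]
  have hle : (Finsupp.single 0 1 + Finsupp.single 1 1 : Fin 2 →₀ ℕ) ≤ e ↔ e 0 ≠ 0 ∧ e 1 ≠ 0 := by
    rw [Finsupp.le_def, Fin.forall_fin_two]
    simp [Nat.one_le_iff_ne_zero]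
  have hs (i : Fin 2) : e = Finsupp.single i 1 ↔ e i = 1 ∧ e (1 - i) = 0 := by
    constructor
    · rintro rfl; fin_cases i <;> simp
    · rintro ⟨h1, h2⟩
      ext j
      fin_cases i <;> fin_cases j <;> simp_all
  simp only [hle, hs]
  by_cases h0 : e 0 = 0
  · simp [h0]
  · by_cases h1 : e 1 = 0
    · simp [h0, h1]
    · have he : e - (Finsupp.single 0 1 + Finsupp.single 1 1) + Finsupp.single 0 1 +
          Finsupp.single 1 1 = Finsupp.single 0 (e 0 - 1 + 1) + Finsupp.single 1 (e 1 - 1 + 1) := by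
        ext j
        fin_cases j <;> simp
      simp [h0, h1, hH, he]

theorem exists_subst_eq (F : FormalGroup R) {a b : MvPowerSeries σ R}
    (ha : PowerSeries.HasSubst a) (hb : PowerSeries.HasSubst b) : ∃ c : MvPowerSeries σ R,
    F.toPowerSeries.subst ![a, b] = a + b + a * b * c := by
  obtain ⟨H, hH⟩ := F.exists_toPowerSeries_eq
  have hab := hasSubst_pair' ha hb
  refine ⟨H.subst ![a, b], ?_⟩
  rw [hH]
  simp only [MvPowerSeries.subst_add hab, MvPowerSeries.subst_mul hab, MvPowerSeries.subst_X hab]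
  rfl

end FormalGroup
end

/-! ### Homogeneity detected by rescaling with 2. -/

noncomputable section

namespace MvPowerSeries

variable {R : Type*} [CommRing R] {σ τ : Type*}

theorem rescale_subst (c : τ → R) {a : σ → MvPowerSeries τ R} (ha : HasSubst a)
    (f : MvPowerSeries σ R) :
    rescale c (f.subst a) = f.subst fun i => rescale c (a i) := by
  rw [rescale_eq_subst, subst_comp_subst_apply ha (HasSubst.smul_X c)]
  simp only [rescale_eq_subst]

theorem subst_rescale (c : σ → R) {a : σ → MvPowerSeries τ R} (ha : HasSubst a)
    (f : MvPowerSeries σ R) :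
    (rescale c f).subst a = f.subst fun i => c i • a i := by
  rw [rescale_eq_subst, subst_comp_subst_apply (HasSubst.smul_X c) ha]
  congr 1
  funext i
  rw [Pi.smul_apply', subst_smul ha, subst_X ha]

theorem coeff_rescale_const (r : R) (f : MvPowerSeries σ R) (e : σ →₀ ℕ) :
    coeff e (rescale (fun _ => r) f) = r ^ e.degree * coeff e f := by
  rw [coeff_rescale, Finsupp.prod, Finset.prod_pow_eq_pow_sum, Finsupp.degree_apply]

theorem rescale_X (c : σ → R) (i : σ) : rescale c (X i : MvPowerSeries σ R) = c i • X i := by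
  rw [rescale_eq_subst, subst_X (HasSubst.smul_X c), Pi.smul_apply']

end MvPowerSeries

namespace PowerSeries

variable {R : Type*} [CommRing R] {τ : Type*}

theorem subst_rescale (r : R) {a : MvPowerSeries τ R} (ha : HasSubst a) (f : PowerSeries R) :
    (rescale r f).subst a = f.subst (r • a) := by
  rw [rescale_eq, PowerSeries.subst, MvPowerSeries.subst_rescale _ ha.const]
  rfl

end PowerSeries

namespace MvPolynomial

variable {σ : Type*}

/-- The endomorphism which multiplies a polynomial of weight `m` by `2 ^ m`. -/
def weightDilation (w : σ → ℕ) : MvPolynomial σ ℤ →+* MvPolynomial σ ℤ :=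
  (aeval fun i => C (2 ^ w i) * X i : MvPolynomial σ ℤ →ₐ[ℤ] MvPolynomial σ ℤ).toRingHom

theorem weightDilation_X (w : σ → ℕ) (i : σ) : weightDilation w (X i) = 2 ^ w i * X i := by
  simp [weightDilation]

theorem coeff_weightDilation (w : σ → ℕ) (q : MvPolynomial σ ℤ) (d : σ →₀ ℕ) :
    coeff d (weightDilation w q) = 2 ^ Finsupp.weight w d * coeff d q := by
  classical
  induction q using MvPolynomial.induction_on' with
  | monomial e r =>
    have : weightDilation w (monomial e r) = monomial e (2 ^ Finsupp.weight w e * r) := by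
      simp only [weightDilation, AlgHom.toRingHom_eq_coe, RingHom.coe_coe, aeval_monomial,
        mul_pow, Finsupp.prod_mul]
      rw [monomial_eq (a := 2 ^ _ * r), C_mul, algebraMap_eq, mul_comm (C (2 ^ _)) (C r), mul_assoc]
      congr 2
      rw [Finsupp.weight_apply, Finsupp.sum, ← Finset.prod_pow_eq_pow_sum, map_prod]
      refine Finset.prod_congr rfl fun i _ => ?_
      change C (2 ^ w i) ^ e i = _
      rw [← C_pow, ← pow_mul, smul_eq_mul, mul_comm]
    rw [this, coeff_monomial, coeff_monomial]
    split_ifs with h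
    · rw [h]
    · simp
  | add p q hp hq => rw [map_add, coeff_add, hp, hq, coeff_add, mul_add]

/-- Distinct powers of 2 are distinct in ℤ, so an eigenvector of the dilation lives in one weight.
This replaces bookkeeping of monomials by a functional equation that passes through substitutions.
-/
theorem isWeightedHomogeneous_of_weightDilation {w : σ → ℕ} {q : MvPolynomial σ ℤ} {m : ℕ}
    (h : weightDilation w q = 2 ^ m * q) : IsWeightedHomogeneous w q m := by
  intro d hd
  have h' := congrArg (coeff d) h
  rw [coeff_weightDilation, show (2 : MvPolynomial σ ℤ) ^ m = C (2 ^ m) by simp, coeff_C_mul] at h'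
  exact Nat.pow_right_injective le_rfl (by exact_mod_cast mul_right_cancel₀ hd h')

/-- If `2 ρ(f) (X) = f(2X)`, where `ρ` is the dilation by powers of two, then the coefficients of
degree `m + 1` in `f` have weight `m`. -/
theorem isWeightedHomogeneous_coeff {τ : Type*} {w : σ → ℕ}
    {f : MvPowerSeries τ (MvPolynomial σ ℤ)}
    (h : (2 : MvPolynomial σ ℤ) • f.map (weightDilation w) = MvPowerSeries.rescale (fun _ => 2) f)
    {e : τ →₀ ℕ} {m : ℕ} (he : e.degree = m + 1) : IsWeightedHomogeneous w (f.coeff e) m := by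
  have h' := congrArg (MvPowerSeries.coeff e) h
  rw [map_smul, MvPowerSeries.coeff_map, MvPowerSeries.coeff_rescale_const, he, pow_succ', mul_assoc,
    smul_eq_mul] at h'
  exact isWeightedHomogeneous_of_weightDilation (mul_left_cancel₀ two_ne_zero h')

end MvPolynomial

/-! ### Weights of the associativity relations. -/

namespace Lazard

open MvPolynomial

/-- The weight of the coefficient of `X ^ (i+1) Y ^ (j+1)`. -/
abbrev weight (p : ℕ × ℕ) : ℕ := p.1 + p.2 + 1

theorem smul_map_weightDilation_genericSeries :
    (2 : MvPolynomial (ℕ × ℕ) ℤ) • genericSeries.map (weightDilation weight) =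
      MvPowerSeries.rescale (fun _ => 2) genericSeries := by
  ext1 e
  rw [map_smul, MvPowerSeries.coeff_rescale_const, genericSeries, map_unitalSeries,
    coeff_unitalSeries, coeff_unitalSeries, Finsupp.degree_eq_sum, Fin.sum_univ_two]
  split_ifs with h0 h1 h1 h2
  · simp [h0, h1]
  · simp
  · simp [h1, h2]
  · simp
  · rw [weightDilation_X, smul_eq_mul, ← mul_assoc, ← pow_succ']
    congr 2
    simp only [weight]
    omega

/-- With ρ the dilation, the equation 2 ρ(G)(X, Y) = G(2X, 2Y) for the generic series is inherited
by both iterated substitutions. -/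
theorem isWeightedHomogeneous_coeff_assocDefect {e : Fin 3 →₀ ℕ} {m : ℕ}
    (he : e.degree = m + 1) :
    IsWeightedHomogeneous weight ((assocDefect genericSeries).coeff e) m := by
  refine isWeightedHomogeneous_coeff ?_ he
  have hG := smul_map_weightDilation_genericSeries
  have hG0 := constantCoeff_genericSeries
  set G := genericSeries
  rw [map_assocDefect _ hG0]
  set G' := G.map (weightDilation weight) with hG'
  have hG'0 : G'.constantCoeff = 0 := by
    rw [hG', MvPowerSeries.constantCoeff_map, hG0, map_zero]
  have key {a b : MvPowerSeries (Fin 3) (MvPolynomial (ℕ × ℕ) ℤ)}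
      (hab : MvPowerSeries.HasSubst ![a, b]) :
      (2 : MvPolynomial (ℕ × ℕ) ℤ) • G'.subst ![a, b] =
        G.subst ![(2 : MvPolynomial (ℕ × ℕ) ℤ) • a, (2 : MvPolynomial (ℕ × ℕ) ℤ) • b] := by
    rw [← MvPowerSeries.subst_smul hab, hG, MvPowerSeries.subst_rescale _ hab]
    congr 1
    funext i
    fin_cases i <;> rfl
  have key' {a b : MvPowerSeries (Fin 3) (MvPolynomial (ℕ × ℕ) ℤ)}
      (hab : MvPowerSeries.HasSubst ![a, b]) :
      MvPowerSeries.rescale (fun _ => 2) (G.subst ![a, b]) =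
        G.subst ![MvPowerSeries.rescale (fun _ => 2) a, MvPowerSeries.rescale (fun _ => 2) b] := by
    rw [MvPowerSeries.rescale_subst _ hab]
    congr 1
    funext i
    fin_cases i <;> rfl
  rw [assocDefect, assocDefect, smul_sub, map_sub,
    key (MvPowerSeries.HasSubst.cons_subst_zero_left 0 1 2 hG'0),
    key (MvPowerSeries.HasSubst.cons_subst_zero_right 0 1 2 hG'0),
    key MvPowerSeries.HasSubst.X_X, key MvPowerSeries.HasSubst.X_X,
    key' (MvPowerSeries.HasSubst.cons_subst_zero_left 0 1 2 hG0),
    key' (MvPowerSeries.HasSubst.cons_subst_zero_right 0 1 2 hG0),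
    key' MvPowerSeries.HasSubst.X_X, key' MvPowerSeries.HasSubst.X_X]
  simp only [MvPowerSeries.rescale_X]

/-! ### The universal logarithm -/

/-- The generic logarithm `X + b₀ X² + b₁ X³ + ⋯`. -/
def genericLog (K : Type*) [CommRing K] : PowerSeries (MvPolynomial ℕ K) :=
  PowerSeries.mk fun n => if n = 0 then 0 else if n = 1 then 1 else X (n - 2)

section

variable (K : Type*) [CommRing K]

theorem coeff_genericLog (n : ℕ) : PowerSeries.coeff n (genericLog K) =
    if n = 0 then 0 else if n = 1 then 1 else X (n - 2) := PowerSeries.coeff_mk _ _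

theorem constantCoeff_genericLog : (genericLog K).constantCoeff = 0 := by
  rw [← PowerSeries.coeff_zero_eq_constantCoeff_apply, coeff_genericLog, if_pos rfl]

theorem coeff_one_genericLog : PowerSeries.coeff 1 (genericLog K) = 1 := by
  rw [coeff_genericLog, if_neg one_ne_zero, if_pos rfl]

/-- The formal group law with the generic logarithm. -/
def logF : FormalGroup (MvPolynomial ℕ K) :=
  FormalGroup.ofLog (genericLog K) (constantCoeff_genericLog K) (coeff_one_genericLog K)

instance : (logF K).IsComm := by unfold logF; infer_instance

theorem isLog_logF : (logF K).IsLog (genericLog K) := FormalGroup.isLog_ofLog _ _ _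

end

/-- The weight of the coefficient of `X ^ (k+2)` in the generic logarithm. -/
abbrev logWeight (k : ℕ) : ℕ := k + 1

/-- With ρ the dilation, the generic logarithm satisfies 2 ρ(g)(X) = g(2X). Hence 2 ρ(F)(X, Y) and
F(2X, 2Y) have the same image under g, which is injective. -/
theorem isWeightedHomogeneous_coeff_logF {e : Fin 2 →₀ ℕ} {m : ℕ} (he : e.degree = m + 1) :
    IsWeightedHomogeneous logWeight ((logF ℤ).toPowerSeries.coeff e) m := by
  refine isWeightedHomogeneous_coeff ?_ he
  have hF := isLog_logF ℤ
  set F := logF ℤ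
  set g := genericLog ℤ with hg
  have hF' := hF.map (weightDilation logWeight)
  set F' := F.map (weightDilation logWeight) with hF'def
  set g' := g.map (weightDilation logWeight) with hg'
  have hgg : (2 : MvPolynomial ℕ ℤ) • g' = PowerSeries.rescale 2 g := by
    ext1 n
    rw [map_smul, PowerSeries.coeff_rescale, hg', PowerSeries.coeff_map, hg, coeff_genericLog]
    split_ifs with h0 h1
    · simp
    · simp [h1]
    · rw [weightDilation_X, smul_eq_mul, ← mul_assoc, ← pow_succ']
      congr 2
      simp only [logWeight]
      omega
  have hsub {a : MvPowerSeries (Fin 2) (MvPolynomial ℕ ℤ)} (ha : PowerSeries.HasSubst a) :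
      g.subst ((2 : MvPolynomial ℕ ℤ) • a) = (2 : MvPolynomial ℕ ℤ) • g'.subst a := by
    rw [← PowerSeries.subst_rescale _ ha, ← hgg, PowerSeries.subst_smul ha]
  have hX (i : Fin 2) := PowerSeries.HasSubst.X (S := MvPolynomial ℕ ℤ) i
  have h2 (a : MvPowerSeries (Fin 2) (MvPolynomial ℕ ℤ)) (ha : PowerSeries.HasSubst a) :
      PowerSeries.HasSubst ((2 : MvPolynomial ℕ ℤ) • a) := ha.smul' _
  have hr : MvPowerSeries.rescale (fun _ => 2) F.toPowerSeries =
      F.toPowerSeries.subst ![(2 : MvPolynomial ℕ ℤ) • MvPowerSeries.X 0,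
        (2 : MvPolynomial ℕ ℤ) • MvPowerSeries.X 1] := by
    rw [MvPowerSeries.rescale_eq_subst]
    congr 1
    funext i
    fin_cases i <;> rfl
  change (2 : MvPolynomial ℕ ℤ) • F'.toPowerSeries = _
  rw [hr]
  refine hF.subst_injective (h2 _ F'.hasSubst_toPowerSeries)
    (F.hasSubst_add (h2 _ (hX 0)) (h2 _ (hX 1))) ?_
  rw [hF.subst_add (h2 _ (hX 0)) (h2 _ (hX 1)), hsub F'.hasSubst_toPowerSeries, hsub (hX 0),
    hsub (hX 1), hF'.subst_eq, smul_add]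

end Lazard

/-! ### The map from `MU` to the coefficient ring of the generic logarithm. -/

namespace MU

open Lazard MvPolynomial

/-- The homomorphism which classifies the formal group law with the generic logarithm. -/
def toLog (K : Type*) [CommRing K] : MU →+* MvPolynomial ℕ K := classify (logF K)

theorem isLog_map_toLog (K : Type*) [CommRing K] : (F.map (toLog K)).IsLog (genericLog K) := by
  rw [toLog, map_classify]
  exact isLog_logF K

theorem map_comp {R S : Type*} [CommRing R] [CommRing S] (f : MU →+* R) (g : R →+* S) :
    F.map (g.comp f) = (F.map f).map g := by
  ext1
  change MvPowerSeries.map (g.comp f) _ = MvPowerSeries.map g (MvPowerSeries.map f _)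
  rw [MvPowerSeries.map_map]

theorem hom_ext {R : Type*} [CommRing R] {f g : MU →+* R} (h : F.map f = F.map g) : f = g := by
  rw [eq_classify (F.map g) f h, ← eq_classify (F.map g) g rfl]

theorem map_mk_X {R : Type*} [CommRing R] (f : MU →+* R) (p : ℕ × ℕ) : f (mk (X p)) =
    (F.map f).toPowerSeries.coeff (Finsupp.single 0 (p.1 + 1) + Finsupp.single 1 (p.2 + 1)) := by
  simp [F, Lazard.genericSeries, Lazard.coeff_unitalSeries]

theorem isWeightedHomogeneous_toLog_mk {n : ℕ} {q : MvPolynomial (ℕ × ℕ) ℤ}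
    (hq : IsWeightedHomogeneous Lazard.weight q n) :
    IsWeightedHomogeneous logWeight (toLog ℤ (mk q)) n := by
  have hX (p : ℕ × ℕ) : IsWeightedHomogeneous logWeight (toLog ℤ (mk (X p))) (Lazard.weight p) := by
    rw [map_mk_X, toLog, map_classify]
    refine isWeightedHomogeneous_coeff_logF ?_
    simp only [map_add, Finsupp.degree_single, Lazard.weight]
    omega
  rw [q.as_sum, map_sum, map_sum]
  refine IsWeightedHomogeneous.sum _ _ _ fun d hd => ?_
  rw [← hq (mem_support_iff.mp hd), monomial_eq, map_mul, map_mul]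
  have hC : toLog ℤ (mk (C (coeff d q))) = C (coeff d q) := by
    simp
  rw [hC]
  refine IsWeightedHomogeneous.C_mul ?_ _
  rw [Finsupp.prod, map_prod, map_prod, Finsupp.weight_apply, Finsupp.sum]
  refine IsWeightedHomogeneous.prod _ _ _ fun p _ => ?_
  rw [map_pow, map_pow]
  exact (hX p).pow _

theorem IsHomogeneous.toLog {n : ℕ} {x : MU} (hx : IsHomogeneous n x) :
    IsWeightedHomogeneous logWeight (toLog ℤ x) n := by
  obtain ⟨q, hq, rfl⟩ := hx
  exact isWeightedHomogeneous_toLog_mk hq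

end MU
end

noncomputable section

/-! ### Linearization -/

namespace DualNumber

variable {A : Type*} [CommRing A]

/-- The homomorphism `DualNumber A → A` which kills `ε`. -/
def fstRingHom (A : Type*) [CommRing A] : DualNumber A →+* A :=
  (TrivSqZeroExt.fstHom A A A).toRingHom

theorem fstRingHom_apply (x : DualNumber A) : fstRingHom A x = x.fst := rfl

theorem snd_coeff_eps_smul {σ : Type*} (f : MvPowerSeries σ (DualNumber A)) (e : σ →₀ ℕ) :
    TrivSqZeroExt.snd (((DualNumber.eps : DualNumber A) • f).coeff e) =
      (f.map (fstRingHom A)).coeff e := by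
  simp [fstRingHom_apply]

/-- Since ε² = 0, a multiple of ε only sees the other factor modulo ε. -/
theorem eps_smul_congr {σ : Type*} {f g : MvPowerSeries σ (DualNumber A)}
    (h : f.map (fstRingHom A) = g.map (fstRingHom A)) :
    (DualNumber.eps : DualNumber A) • f = (DualNumber.eps : DualNumber A) • g := by
  ext e
  · simp
  · rw [snd_coeff_eps_smul, snd_coeff_eps_smul, h]

end DualNumber

namespace MvPolynomial

variable {τ A : Type*} [CommRing A]

/-- The homomorphism to the dual numbers given by a linear form `c` on the variables. -/
def toDual (c : τ → A) : MvPolynomial τ ℤ →+* DualNumber A :=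
  eval₂Hom (Int.castRingHom _) fun p => TrivSqZeroExt.inr (c p)

theorem toDual_X (c : τ → A) (p : τ) : toDual c (X p) = TrivSqZeroExt.inr (c p) := by
  simp [toDual]

theorem toDual_eq (c : τ → A) (f : MvPolynomial τ ℤ →+* DualNumber A)
    (hf : ∀ p, f (X p) = TrivSqZeroExt.inr (c p)) : f = toDual c :=
  ringHom_ext (by simp) fun p => by rw [hf, toDual_X]

/-- Weighted homogeneous polynomials of positive weight are generated by the variables and by
products of polynomials of smaller positive weight. -/
theorem IsWeightedHomogeneous.induction_weight {w : τ → ℕ} (hw : ∀ p, 0 < w p)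
    {n : ℕ} (hn : 0 < n) {Z : AddSubgroup (MvPolynomial τ ℤ)}
    (hX : ∀ p, w p = n → X p ∈ Z)
    (hmul : ∀ (a b : ℕ) (f g : MvPolynomial τ ℤ), 0 < a → 0 < b → a + b = n →
      IsWeightedHomogeneous w f a → IsWeightedHomogeneous w g b → f * g ∈ Z)
    {q : MvPolynomial τ ℤ} (hq : IsWeightedHomogeneous w q n) : q ∈ Z := by
  classical
  rw [q.as_sum]
  refine AddSubgroup.sum_mem _ fun d hd => ?_
  have hdn := hq (mem_support_iff.mp hd)
  have hd0 : d ≠ 0 := by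
    rintro rfl
    simp at hdn
    omega
  obtain ⟨p, hp⟩ := Finsupp.ne_iff.mp hd0
  have hsplit : d = Finsupp.single p 1 + (d - Finsupp.single p 1) := by
    ext r
    by_cases hr : p = r
    · subst hr
      simp only [Finsupp.coe_zero, Pi.zero_apply] at hp
      simp
      omega
    · simp [Finsupp.single_eq_of_ne (Ne.symm hr)]
  set d' := d - Finsupp.single p 1
  have hwd : w p + Finsupp.weight w d' = n := by
    rw [← hdn, hsplit, map_add, Finsupp.weight_single, one_smul]
  by_cases hd' : d' = 0
  · have h1 : monomial d (coeff d q) = coeff d q • (X p : MvPolynomial τ ℤ) := by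
      rw [hsplit, hd', _root_.add_zero, X, smul_monomial, smul_eq_mul, mul_one]
    rw [h1]
    refine AddSubgroup.zsmul_mem _ (hX p ?_) _
    rw [← hwd, hd', map_zero, _root_.add_zero]
  · have h1 : monomial d (coeff d q) = X p * monomial d' (coeff d q) := by
      rw [X, monomial_mul, one_mul, ← hsplit]
    rw [h1]
    refine hmul (w p) (Finsupp.weight w d') _ _ (hw p) ?_ hwd (isWeightedHomogeneous_X _ _ _)
      (isWeightedHomogeneous_monomial _ _ _ rfl)
    obtain ⟨r, hr⟩ := Finsupp.ne_iff.mp hd'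
    exact (hw r).trans_le (Finsupp.le_weight_of_ne_zero' w hr)

theorem fst_toDual_of_pos {w : τ → ℕ} (c : τ → A) {n : ℕ} (hn : 0 < n) {q : MvPolynomial τ ℤ}
    (hq : IsWeightedHomogeneous w q n) : (toDual c q).fst = 0 := by
  have h : ((TrivSqZeroExt.fstHom A A A).toRingHom.comp (toDual c)) =
      (Int.castRingHom A).comp constantCoeff :=
    ringHom_ext (by simp) fun p => by simp [toDual_X]
  have h' := RingHom.congr_fun h q
  have h0 : constantCoeff q = 0 := by
    by_contra h0
    have := hq (d := 0) h0
    simp at this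
    omega
  simpa [h0] using h'

/-- Both factors land in the ideal (ε), whose square is zero: `toDual c` forgets decomposables. -/
theorem toDual_mul_of_pos {w : τ → ℕ} (c : τ → A) {a b : ℕ} (ha : 0 < a) (hb : 0 < b)
    {f g : MvPolynomial τ ℤ} (hf : IsWeightedHomogeneous w f a)
    (hg : IsWeightedHomogeneous w g b) : toDual c (f * g) = 0 := by
  rw [map_mul]
  ext <;> simp [fst_toDual_of_pos c ha hf, fst_toDual_of_pos c hb hg]

end MvPolynomial

namespace MU

open Lazard MvPolynomial

/-- The homomorphism `MU_* → ℤ[ε]` which sends the coefficient of `X ^ (k+2)` in the logarithm to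
`ε`, and all the other coefficients to zero. -/
def linearize (k : ℕ) : MU →+* DualNumber ℤ :=
  (toDual fun j => if j = k then 1 else 0).comp (toLog ℤ)

/-- The coefficient of the generator of degree `2(k+1)` in the image of `x` in the ring of
coefficients of the logarithm, modulo decomposables. -/
def slope (k : ℕ) (x : MU) : ℤ := (linearize k x).snd

theorem slope_add (k : ℕ) (x y : MU) : slope k (x + y) = slope k x + slope k y := by
  simp [slope]

theorem slope_zsmul (k : ℕ) (a : ℤ) (x : MU) : slope k (a • x) = a * slope k x := by
  simp [slope]

/-- The logarithm becomes X + ε X^(k+2), and F is X + Y modulo ε. Hence F = X + Y + ε (X^(k+2) +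
Y^(k+2) - (X + Y)^(k+2)), and the mixed coefficients are negated binomial coefficients. -/
theorem linearize_mk_X (k : ℕ) (p : ℕ × ℕ) : linearize k (mk (X p)) =
    TrivSqZeroExt.inr (if p.1 + p.2 = k then -((k + 2).choose (p.1 + 1) : ℤ) else 0) := by
  set f : MvPolynomial ℕ ℤ →+* DualNumber ℤ := toDual fun j => if j = k then 1 else 0 with hf
  have hlog := (isLog_map_toLog ℤ).map f
  rw [← map_comp] at hlog
  have hg : (genericLog ℤ).map f =
      PowerSeries.X + (DualNumber.eps : DualNumber ℤ) • PowerSeries.X ^ (k + 2) := by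
    ext1 n
    rw [PowerSeries.coeff_map, coeff_genericLog, map_add, map_smul, PowerSeries.coeff_X,
      PowerSeries.coeff_X_pow]
    rcases n with _ | _ | n
    · simp
    · simp
    · by_cases hn : n = k
      · subst hn
        simp [hf, toDual_X]
      · simp [hf, toDual_X, hn]
  set G := F.map (f.comp (toLog ℤ)) with hG
  have hkey : ∀ {a : MvPowerSeries (Fin 2) (DualNumber ℤ)}, PowerSeries.HasSubst a →
      ((genericLog ℤ).map f).subst a = a + (DualNumber.eps : DualNumber ℤ) • a ^ (k + 2) := by
    intro a ha
    rw [hg, PowerSeries.subst_add ha, PowerSeries.subst_smul ha, PowerSeries.subst_pow ha,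
      PowerSeries.subst_X ha]
  have h := hlog.subst_eq
  rw [hkey G.hasSubst_toPowerSeries, hkey (PowerSeries.HasSubst.X 0),
    hkey (PowerSeries.HasSubst.X 1)] at h
  have hfst : G.toPowerSeries.map (DualNumber.fstRingHom ℤ) =
      MvPowerSeries.X 0 + MvPowerSeries.X 1 := by
    have h' := congrArg (MvPowerSeries.map (DualNumber.fstRingHom ℤ)) h
    have h0 : DualNumber.fstRingHom ℤ DualNumber.eps = 0 := by
      simp [DualNumber.fstRingHom_apply]
    simpa [MvPowerSeries.smul_eq_C_mul, h0] using h'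
  have hcoeff := congrArg (fun s => TrivSqZeroExt.snd (MvPowerSeries.coeff
    (Finsupp.single 0 (p.1 + 1) + Finsupp.single 1 (p.2 + 1)) s)) h
  have hXne (i : Fin 2) : (Finsupp.single 0 (p.1 + 1) + Finsupp.single 1 (p.2 + 1) : Fin 2 →₀ ℕ) ≠
      Finsupp.single i 1 := by
    intro h
    have h0 := DFunLike.congr_fun h 0
    have h1 := DFunLike.congr_fun h 1
    fin_cases i <;> simp at h0 h1
  have hXne' (i : Fin 2) : (Finsupp.single 0 (p.1 + 1) + Finsupp.single 1 (p.2 + 1) : Fin 2 →₀ ℕ) ≠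
      Finsupp.single i (k + 2) := by
    intro h
    have h0 := DFunLike.congr_fun h 0
    have h1 := DFunLike.congr_fun h 1
    fin_cases i <;> simp at h0 h1
  have hpow := PowerSeries.coeff_subst_X_zero_add_X_one (R := ℤ) (PowerSeries.X ^ (k + 2))
    (Finsupp.single 0 (p.1 + 1) + Finsupp.single 1 (p.2 + 1))
  have hs : PowerSeries.HasSubst
      (MvPowerSeries.X 0 + MvPowerSeries.X 1 : MvPowerSeries (Fin 2) ℤ) :=
    (PowerSeries.HasSubst.X 0).add (PowerSeries.HasSubst.X 1)
  rw [PowerSeries.subst_pow hs, PowerSeries.subst_X hs, PowerSeries.coeff_X_pow] at hpow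
  simp only [map_add, TrivSqZeroExt.snd_add, DualNumber.snd_coeff_eps_smul, map_pow, hfst, hpow,
    MvPowerSeries.map_X, MvPowerSeries.coeff_X_pow, MvPowerSeries.coeff_X, hXne, hXne',
    if_false] at hcoeff
  rw [linearize, map_mk_X, ← hG]
  ext
  · have := congrArg (MvPowerSeries.coeff
      (Finsupp.single 0 (p.1 + 1) + Finsupp.single 1 (p.2 + 1))) hfst
    rw [MvPowerSeries.coeff_map, DualNumber.fstRingHom_apply, map_add, MvPowerSeries.coeff_X,
      MvPowerSeries.coeff_X, if_neg (hXne 0), if_neg (hXne 1)] at this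
    rw [this, add_zero, TrivSqZeroExt.fst_inr]
  · by_cases hp : p.1 + p.2 = k
    · have h2 : p.1 + 1 + (p.2 + 1) = k + 2 := by omega
      simp [h2] at hcoeff
      simp [hp]
      linarith
    · have h2 : ¬ p.1 + 1 + (p.2 + 1) = k + 2 := by omega
      simp [h2] at hcoeff
      simp [hp, hcoeff]

end MU
end

/-! ### Symmetric cocycles modulo a prime. -/

noncomputable section

namespace Lazard

/-- `c 1, …, c (n - 1)` are the coefficients of a symmetric cocycle
`∑ c i X ^ i Y ^ (n - i)`. -/
structure IsCocycle {A : Type*} [CommRing A] (n : ℕ) (c : ℕ → A) : Prop where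
  symm : ∀ i j, 0 < i → 0 < j → i + j = n → c i = c j
  cocycle : ∀ i j k, 0 < i → 0 < j → 0 < k → i + j + k = n →
    ((i + j).choose i : A) * c (i + j) = ((j + k).choose j : A) * c i

/-- The cocycle identity for (1, m - 1, n - m) expresses m c_m as a multiple of c_1, and m is
invertible modulo p. -/
theorem IsCocycle.eq_zero_of_not_dvd {p : ℕ} [Fact p.Prime] {n : ℕ} {c : ℕ → ZMod p}
    (hc : IsCocycle n c) (h1 : c 1 = 0) {m : ℕ} (hm : m < n) (hpm : ¬ p ∣ m) : c m = 0 := by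
  have hm0 : m ≠ 0 := by rintro rfl; exact hpm (dvd_zero _)
  obtain rfl | hm1 := eq_or_ne m 1
  · exact h1
  have h := hc.cocycle 1 (m - 1) (n - m) one_pos (by omega) (by omega) (by omega)
  rw [h1, mul_zero, show 1 + (m - 1) = m by omega, Nat.choose_one_right] at h
  refine (mul_eq_zero.mp h).resolve_left ?_
  rwa [ZMod.natCast_eq_zero_iff]

/-- The space of symmetric cocycles of degree `n` over a prime field is at most one-dimensional,
and one of the coefficients is a coordinate on it. -/
theorem exists_coordinate (p : ℕ) [hp : Fact p.Prime] (n : ℕ) (hn : 2 ≤ n) :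
    ∃ m, 0 < m ∧ m < n ∧ ∀ c : ℕ → ZMod p, IsCocycle n c → c m = 0 →
      ∀ i, 0 < i → i < n → c i = 0 := by
  induction n using Nat.strong_induction_on with
  | _ n ih =>
  by_cases hpn : p ∣ n
  swap
  -- When p ∤ n, an index i divisible by p has a mirror index n - i prime to p, so symmetry covers
  -- it.
  · refine ⟨1, one_pos, by omega, fun c hc h1 i hi hin => ?_⟩
    by_cases hpi : p ∣ i
    · rw [hc.symm i (n - i) hi (by omega) (by omega)]
      refine hc.eq_zero_of_not_dvd h1 (by omega) fun h => hpn ?_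
      have := dvd_add hpi h
      rwa [show i + (n - i) = n by omega] at this
    · exact hc.eq_zero_of_not_dvd h1 hin hpi
  obtain ⟨n', rfl⟩ := hpn
  have hp2 := hp.out.two_le
  obtain hn' | hn' : n' = 1 ∨ 2 ≤ n' := by
    rcases n' with _ | _ | n'
    · omega
    · simp
    · right; omega
  · subst hn'
    refine ⟨1, one_pos, by omega, fun c hc h1 i hi hin => hc.eq_zero_of_not_dvd h1 hin fun h => ?_⟩
    have := Nat.le_of_dvd hi h
    omega
  obtain ⟨m, hm, hmn, hcoord⟩ := ih n' (by nlinarith) hn'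
  -- For n = p n' with n' ≥ 2, a cocycle is supported on multiples of p. By Lucas' theorem its
  -- restriction to them is a cocycle of degree n', so the coordinate m for n' becomes p m.
  refine ⟨p * m, by positivity, Nat.mul_lt_mul_of_pos_left hmn (by omega), fun c hc h0 => ?_⟩
  have hlucas (a b : ℕ) : ((p * a).choose (p * b) : ZMod p) = (a.choose b : ZMod p) := by
    have := Choose.choose_modEq_choose_mod_mul_choose_div_nat (p := p) (n := p * a) (k := p * b)
    rw [(ZMod.natCast_eq_natCast_iff _ _ _).mpr this]
    simp [Nat.mul_div_cancel_left _ hp.out.pos]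
  -- The triple (1, p - 1, n - p) gives p c_p = binom(n - 1, p - 1) c_1 with n = p n'. The left side
  -- is 0 and the binomial coefficient is 1 modulo p.
  have h1 : c 1 = 0 := by
    have hle : 2 * p ≤ p * n' := by nlinarith
    have h := hc.cocycle 1 (p - 1) (p * n' - p) one_pos (by omega) (by omega) (by omega)
    rw [show 1 + (p - 1) = p by omega, Nat.choose_one_right, CharP.cast_eq_zero, zero_mul] at h
    have := Choose.choose_modEq_choose_mod_mul_choose_div_nat (p := p)
      (n := p - 1 + (p * n' - p)) (k := p - 1)
    have h2 : p - 1 + (p * n' - p) = p * (n' - 1) + (p - 1) := by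
      rw [Nat.mul_sub, mul_one]; omega
    rw [h2] at this h
    rw [(ZMod.natCast_eq_natCast_iff _ _ _).mpr this, Nat.mul_add_mod,
      Nat.mod_eq_of_lt (by omega : p - 1 < p), Nat.div_eq_of_lt (by omega : p - 1 < p)] at h
    simpa using h.symm
  have hc' : IsCocycle n' fun i => c (p * i) := by
    refine ⟨fun i j hi hj hij => hc.symm _ _ (by positivity) (by positivity) (by rw [← hij]; ring),
      fun i j k hi hj hk hijk => ?_⟩
    have := hc.cocycle (p * i) (p * j) (p * k) (by positivity) (by positivity) (by positivity)
      (by rw [← hijk]; ring)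
    rwa [← mul_add, ← mul_add, hlucas, hlucas] at this
  intro i hi hin
  by_cases hpi : p ∣ i
  · obtain ⟨a, rfl⟩ := hpi
    exact hcoord _ hc' h0 a (Nat.pos_of_mul_pos_left hi) (Nat.lt_of_mul_lt_mul_left hin)
  · exact hc.eq_zero_of_not_dvd h1 hin hpi

/-- Both sides of the cocycle identity are the multinomial coefficient n! / (i! j! k!). Up to sign,
for n = k + 2 this cocycle is `slope k` on the coefficients of F. -/
theorem isCocycle_choose (n : ℕ) : IsCocycle (A := ℤ) n fun i => (n.choose i : ℤ) where
  symm i j _ _ hij := by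
    rw [← hij, Nat.choose_symm_add]
  cocycle i j k _ _ _ hijk := by
    have h := Nat.choose_mul (n := n) (k := i + j) (s := i) (by omega)
    rw [show n - i = j + k by omega, show i + j - i = j by omega] at h
    have h' : (n.choose (i + j) : ℤ) * (i + j).choose i = n.choose i * (j + k).choose j := by
      exact_mod_cast h
    linarith

end Lazard
end

/-! ### Linearised associativity is the cocycle condition. -/

noncomputable section

namespace Lazard

open MvPolynomial

variable {A : Type*} [CommRing A]

/-- The exponent of `X ^ i Y ^ j Z ^ k`. -/
def exponent (i j k : ℕ) : Fin 3 →₀ ℕ :=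
  Finsupp.single 0 i + Finsupp.single 1 j + Finsupp.single 2 k

theorem exponent_inj {i j k i' j' k' : ℕ} :
    exponent i j k = exponent i' j' k' ↔ i = i' ∧ j = j' ∧ k = k' := by
  refine ⟨fun h => ⟨?_, ?_, ?_⟩, by rintro ⟨rfl, rfl, rfl⟩; rfl⟩
  · simpa [exponent] using DFunLike.congr_fun h 0
  · simpa [exponent] using DFunLike.congr_fun h 1
  · simpa [exponent] using DFunLike.congr_fun h 2

theorem degree_exponent (i j k : ℕ) : (exponent i j k).degree = i + j + k := by
  simp [exponent]

theorem coeff_X_pow_mul (i j k a b c : ℕ) : MvPowerSeries.coeff (exponent i j k)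
    ((MvPowerSeries.X 0 : MvPowerSeries (Fin 3) A) ^ a * MvPowerSeries.X 1 ^ b *
      MvPowerSeries.X 2 ^ c) = if i = a ∧ j = b ∧ k = c then 1 else 0 := by
  classical
  rw [MvPowerSeries.X_pow_eq, MvPowerSeries.X_pow_eq, MvPowerSeries.X_pow_eq,
    MvPowerSeries.monomial_mul_monomial, MvPowerSeries.monomial_mul_monomial,
    MvPowerSeries.coeff_monomial]
  simp only [mul_one]
  exact if_congr exponent_inj rfl rfl

theorem coeff_subst_left (γ : MvPowerSeries (Fin 2) A) (i j k : ℕ) :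
    MvPowerSeries.coeff (exponent i j k) (γ.subst ![(MvPowerSeries.X 0 + MvPowerSeries.X 1 :
      MvPowerSeries (Fin 3) A), MvPowerSeries.X 2]) =
    (i + j).choose i * γ.coeff (Finsupp.single 0 (i + j) + Finsupp.single 1 k) := by
  have hs : MvPowerSeries.HasSubst ![(MvPowerSeries.X 0 + MvPowerSeries.X 1 :
      MvPowerSeries (Fin 3) A), MvPowerSeries.X 2] :=
    FormalGroup.hasSubst_pair' ((PowerSeries.HasSubst.X 0).add (PowerSeries.HasSubst.X 1))
      (PowerSeries.HasSubst.X 2)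
  have key (d : Fin 2 →₀ ℕ) : MvPowerSeries.coeff (exponent i j k)
      ((MvPowerSeries.X 0 + MvPowerSeries.X 1 : MvPowerSeries (Fin 3) A) ^ d 0 *
        MvPowerSeries.X 2 ^ d 1) = if i + j = d 0 ∧ k = d 1 then ((i + j).choose i : A) else 0 := by
    rw [add_pow, Finset.sum_mul, map_sum]
    have hterm (m : ℕ) : MvPowerSeries.coeff (exponent i j k)
        ((MvPowerSeries.X 0 : MvPowerSeries (Fin 3) A) ^ m * MvPowerSeries.X 1 ^ (d 0 - m) *
          ((d 0).choose m : MvPowerSeries (Fin 3) A) * MvPowerSeries.X 2 ^ d 1) =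
        (if i = m ∧ j = d 0 - m ∧ k = d 1 then 1 else 0) * ((d 0).choose m : A) := by
      rw [← coeff_X_pow_mul, ← MvPowerSeries.coeff_mul_C]
      congr 1
      rw [map_natCast]
      ring
    simp only [hterm]
    split_ifs with h
    · rw [Finset.sum_eq_single i]
      · rw [if_pos ⟨rfl, by omega, h.2⟩, one_mul, h.1]
      · intro m _ hm
        rw [if_neg fun h' => hm h'.1.symm, zero_mul]
      · intro hi
        exact absurd (Finset.mem_range.mpr (by omega)) hi
    · refine Finset.sum_eq_zero fun m hm => ?_
      have := Finset.mem_range.mp hm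
      rw [if_neg fun h' => h ⟨by omega, h'.2.2⟩, zero_mul]
  rw [MvPowerSeries.coeff_subst hs,
    finsum_eq_single _ (Finsupp.single 0 (i + j) + Finsupp.single 1 k)]
  · rw [Finsupp.prod_fintype _ _ (by simp), Fin.prod_univ_two, smul_eq_mul, mul_comm]
    congr 1
    refine (key _).trans ?_
    simp
  · intro d hd
    rw [Finsupp.prod_fintype _ _ (by simp), Fin.prod_univ_two]
    refine (congrArg _ (key d)).trans ?_
    rw [if_neg, smul_zero]
    rintro ⟨h0, h1⟩
    exact hd (Finsupp.ext fun s => by fin_cases s <;> simp [h0, h1])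

theorem coeff_subst_right (γ : MvPowerSeries (Fin 2) A) (i j k : ℕ) :
    MvPowerSeries.coeff (exponent i j k) (γ.subst ![(MvPowerSeries.X 0 :
      MvPowerSeries (Fin 3) A), MvPowerSeries.X 1 + MvPowerSeries.X 2]) =
    (j + k).choose j * γ.coeff (Finsupp.single 0 i + Finsupp.single 1 (j + k)) := by
  have hs : MvPowerSeries.HasSubst ![(MvPowerSeries.X 0 : MvPowerSeries (Fin 3) A),
      MvPowerSeries.X 1 + MvPowerSeries.X 2] :=
    FormalGroup.hasSubst_pair' (PowerSeries.HasSubst.X 0)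
      ((PowerSeries.HasSubst.X 1).add (PowerSeries.HasSubst.X 2))
  have key (d : Fin 2 →₀ ℕ) : MvPowerSeries.coeff (exponent i j k)
      ((MvPowerSeries.X 0 : MvPowerSeries (Fin 3) A) ^ d 0 *
        (MvPowerSeries.X 1 + MvPowerSeries.X 2) ^ d 1) =
        if i = d 0 ∧ j + k = d 1 then ((j + k).choose j : A) else 0 := by
    rw [add_pow, Finset.mul_sum, map_sum]
    have hterm (m : ℕ) : MvPowerSeries.coeff (exponent i j k)
        ((MvPowerSeries.X 0 : MvPowerSeries (Fin 3) A) ^ d 0 * (MvPowerSeries.X 1 ^ m *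
          MvPowerSeries.X 2 ^ (d 1 - m) * ((d 1).choose m : MvPowerSeries (Fin 3) A))) =
        (if i = d 0 ∧ j = m ∧ k = d 1 - m then 1 else 0) * ((d 1).choose m : A) := by
      rw [← coeff_X_pow_mul, ← MvPowerSeries.coeff_mul_C]
      congr 1
      rw [map_natCast]
      ring
    simp only [hterm]
    split_ifs with h
    · rw [Finset.sum_eq_single j]
      · rw [if_pos ⟨h.1, rfl, by omega⟩, one_mul, h.2]
      · intro m _ hm
        rw [if_neg fun h' => hm h'.2.1.symm, zero_mul]
      · intro hi
        exact absurd (Finset.mem_range.mpr (by omega)) hi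
    · refine Finset.sum_eq_zero fun m hm => ?_
      have := Finset.mem_range.mp hm
      rw [if_neg fun h' => h ⟨h'.1, by omega⟩, zero_mul]
  rw [MvPowerSeries.coeff_subst hs,
    finsum_eq_single _ (Finsupp.single 0 i + Finsupp.single 1 (j + k))]
  · rw [Finsupp.prod_fintype _ _ (by simp), Fin.prod_univ_two, smul_eq_mul, mul_comm]
    congr 1
    refine (key _).trans ?_
    simp
  · intro d hd
    rw [Finsupp.prod_fintype _ _ (by simp), Fin.prod_univ_two]
    refine (congrArg _ (key d)).trans ?_
    rw [if_neg, smul_zero]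
    rintro ⟨h0, h1⟩
    exact hd (Finsupp.ext fun s => by fin_cases s <;> simp [h0, h1])

/-- A series in two of the three variables has no monomial involving the third. This discards the
inner terms Γ(X, Y) and Γ(Y, Z) of linearised associativity. -/
theorem coeff_subst_X_X (γ : MvPowerSeries (Fin 2) A) (s t u : Fin 3) (hs : u ≠ s) (ht : u ≠ t)
    {e : Fin 3 →₀ ℕ} (he : e u ≠ 0) : MvPowerSeries.coeff e
      (γ.subst ![(MvPowerSeries.X s : MvPowerSeries (Fin 3) A), MvPowerSeries.X t]) = 0 := by
  classical
  rw [MvPowerSeries.coeff_subst MvPowerSeries.HasSubst.X_X]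
  refine finsum_eq_zero_of_forall_eq_zero fun d => ?_
  rw [Finsupp.prod_fintype _ _ (by simp), Fin.prod_univ_two]
  simp only [Matrix.cons_val_zero, Matrix.cons_val_one]
  rw [MvPowerSeries.X_pow_eq, MvPowerSeries.X_pow_eq, MvPowerSeries.monomial_mul_monomial,
    MvPowerSeries.coeff_monomial, if_neg, smul_zero]
  rintro rfl
  simp [Finsupp.single_eq_of_ne hs, Finsupp.single_eq_of_ne ht] at he

/-- The series `∑ c (i, j) X ^ (i+1) Y ^ (j+1)`. -/
def cocycleSeries (c : ℕ × ℕ → A) : MvPowerSeries (Fin 2) A := fun e =>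
  if e 0 = 0 ∨ e 1 = 0 then 0 else c (e 0 - 1, e 1 - 1)

theorem coeff_cocycleSeries (c : ℕ × ℕ → A) (e : Fin 2 →₀ ℕ) : (cocycleSeries c).coeff e =
    if e 0 = 0 ∨ e 1 = 0 then 0 else c (e 0 - 1, e 1 - 1) := rfl

theorem map_toDual_genericSeries (c : ℕ × ℕ → A) : genericSeries.map (toDual c) =
    MvPowerSeries.X 0 + MvPowerSeries.X 1 + (DualNumber.eps : DualNumber A) •
      (cocycleSeries c).map (TrivSqZeroExt.inlHom A A) := by
  ext1 e
  have hs (i : Fin 2) : e = Finsupp.single i 1 ↔ e i = 1 ∧ e (1 - i) = 0 := by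
    constructor
    · rintro rfl; fin_cases i <;> simp
    · rintro ⟨h1, h2⟩
      ext j
      fin_cases i <;> fin_cases j <;> simp_all
  classical
  rw [genericSeries, map_unitalSeries, coeff_unitalSeries, map_add, map_add, map_smul,
    MvPowerSeries.coeff_map, coeff_cocycleSeries, MvPowerSeries.coeff_X, MvPowerSeries.coeff_X]
  simp only [hs]
  by_cases h0 : e 0 = 0
  · simp [h0]
  · by_cases h1 : e 1 = 0
    · simp [h0, h1]
    · ext <;> simp [h0, h1, toDual]

/-- Over the dual numbers G = X + Y + ε Γ, so G(G(X, Y), Z) = X + Y + Z + ε (Γ(X, Y) + Γ(X + Y, Z)),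
and similarly on the other side. On monomials with positive exponents only Γ(X + Y, Z) - Γ(X, Y + Z)
remains. -/
theorem snd_toDual_coeff_assocDefect (c : ℕ × ℕ → A) {i j k : ℕ} (hi : 0 < i) (hj : 0 < j)
    (hk : 0 < k) :
    (toDual c ((assocDefect genericSeries).coeff (exponent i j k))).snd =
      (i + j).choose i * c (i + j - 1, k - 1) - (j + k).choose j * c (i - 1, j + k - 1) := by
  rw [← MvPowerSeries.coeff_map, map_assocDefect _ constantCoeff_genericSeries]
  have hG0 : (genericSeries.map (toDual c)).constantCoeff = 0 := by
    rw [MvPowerSeries.constantCoeff_map, constantCoeff_genericSeries, map_zero]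
  have hG := map_toDual_genericSeries c
  set G := genericSeries.map (toDual c)
  set Γ := (cocycleSeries c).map (TrivSqZeroExt.inlHom A A) with hΓ
  have hΓfst : Γ.map (DualNumber.fstRingHom A) = cocycleSeries c := by
    ext e
    simp [hΓ, DualNumber.fstRingHom_apply]
  have hsub {a b : MvPowerSeries (Fin 3) (DualNumber A)} (hab : MvPowerSeries.HasSubst ![a, b]) :
      G.subst ![a, b] = a + b + (DualNumber.eps : DualNumber A) • Γ.subst ![a, b] := by
    rw [hG, MvPowerSeries.subst_add hab, MvPowerSeries.subst_add hab, MvPowerSeries.subst_smul hab,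
      MvPowerSeries.subst_X hab, MvPowerSeries.subst_X hab]
    rfl
  have hsnd {a b : MvPowerSeries (Fin 3) (DualNumber A)} (hab : MvPowerSeries.HasSubst ![a, b])
      (e : Fin 3 →₀ ℕ) : (MvPowerSeries.coeff e (G.subst ![a, b])).snd =
        (a.coeff e).snd + (b.coeff e).snd + ((cocycleSeries c).subst
          ![a.map (DualNumber.fstRingHom A), b.map (DualNumber.fstRingHom A)]).coeff e := by
    rw [hsub hab, map_add, map_add, TrivSqZeroExt.snd_add, TrivSqZeroExt.snd_add,
      DualNumber.snd_coeff_eps_smul, MvPowerSeries.map_subst hab, map_pair, hΓfst]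
  have hfst (s t : Fin 3) : (G.subst ![(MvPowerSeries.X s : MvPowerSeries (Fin 3) (DualNumber A)),
      MvPowerSeries.X t]).map (DualNumber.fstRingHom A) =
        MvPowerSeries.X s + MvPowerSeries.X t := by
    have h0 : DualNumber.fstRingHom A DualNumber.eps = 0 := by
      simp [DualNumber.fstRingHom_apply]
    rw [hsub MvPowerSeries.HasSubst.X_X]
    simp [MvPowerSeries.smul_eq_C_mul, h0]
  have hX (s : Fin 3) (e : Fin 3 →₀ ℕ) :
      (MvPowerSeries.coeff e (MvPowerSeries.X s : MvPowerSeries (Fin 3) (DualNumber A))).snd =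
        0 := by
    classical
    rw [MvPowerSeries.coeff_X]
    split_ifs <;> simp
  have h2 : exponent i j k 2 ≠ 0 := by simpa [exponent] using hk.ne'
  have h0 : exponent i j k 0 ≠ 0 := by simpa [exponent] using hi.ne'
  rw [assocDefect, map_sub, TrivSqZeroExt.snd_sub,
    hsnd (MvPowerSeries.HasSubst.cons_subst_zero_left 0 1 2 hG0),
    hsnd (MvPowerSeries.HasSubst.cons_subst_zero_right 0 1 2 hG0),
    hsnd MvPowerSeries.HasSubst.X_X, hsnd MvPowerSeries.HasSubst.X_X, hfst, hfst]
  simp only [hX, MvPowerSeries.map_X]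
  rw [coeff_subst_X_X _ 0 1 2 (by decide) (by decide) h2,
    coeff_subst_X_X _ 1 2 0 (by decide) (by decide) h0, coeff_subst_left, coeff_subst_right,
    coeff_cocycleSeries, coeff_cocycleSeries, if_neg, if_neg]
  · simp
  · simp; omega
  · simp; omega

end Lazard
end

/-! ### Elements with admissible slopes generate `MU`. -/

noncomputable section

/-- A proper subgroup of `ℤ^n` is annihilated by a nonzero linear form modulo some prime. -/
theorem Submodule.exists_zmod_annihilator {ι : Type*} [Fintype ι] {N : Submodule ℤ (ι → ℤ)}
    (hN : N ≠ ⊤) : ∃ p : ℕ, p.Prime ∧ ∃ c : ι → ZMod p, c ≠ 0 ∧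
      ∀ v ∈ N, ∑ i, (v i : ZMod p) * c i = 0 := by
  classical
  -- The quotient by a maximal proper subgroup is a simple ℤ-module, hence ℤ/p for a prime p.
  obtain ⟨M, hM, hNM⟩ := (eq_top_or_exists_le_coatom N).resolve_left hN
  have hsimple : IsSimpleModule ℤ ((ι → ℤ) ⧸ M) := isSimpleModule_iff_isCoatom.mpr hM
  obtain ⟨I, hI, ⟨e⟩⟩ := isSimpleModule_iff_quot_maximal.mp hsimple
  obtain ⟨n, rfl⟩ : ∃ n : ℕ, I = Ideal.span {(n : ℤ)} := by
    obtain ⟨z, hz⟩ := (IsPrincipalIdealRing.principal I).principal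
    refine ⟨z.natAbs, ?_⟩
    rw [Int.span_natAbs]
    exact hz
  have hn0 : n ≠ 0 := by
    rintro rfl
    refine (Ideal.bot_lt_of_maximal (R := ℤ) (Ideal.span {((0 : ℕ) : ℤ)}) Int.not_isField).ne ?_
    simp
  have hn : n.Prime := by
    have := (Ideal.span_singleton_prime (by exact_mod_cast hn0)).mp hI.isPrime
    exact Nat.prime_iff_prime_int.mpr this
  let f : (ι → ℤ) →+ ZMod n := ((Int.quotientSpanNatEquivZMod n).toAddEquiv.toAddMonoidHom.comp
    e.toAddEquiv.toAddMonoidHom).comp M.mkQ.toAddMonoidHom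
  have hf (v : ι → ℤ) : f v = 0 ↔ v ∈ M := by
    simp [f]
  have hsum (v : ι → ℤ) : f v = ∑ i, (v i : ZMod n) * f (Pi.single i 1) := by
    conv_lhs => rw [← Finset.univ_sum_single v, map_sum]
    refine Finset.sum_congr rfl fun i _ => ?_
    rw [← zsmul_eq_mul, ← map_zsmul]
    congr 1
    ext j
    by_cases hj : j = i
    · subst hj; simp
    · simp [hj]
  refine ⟨n, hn, fun i => f (Pi.single i 1), fun h => ?_, fun v hv => ?_⟩
  · refine hM.1 (eq_top_iff.mpr fun v _ => (hf v).mp ?_)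
    rw [hsum]
    exact Finset.sum_eq_zero fun i _ => by
      rw [show f (Pi.single i 1) = 0 from congrFun h i, mul_zero]
  · rw [← hsum]
    exact (hf v).mpr (hNM hv)

namespace MvPolynomial

variable {τ A B : Type*} [CommRing A] [CommRing B]

theorem fst_toDual (c : τ → A) (q : MvPolynomial τ ℤ) :
    (toDual c q).fst = (constantCoeff q : ℤ) := by
  have h : ((TrivSqZeroExt.fstHom A A A).toRingHom.comp (toDual c)) =
      (Int.castRingHom A).comp constantCoeff :=
    ringHom_ext (by simp) fun p => by simp [toDual_X]
  exact RingHom.congr_fun h q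

/-- The ε-component applies the form c to the linear part of q, so it is natural in additive maps.
This serves to divide by δ, to reduce modulo p and to combine two cocycles. -/
theorem snd_toDual_comp (f : A →+ B) (c : τ → A) (q : MvPolynomial τ ℤ) :
    (toDual (fun p => f (c p)) q).snd = f (toDual c q).snd := by
  induction q using MvPolynomial.induction_on with
  | C a => simp [toDual]
  | add p q hp hq => simp [hp, hq]
  | mul_X q p _ =>
    rw [map_mul, map_mul, toDual_X, toDual_X]
    simp only [TrivSqZeroExt.snd_mul, TrivSqZeroExt.snd_inr, TrivSqZeroExt.fst_inr, fst_toDual]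
    simp [← zsmul_eq_mul]

end MvPolynomial

namespace MU

open Lazard MvPolynomial

/-- The slope of `x` in degree `2(k+1)` is as divisible as that of a polynomial generator has to
be. -/
def HasGeneratorSlope (k : ℕ) (x : MU) : Prop :=
  ∀ p : ℕ, p.Prime → (p : ℤ) ∣ slope k x → (∃ a, k + 2 = p ^ a) ∧ ¬ (p : ℤ) ^ 2 ∣ slope k x

theorem mk_X_symm (i j : ℕ) : mk (X (i, j)) = mk (X (j, i)) := by
  have h := congrArg (MvPowerSeries.coeff (Finsupp.single 0 (i + 1) + Finsupp.single 1 (j + 1)))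
    (FormalGroup.IsComm.comm (F := F))
  have hF (a b : ℕ) : F.toPowerSeries.coeff
      (Finsupp.single 0 (a + 1) + Finsupp.single 1 (b + 1)) = mk (X (a, b)) := by
    simp [F, genericSeries, coeff_unitalSeries]
  rw [hF, MvPowerSeries.coeff_subst MvPowerSeries.HasSubst.X_X,
    finsum_eq_single _ (Finsupp.single 0 (j + 1) + Finsupp.single 1 (i + 1)), hF] at h
  · rw [h, Finsupp.prod_fintype _ _ (by simp)]
    classical
    simp [Fin.prod_univ_two, MvPowerSeries.X_pow_eq, MvPowerSeries.monomial_mul_monomial,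
      add_comm]
  · intro d hd
    classical
    rw [Finsupp.prod_fintype _ _ (by simp), Fin.prod_univ_two]
    simp only [Matrix.cons_val_zero, Matrix.cons_val_one]
    rw [MvPowerSeries.X_pow_eq, MvPowerSeries.X_pow_eq, MvPowerSeries.monomial_mul_monomial,
      MvPowerSeries.coeff_monomial, if_neg, smul_zero]
    intro h'
    have h0 := DFunLike.congr_fun h' 0
    have h1 := DFunLike.congr_fun h' 1
    refine hd (Finsupp.ext fun s => ?_)
    fin_cases s
    · simpa using h1.symm
    · simpa using h0.symm

theorem linearize_comp_mk (k : ℕ) : (linearize k).comp mk = toDual fun p : ℕ × ℕ =>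
    if p.1 + p.2 = k then -((k + 2).choose (p.1 + 1) : ℤ) else 0 :=
  toDual_eq _ _ fun p => linearize_mk_X k p

/-- Write the cocycle of binomial coefficients as `δ` times a cocycle `s`, and the slope of `x` as
`δ` times an integer prime to `p`. -/
theorem HasGeneratorSlope.exists_eq_mul {k : ℕ} {x : MU} (hx : HasGeneratorSlope k x) {p : ℕ}
    (hp : p.Prime) : ∃ (δ : ℤ) (s : ℕ → ℤ) (t : ℤ), δ ≠ 0 ∧
      (∀ i, 0 < i → i < k + 2 → ((k + 2).choose i : ℤ) = δ * s i) ∧ slope k x = δ * t ∧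
      ¬ (p : ℤ) ∣ t := by
  -- If p divides the slope, k + 2 is a power of p, so p divides all inner binomial coefficients and
  -- δ = p works because p² does not divide the slope. Otherwise δ = 1.
  by_cases h : (p : ℤ) ∣ slope k x
  · obtain ⟨⟨a, ha⟩, h2⟩ := hx p hp h
    obtain ⟨t, ht⟩ := h
    refine ⟨p, fun i => (k + 2).choose i / p, t, by exact_mod_cast hp.ne_zero,
      fun i hi hik => ?_, ht, fun hpt => h2 ?_⟩
    · refine (Int.mul_ediv_cancel' ?_).symm
      have := hp.dvd_choose_pow (n := a) hi.ne' (by omega)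
      rw [← ha] at this
      exact_mod_cast this
    · rw [ht, pow_two]
      exact mul_dvd_mul_left _ hpt
  · exact ⟨1, fun i => (k + 2).choose i, slope k x, one_ne_zero, by simp, by simp, h⟩

theorem isWeightedHomogeneous_X_pair {i j k : ℕ} (h : i + j = k) : IsWeightedHomogeneous
    Lazard.weight (X (i, j) : MvPolynomial (ℕ × ℕ) ℤ) (k + 1) := by
  subst h
  exact isWeightedHomogeneous_X _ _ _

/-- The generation half of Lazard's theorem. By induction A contains all decomposables of weight k +
1, so only the coefficients `mk (X (i, k - i))` matter. If A missed one of them, a nonzero form c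
modulo some prime p would kill every combination of them lying in A. The relations make c a cocycle,
hence a multiple of the reduced binomial cocycle. But c kills `x k`, while that cocycle does not. -/
theorem mk_mem_of_isWeightedHomogeneous {x : ℕ → MU} (hx : ∀ k, IsHomogeneous (k + 1) (x k))
    (hs : ∀ k, HasGeneratorSlope k (x k)) {A : Subring MU} (hA : ∀ k, x k ∈ A) (n : ℕ)
    {q : MvPolynomial (ℕ × ℕ) ℤ} (hq : IsWeightedHomogeneous Lazard.weight q n) : mk q ∈ A := by
  induction n using Nat.strong_induction_on generalizing q with
  | _ n ih =>
  have hw (p : ℕ × ℕ) : 0 < Lazard.weight p := Nat.succ_pos _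
  rcases n with _ | k
  · have : q = C (coeff 0 q) := by
      ext d
      rw [coeff_C]
      split_ifs with h
      · rw [← h]
      · by_contra hd
        obtain ⟨p, hp⟩ := Finsupp.ne_iff.mp (Ne.symm h)
        have := (hw p).trans_le (Finsupp.le_weight_of_ne_zero' Lazard.weight hp)
        rw [hq hd] at this
        exact lt_irrefl _ this
    rw [this]
    simp
  have hmul : ∀ (a b : ℕ) (f g : MvPolynomial (ℕ × ℕ) ℤ), 0 < a → 0 < b → a + b = k + 1 →
      IsWeightedHomogeneous Lazard.weight f a → IsWeightedHomogeneous Lazard.weight g b →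
      mk (f * g) ∈ A := fun a b f g ha hb hab hf hg => by
    rw [map_mul]
    exact A.mul_mem (ih a (by omega) hf) (ih b (by omega) hg)
  refine hq.induction_weight hw k.succ_pos (Z := A.toAddSubgroup.comap mk.toAddMonoidHom) ?_ hmul
  let a : Fin (k + 1) → MU := fun i => mk (X ((i : ℕ), k - i))
  suffices h : ∀ i, a i ∈ A by
    rintro ⟨i, j⟩ hij
    have hij' : i + j = k := by simp only [Lazard.weight] at hij; omega
    have := h ⟨i, by omega⟩
    simp only [a, show k - i = j by omega] at this
    exact this
  let N : Submodule ℤ (Fin (k + 1) → ℤ) :=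
    A.toAddSubgroup.toIntSubmodule.comap (Fintype.linearCombination ℤ a)
  have hmemN (v : Fin (k + 1) → ℤ) : v ∈ N ↔ ∑ i, v i • a i ∈ A := Iff.rfl
  by_contra! hne
  have hN : N ≠ ⊤ := by
    rintro hN
    obtain ⟨i, hi⟩ := hne
    have : Pi.single i 1 ∈ N := hN ▸ Submodule.mem_top
    rw [hmemN, Finset.sum_eq_single i] at this
    · simp only [Pi.single_eq_same, one_smul] at this
      exact hi this
    · intro j _ hj
      rw [Pi.single_eq_of_ne hj, zero_smul]
    · simp
  obtain ⟨p, hp, c, hc0, hcN⟩ := Submodule.exists_zmod_annihilator hN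
  have : Fact p.Prime := ⟨hp⟩
  let c' : ℕ × ℕ → ZMod p := fun r => if h : r.1 + r.2 = k then c ⟨r.1, by omega⟩ else 0
  have hc' (i : Fin (k + 1)) : c' (i, k - i) = c i := by
    have : (i : ℕ) + (k - i) = k := by omega
    simp [c', this]
  -- Modulo decomposables, f is a combination v of the variables of weight k + 1. The decomposables
  -- map into A and are killed by `toDual c'`, so `mk f ∈ A` forces v into N.
  have key {f : MvPolynomial (ℕ × ℕ) ℤ} (hf : IsWeightedHomogeneous Lazard.weight f (k + 1))
      (hfA : mk f ∈ A) : (toDual c' f).snd = 0 := by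
    let Z : AddSubgroup (MvPolynomial (ℕ × ℕ) ℤ) :=
      { carrier := {g | ∃ v : Fin (k + 1) → ℤ, mk g - ∑ i, v i • a i ∈ A ∧
          (toDual c' g).snd = ∑ i, (v i : ZMod p) * c i}
        zero_mem' := ⟨0, by simp, by simp⟩
        add_mem' := by
          rintro f g ⟨v, hv, hv'⟩ ⟨w, hw, hw'⟩
          refine ⟨v + w, ?_, ?_⟩
          · convert! A.add_mem hv hw using 1
            simp only [map_add, Pi.add_apply, add_smul, Finset.sum_add_distrib]
            ring
          · simp [hv', hw', add_mul, Finset.sum_add_distrib]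
        neg_mem' := by
          rintro f ⟨v, hv, hv'⟩
          refine ⟨-v, ?_, ?_⟩
          · convert! A.neg_mem hv using 1
            simp only [map_neg, Pi.neg_apply, neg_smul, Finset.sum_neg_distrib]
            ring
          · simp [hv'] }
    have hfZ : f ∈ Z := by
      refine hf.induction_weight (Z := Z) hw k.succ_pos ?_ fun a b f g ha hb hab hf hg => ⟨0, ?_, ?_⟩
      · rintro ⟨i, j⟩ hij
        have hij' : i + j = k := by simp only [Lazard.weight] at hij; omega
        have hj : j = k - i := by omega
        have hsum : ∑ m : Fin (k + 1), (Pi.single ⟨i, by omega⟩ 1 : Fin (k + 1) → ℤ) m • a m =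
            a ⟨i, by omega⟩ := by
          rw [Finset.sum_eq_single ⟨i, by omega⟩]
          · simp
          · intro m _ hm
            rw [Pi.single_eq_of_ne hm, zero_smul]
          · simp
        refine ⟨Pi.single ⟨i, by omega⟩ 1, ?_, ?_⟩
        · rw [hsum]
          simp [a, hj]
        · rw [toDual_X, TrivSqZeroExt.snd_inr, Finset.sum_eq_single ⟨i, by omega⟩]
          · simp [← hc', hj]
          · intro m _ hm
            rw [Pi.single_eq_of_ne hm, Int.cast_zero, zero_mul]
          · simp
      · simpa using hmul a b f g ha hb hab hf hg
      · rw [toDual_mul_of_pos c' ha hb hf hg]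
        simp
    obtain ⟨v, hv, hv'⟩ := hfZ
    rw [hv']
    refine hcN v ((hmemN v).mpr ?_)
    have := A.sub_mem hfA hv
    rwa [sub_sub_cancel] at this
  -- The commutativity and associativity relations map to 0, which lies in A, so `key` applies to
  -- them.
  have hcocycle : IsCocycle (k + 2) fun m => c' (m - 1, k + 1 - m) := by
    refine ⟨fun i j hi hj hij => ?_, fun i j l hi hj hl hijl => ?_⟩
    · have h := key (f := X (i - 1, j - 1) - X (j - 1, i - 1)) ?_ ?_
      · rw [map_sub, toDual_X, toDual_X] at h
        simp only [TrivSqZeroExt.snd_sub, TrivSqZeroExt.snd_inr] at h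
        rw [show k + 1 - i = j - 1 by omega, show k + 1 - j = i - 1 by omega]
        exact sub_eq_zero.mp h
      · refine IsWeightedHomogeneous.sub ?_ ?_
        · exact isWeightedHomogeneous_X_pair (by omega)
        · exact isWeightedHomogeneous_X_pair (by omega)
      · rw [map_sub, mk_X_symm, sub_self]
        exact A.zero_mem
    · have h := key (f := (assocDefect genericSeries).coeff (exponent i j l))
        (isWeightedHomogeneous_coeff_assocDefect (by rw [degree_exponent]; omega)) (by
          rw [← MvPowerSeries.coeff_map, map_mk_assocDefect, map_zero]
          exact A.zero_mem)
      rw [snd_toDual_coeff_assocDefect c' hi hj hl] at h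
      simp only [show k + 1 - (i + j) = l - 1 by omega, show k + 1 - i = j + l - 1 by omega]
      exact sub_eq_zero.mp h
  -- Dividing the integral binomial cocycle by δ before reducing modulo p keeps its value t on `x k`
  -- nonzero.
  obtain ⟨δ, s, t, hδ, hchoose, hslope, hpt⟩ := (hs k).exists_eq_mul hp
  have hscocycle : IsCocycle (k + 2) fun m => (s m : ZMod p) := by
    have h := isCocycle_choose (k + 2)
    refine ⟨fun i j hi hj hij => ?_, fun i j l hi hj hl hijl => ?_⟩
    · have := h.symm i j hi hj hij
      rw [hchoose i hi (by omega), hchoose j hj (by omega)] at this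
      rw [mul_left_cancel₀ hδ this]
    · have := h.cocycle i j l hi hj hl hijl
      rw [hchoose i hi (by omega), hchoose (i + j) (by omega) (by omega)] at this
      have h' : ((i + j).choose i : ℤ) * s (i + j) = (j + l).choose j * s i :=
        mul_left_cancel₀ hδ (by linear_combination this)
      have := congrArg (Int.cast : ℤ → ZMod p) h'
      push_cast at this
      exact this
  let s' : ℕ × ℕ → ℤ := fun r => if r.1 + r.2 = k then -s (r.1 + 1) else 0
  obtain ⟨f, hf, hfx⟩ := hx k
  have htf : (toDual s' f).snd = t := by
    have h1 : slope k (x k) = (((linearize k).comp mk) f).snd := by rw [← hfx]; rfl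
    have h2 : (fun r : ℕ × ℕ => if r.1 + r.2 = k then -((k + 2).choose (r.1 + 1) : ℤ) else 0) =
        fun r => AddMonoidHom.mulLeft δ (s' r) := by
      funext r
      change _ = δ * s' r
      simp only [s']
      split_ifs with h
      · rw [hchoose _ (by omega) (by omega), mul_neg]
      · rw [mul_zero]
    rw [linearize_comp_mk, h2, snd_toDual_comp, hslope] at h1
    exact (mul_left_cancel₀ hδ h1).symm
  have htf' : (toDual (fun r => (s' r : ZMod p)) f).snd = (t : ZMod p) := by
    rw [← htf]
    exact snd_toDual_comp (Int.castAddHom (ZMod p)) s' f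
  obtain ⟨m, hm, hmk, hcoord⟩ := exists_coordinate p (k + 2) (by omega)
  -- This combination of two cocycles is a cocycle that vanishes at the coordinate m, hence
  -- everywhere.
  have hzero : ∀ i, 0 < i → i < k + 2 →
      (s m : ZMod p) * c' (i - 1, k + 1 - i) - c' (m - 1, k + 1 - m) * (s i : ZMod p) = 0 := by
    refine hcoord _ ⟨fun i j hi hj hij => ?_, fun i j l hi hj hl hijl => ?_⟩ (by ring)
    · have h1 := hcocycle.symm i j hi hj hij
      have h2 := hscocycle.symm i j hi hj hij
      rw [h1, h2]
    · have h1 := hcocycle.cocycle i j l hi hj hl hijl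
      have h2 := hscocycle.cocycle i j l hi hj hl hijl
      linear_combination (s m : ZMod p) * h1 - c' (m - 1, k + 1 - m) * h2
  -- Evaluating the proportionality on f gives s_m · 0 + c'_m · t = 0: the first value vanishes by
  -- `key`, and p ∤ t. The plus sign comes from the sign built into s'.
  have hcm : c' (m - 1, k + 1 - m) = 0 := by
    let φ : ZMod p × ZMod p →+ ZMod p :=
      (AddMonoidHom.mulLeft (s m : ZMod p)).comp (AddMonoidHom.fst _ _) +
        (AddMonoidHom.mulLeft (c' (m - 1, k + 1 - m))).comp (AddMonoidHom.snd _ _)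
    have h0 : (fun r : ℕ × ℕ => φ (c' r, (s' r : ZMod p))) = fun _ => (0 : ZMod p) := by
      funext r
      change (s m : ZMod p) * c' r + c' (m - 1, k + 1 - m) * (s' r : ZMod p) = 0
      by_cases hr : r.1 + r.2 = k
      · have := hzero (r.1 + 1) (by omega) (by omega)
        rw [show r.1 + 1 - 1 = r.1 by omega, show k + 1 - (r.1 + 1) = r.2 by omega] at this
        simp only [s', if_pos hr]
        push_cast
        linear_combination this
      · simp [c', s', hr]
    have h := snd_toDual_comp φ (fun r => (c' r, (s' r : ZMod p))) f
    have h1 := snd_toDual_comp (AddMonoidHom.fst (ZMod p) (ZMod p))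
      (fun r => (c' r, (s' r : ZMod p))) f
    have h2 := snd_toDual_comp (AddMonoidHom.snd (ZMod p) (ZMod p))
      (fun r => (c' r, (s' r : ZMod p))) f
    simp only [AddMonoidHom.coe_fst, AddMonoidHom.coe_snd] at h1 h2
    rw [h0] at h
    have hz : (toDual (fun _ : ℕ × ℕ => (0 : ZMod p)) f).snd = 0 := by
      have := snd_toDual_comp (0 : ZMod p →+ ZMod p) c' f
      simpa using this
    rw [hz] at h
    change 0 = (s m : ZMod p) * (Prod.fst _) + c' (m - 1, k + 1 - m) * (Prod.snd _) at h
    rw [← h1, ← h2, htf', key hf (hfx ▸ hA k), mul_zero, zero_add] at h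
    refine (mul_eq_zero.mp h.symm).resolve_right ?_
    rwa [ZMod.intCast_zmod_eq_zero_iff_dvd]
  refine hc0 (funext fun i => ?_)
  have := hcoord _ hcocycle hcm (i + 1) (by omega) (by omega)
  simp only [show (i : ℕ) + 1 - 1 = i by omega, show k + 1 - ((i : ℕ) + 1) = k - i by omega] at this
  rw [← hc', this]
  rfl

theorem adjoin_eq_top {x : ℕ → MU} (hx : ∀ k, IsHomogeneous (k + 1) (x k))
    (hs : ∀ k, HasGeneratorSlope k (x k)) : Algebra.adjoin ℤ (Set.range x) = ⊤ := by
  have hmem {n : ℕ} {q : MvPolynomial (ℕ × ℕ) ℤ} (hq : IsWeightedHomogeneous Lazard.weight q n) :=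
    mk_mem_of_isWeightedHomogeneous hx hs (A := (Algebra.adjoin ℤ (Set.range x)).toSubring)
      (fun k => Algebra.subset_adjoin ⟨k, rfl⟩) n hq
  refine eq_top_iff.mpr fun y _ => ?_
  obtain ⟨q, rfl⟩ := mk_surjective y
  rw [q.as_sum, map_sum]
  exact Subalgebra.sum_mem _ fun d _ => hmem (isWeightedHomogeneous_monomial _ _ _ rfl)

end MU
end

/-! ### Algebraic independence by differentiation. -/

noncomputable section

namespace MvPolynomial

theorem snd_toDual_single {τ : Type*} [DecidableEq τ] (k : τ) (q : MvPolynomial τ ℤ) :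
    (toDual (fun j => if j = k then (1 : ℤ) else 0) q).snd = coeff (Finsupp.single k 1) q := by
  induction q using MvPolynomial.induction_on with
  | C a =>
    rw [coeff_C, if_neg]
    · simp [toDual]
    · intro h
      simpa using DFunLike.congr_fun h k
  | add p q hp hq => simp [hp, hq]
  | mul_X q p _ =>
    rw [map_mul, toDual_X, coeff_mul_X']
    simp only [TrivSqZeroExt.snd_mul, TrivSqZeroExt.snd_inr, TrivSqZeroExt.fst_inr, fst_toDual]
    by_cases hp : p = k
    · subst hp
      simp [constantCoeff_eq]
    · simp [hp]

open Lazard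

theorem notMem_vars_of_weight_lt {u : MvPolynomial ℕ ℤ} {i k : ℕ}
    (hu : IsWeightedHomogeneous logWeight u (i + 1)) (hik : i < k) : k ∉ u.vars := by
  intro hk
  obtain ⟨d, hd, hkd⟩ := (mem_vars_iff_mem_support _).mp hk
  have h1 := hu (mem_support_iff.mp hd)
  have h2 := Finsupp.le_weight_of_ne_zero' logWeight (Finsupp.mem_support_iff.mp hkd)
  rw [h1] at h2
  simp only [logWeight] at h2
  omega

/-- Variable k alone has the full weight k + 1, so it occurs only in its own linear term. -/
theorem pderiv_of_isWeightedHomogeneous {u : MvPolynomial ℕ ℤ} {k : ℕ}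
    (hu : IsWeightedHomogeneous logWeight u (k + 1)) :
    pderiv k u = C (coeff (Finsupp.single k 1) u) := by
  set c := coeff (Finsupp.single k 1) u with hc
  have hX : IsWeightedHomogeneous logWeight (C c * X k) (k + 1) :=
    (isWeightedHomogeneous_X ℤ logWeight k).C_mul c
  have hr := hu.sub hX
  have hk : k ∉ (u - C c * X k).vars := by
    intro hk
    obtain ⟨d, hd, hkd⟩ := (mem_vars_iff_mem_support _).mp hk
    have hd' := mem_support_iff.mp hd
    have h1 := hr hd'
    have hle : Finsupp.single k 1 ≤ d :=
      Finsupp.single_le_iff.mpr (Nat.one_le_iff_ne_zero.mpr (Finsupp.mem_support_iff.mp hkd))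
    have hsplit := add_tsub_cancel_of_le hle
    rw [← hsplit, map_add, Finsupp.weight_single, one_smul] at h1
    have h0 : d - Finsupp.single k 1 = 0 := by
      by_contra h0
      obtain ⟨j, hj⟩ := Finsupp.ne_iff.mp h0
      have := Finsupp.le_weight_of_ne_zero' logWeight hj
      simp only [logWeight] at this h1
      omega
    rw [h0, _root_.add_zero] at hsplit
    refine hd' ?_
    rw [← hsplit, coeff_sub, coeff_C_mul, coeff_X, if_pos rfl, mul_one, ← hc, sub_self]
  have := pderiv_eq_zero_of_notMem_vars hk
  rw [map_sub, pderiv_C_mul, pderiv_X_self, mul_one, sub_eq_zero] at this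
  exact this

/-- The chain rule has a single term, because `u i` does not involve variable k for i < k. -/
theorem pderiv_aeval_of_mem_supported {u : ℕ → MvPolynomial ℕ ℤ}
    (hu : ∀ k, IsWeightedHomogeneous logWeight (u k) (k + 1)) {k : ℕ} {q : MvPolynomial ℕ ℤ}
    (hq : q ∈ supported ℤ (Set.Iic k)) : pderiv k (aeval u q) =
      aeval u (pderiv k q) * C (coeff (Finsupp.single k 1) (u k)) := by
  rw [supported] at hq
  induction hq using Algebra.adjoin_induction with
  | mem x hx =>
    obtain ⟨i, hi, rfl⟩ := hx
    obtain hik | hik := eq_or_lt_of_le (Set.mem_Iic.mp hi)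
    · rw [hik, aeval_X, pderiv_X_self, map_one, one_mul, pderiv_of_isWeightedHomogeneous (hu _)]
    · rw [aeval_X, pderiv_X_of_ne hik.ne, map_zero, zero_mul,
        pderiv_eq_zero_of_notMem_vars (notMem_vars_of_weight_lt (hu i) hik)]
  | algebraMap r => simp [algebraMap_eq]
  | add x y _ _ hx hy => rw [map_add, map_add, hx, hy, map_add, map_add, add_mul]
  | mul x y _ _ hx hy =>
    rw [map_mul, pderiv_mul, hx, hy, pderiv_mul, map_add, map_mul, map_mul]
    ring

/-- Homogeneous polynomials `u 0, u 1, …` in `b₀, b₁, …` such that `u k` has the weight of `b k`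
and involves `b k` are algebraically independent. -/
theorem algebraicIndependent_of_coeff_ne_zero {u : ℕ → MvPolynomial ℕ ℤ}
    (hu : ∀ k, IsWeightedHomogeneous logWeight (u k) (k + 1))
    (hc : ∀ k, coeff (Finsupp.single k 1) (u k) ≠ 0) : AlgebraicIndependent ℤ u := by
  rw [algebraicIndependent_iff]
  intro q hq
  -- Differentiating a relation with respect to its largest variable gives, up to a nonzero
  -- constant, a relation of smaller degree. That derivative is then zero by induction, although the
  -- variable occurs in q and the characteristic is zero.
  induction hn : q.totalDegree using Nat.strong_induction_on generalizing q with
  | _ n ih =>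
  subst hn
  by_cases hvars : q.vars = ∅
  · obtain ⟨r, rfl⟩ : ∃ r, q = C r := ⟨_, vars_eq_empty_iff_eq_C.mp hvars⟩
    simpa using hq
  set k := q.vars.max' (Finset.nonempty_iff_ne_empty.mpr hvars) with hk
  have hkq : k ∈ q.vars := Finset.max'_mem _ _
  have hsupp : q ∈ supported ℤ (Set.Iic k) :=
    mem_supported.mpr fun i hi => Finset.le_max' _ _ hi
  have hchain := pderiv_aeval_of_mem_supported hu hsupp
  rw [hq, map_zero] at hchain
  have h0 : aeval u (pderiv k q) = 0 := by
    refine (mul_eq_zero.mp hchain.symm).resolve_right ?_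
    rw [C_eq_zero]
    exact hc k
  obtain ⟨d, hd, hkd⟩ := (mem_vars_iff_mem_support _).mp hkq
  have hd0 := mem_support_iff.mp hd
  have hle : Finsupp.single k 1 ≤ d :=
    Finsupp.single_le_iff.mpr (Nat.one_le_iff_ne_zero.mpr (Finsupp.mem_support_iff.mp hkd))
  have hlt : (pderiv k q).totalDegree < q.totalDegree := by
    refine (Finset.sup_lt_iff ?_).mpr fun m hm => ?_
    · have h1 := le_totalDegree hd
      have h2 := Finset.single_le_sum (f := fun i => d i) (fun _ _ => Nat.zero_le _) hkd
      have h3 := Finsupp.mem_support_iff.mp hkd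
      exact (Nat.pos_of_ne_zero h3).trans_le (h2.trans h1)
    · have hm' := mem_support_iff.mp hm
      rw [coeff_pderiv] at hm'
      have h1 := le_totalDegree (mem_support_iff.mpr (left_ne_zero_of_mul hm'))
      rw [Finsupp.sum_add_index' (fun _ => rfl) (fun _ _ _ => rfl),
        Finsupp.sum_single_index rfl] at h1
      omega
  have h := congrArg (coeff (d - Finsupp.single k 1)) (ih _ hlt _ h0 rfl)
  rw [coeff_pderiv, tsub_add_cancel_of_le hle, coeff_zero] at h
  exact absurd ((mul_eq_zero.mp h).resolve_right (by positivity)) hd0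

end MvPolynomial
end

/-! ### Formal roots of unity and descent from them. -/

noncomputable section

namespace AdjoinRoot

open _root_.Polynomial

variable {R S : Type*} [CommRing R] [CommRing S]

/-- The map induced by `f` on the rings with a formal primitive `n`-th root of unity. -/
def cyclotomicMap (n : ℕ) (f : R →+* S) :
    AdjoinRoot (cyclotomic n R) →+* AdjoinRoot (cyclotomic n S) :=
  AdjoinRoot.map f _ _ (by rw [map_cyclotomic])

theorem cyclotomicMap_of (n : ℕ) (f : R →+* S) (r : R) :
    cyclotomicMap n f (of _ r) = of _ (f r) := map_of _ _ _ _ _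

theorem cyclotomicMap_root (n : ℕ) (f : R →+* S) :
    cyclotomicMap n f (root _) = root _ := map_root _ _ _ _

theorem cyclotomicMap_mk (n : ℕ) (f : R →+* S) (g : R[X]) :
    cyclotomicMap n f (mk _ g) = mk _ (g.map f) := by
  have h : (cyclotomicMap n f).comp (mk _) = (mk _).comp (mapRingHom f) :=
    Polynomial.ringHom_ext (fun r => by simpa using cyclotomicMap_of n f r)
      (by simpa using cyclotomicMap_root n f)
  exact RingHom.congr_fun h g

/-- As Φ_n is monic of degree φ(n), a representative of smaller degree has the constant c as its
image; r is its constant term. The half that needs no injectivity is used before `toLog ℤ` is known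
to be injective. -/
theorem exists_of_cyclotomicMap_eq_of [Nontrivial R] [Nontrivial S] {n : ℕ} (hn : 0 < n)
    (f : R →+* S) {y : AdjoinRoot (cyclotomic n R)} {c : S} (hy : cyclotomicMap n f y = of _ c) :
    ∃ r, f r = c ∧ (Function.Injective f → y = of _ r) := by
  obtain ⟨g₀, rfl⟩ := mk_surjective (g := cyclotomic n R) y
  set g := g₀ %ₘ cyclotomic n R with hg
  have hmk : mk (cyclotomic n R) g₀ = mk _ g := by
    rw [mk_eq_mk, hg]
    exact ⟨g₀ /ₘ cyclotomic n R, by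
      rw [sub_eq_iff_eq_add', modByMonic_add_div]⟩
  have hdeg : g.degree < (n.totient : WithBot ℕ) := by
    rw [← degree_cyclotomic n R]
    exact degree_modByMonic_lt _ (cyclotomic.monic n R)
  have hpos : (0 : WithBot ℕ) < (n.totient : WithBot ℕ) := by
    exact_mod_cast Nat.totient_pos.mpr hn
  rw [hmk, cyclotomicMap_mk, ← mk_C, mk_eq_mk] at hy
  have hgc : g.map f = C c := by
    by_contra h0
    refine (cyclotomic.monic n S).not_dvd_of_degree_lt (sub_ne_zero.mpr h0) ?_ hy
    rw [degree_cyclotomic]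
    exact (degree_sub_le _ _).trans_lt (max_lt (degree_map_le.trans_lt hdeg)
      (degree_C_le.trans_lt hpos))
  have h0 : f (g.coeff 0) = c := by
    rw [← coeff_map, hgc, coeff_C_zero]
  refine ⟨g.coeff 0, h0, fun hf => ?_⟩
  rw [hmk, ← mk_C]
  congr 1
  refine map_injective f hf ?_
  rw [hgc, map_C, h0]

theorem of_cyclotomic_injective [Nontrivial R] {n : ℕ} (hn : 0 < n) :
    Function.Injective (of (cyclotomic n R)) := by
  refine (injective_iff_map_eq_zero _).mpr fun r hr => ?_
  by_contra h0
  rw [← mk_C, mk_eq_zero] at hr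
  refine (cyclotomic.monic n R).not_dvd_of_degree_lt (C_ne_zero.mpr h0) ?_ hr
  rw [degree_cyclotomic]
  refine degree_C_le.trans_lt ?_
  exact_mod_cast Nat.totient_pos.mpr hn

theorem root_cyclotomic_pow (n : ℕ) : root (cyclotomic n R) ^ n = 1 := by
  have h : cyclotomic n R ∣ X ^ n - 1 := cyclotomic.dvd_X_pow_sub_one n R
  have := mk_eq_zero.mpr h
  rw [map_sub, map_pow, mk_X, map_one] at this
  exact sub_eq_zero.mp this

/-- If p ∤ n, multiplication by n permutes the exponents modulo p, and the sum becomes Φ_p(ζ) = 0.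
No domain hypothesis enters. -/
theorem sum_root_cyclotomic_pow {p : ℕ} (hp : p.Prime) (n : ℕ) :
    ∑ i ∈ Finset.range p, (root (cyclotomic p R) ^ i) ^ n = if p ∣ n then (p : AdjoinRoot _) else 0 := by
  have : Fact p.Prime := ⟨hp⟩
  have h1 := root_cyclotomic_pow (R := R) p
  set ζ := root (cyclotomic p R) with hζ
  split_ifs with h
  · obtain ⟨m, rfl⟩ := h
    have (i : ℕ) : (ζ ^ i) ^ (p * m) = 1 := by
      rw [← pow_mul, show i * (p * m) = p * (i * m) by ring, pow_mul, h1, one_pow]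
    simp [this]
  · have h0 : ∑ i ∈ Finset.range p, ζ ^ i = 0 := by
      have := mk_self (f := cyclotomic p R)
      rw [cyclotomic_prime, map_sum] at this
      simp only [map_pow, mk_X] at this
      rw [← cyclotomic_prime] at this
      exact this
    rw [← h0]
    refine Finset.sum_nbij (fun i => i * n % p) ?_ ?_ ?_ ?_
    · intro i _
      exact Finset.mem_coe.mpr (Finset.mem_range.mpr (Nat.mod_lt _ hp.pos))
    · intro i hi j hj hij
      have hij' : i * n ≡ j * n [MOD p] := hij
      have := Nat.ModEq.cancel_right_of_coprime ((Nat.Prime.coprime_iff_not_dvd hp).mpr h) hij'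
      exact Nat.ModEq.eq_of_lt_of_lt this (Finset.mem_range.mp hi) (Finset.mem_range.mp hj)
    · refine Finset.surjOn_of_injOn_of_card_le _ ?_ ?_ le_rfl
      · intro i _
        exact Finset.mem_coe.mpr (Finset.mem_range.mpr (Nat.mod_lt _ hp.pos))
      · intro i hi j hj hij
        have hij' : i * n ≡ j * n [MOD p] := hij
        have := Nat.ModEq.cancel_right_of_coprime ((Nat.Prime.coprime_iff_not_dvd hp).mpr h) hij'
        exact Nat.ModEq.eq_of_lt_of_lt this (Finset.mem_range.mp (Finset.mem_coe.mp hi))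
          (Finset.mem_range.mp (Finset.mem_coe.mp hj))
    · intro i _
      rw [← pow_mul]
      conv_lhs => rw [← Nat.mod_add_div (i * n) p, pow_add, pow_mul, h1, one_pow, mul_one]

end AdjoinRoot

namespace FormalGroup

variable {R : Type*} [CommRing R] {S : Type*} [CommRing S] {σ : Type*}

theorem map_subst_pair (F : FormalGroup R) (f : R →+* S) {a b : MvPowerSeries σ R}
    (ha : PowerSeries.HasSubst a) (hb : PowerSeries.HasSubst b) :
    (F.toPowerSeries.subst ![a, b]).map f =
      (F.map f).toPowerSeries.subst ![a.map f, b.map f] := by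
  rw [MvPowerSeries.map_subst (hasSubst_pair' ha hb), Lazard.map_pair]
  rfl

theorem IsLog.subst_map_sum {F : FormalGroup R} [F.IsComm] {f : R →+* S} {g : PowerSeries S}
    (h : (F.map f).IsLog g) {ι : Type*} (s : Finset ι) (x : ι → F.Point σ) :
    g.subst ((∑ i ∈ s, x i : F.Point σ).val.map f) = ∑ i ∈ s, g.subst ((x i).val.map f) := by
  classical
  have hmap (y : F.Point σ) : PowerSeries.HasSubst (y.val.map f) := by
    change IsNilpotent (MvPowerSeries.constantCoeff _)
    rw [MvPowerSeries.constantCoeff_map]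
    exact IsNilpotent.map y.prop f
  induction s using Finset.induction_on with
  | empty =>
    simpa using PowerSeries.subst_zero_of_constantCoeff_zero h.constantCoeff
  | insert i s hi ih =>
    rw [Finset.sum_insert hi, Finset.sum_insert hi, ← ih]
    have hadd := F.map_subst_pair f (x i).prop (∑ i ∈ s, x i).prop
    exact (congrArg (fun a => g.subst a) hadd).trans (h.subst_add (hmap (x i)) (hmap _))

theorem coeff_subst_monomial (g : PowerSeries R) {n : ℕ} (hn : n ≠ 0) (c : R) (m : ℕ) :
    PowerSeries.coeff m (g.subst (PowerSeries.monomial n c)) =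
      if n ∣ m then PowerSeries.coeff (m / n) g * c ^ (m / n) else 0 := by
  have hpow (d : ℕ) : PowerSeries.coeff m (PowerSeries.monomial n c ^ d) =
      if m = n * d then c ^ d else 0 := by
    rw [PowerSeries.monomial_eq_C_mul_X_pow, mul_pow, ← pow_mul, ← map_pow,
      PowerSeries.coeff_C_mul, PowerSeries.coeff_X_pow]
    split_ifs <;> simp
  rw [PowerSeries.coeff_subst' (PowerSeries.HasSubst.monomial' hn c)]
  simp only [hpow, smul_eq_mul]
  split_ifs with h
  · obtain ⟨d, rfl⟩ := h
    rw [Nat.mul_div_cancel_left _ (Nat.pos_of_ne_zero hn), finsum_eq_single _ d, if_pos rfl]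
    intro d' hd'
    rw [if_neg, mul_zero]
    exact fun h => hd' (Nat.eq_of_mul_eq_mul_left (Nat.pos_of_ne_zero hn) h).symm
  · refine finsum_eq_zero_of_forall_eq_zero fun d => ?_
    rw [if_neg, mul_zero]
    rintro rfl
    exact h (dvd_mul_right _ _)

end FormalGroup
end

/-! ### The curve v_ℓ f_ℓ (X) and its logarithm. -/

noncomputable section

namespace FormalGroup

variable {R : Type*} [CommRing R] {S : Type*} [CommRing S]

theorem map_monomialPoint_val (F : FormalGroup R) (f : R →+* S) (c : R) (n : ℕ+) :
    MvPowerSeries.map f (F.monomialPoint c n).val = PowerSeries.monomial (n : ℕ) (f c) := by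
  change PowerSeries.map f (PowerSeries.monomial (n : ℕ) c) = _
  ext m
  rw [PowerSeries.coeff_map, PowerSeries.coeff_monomial, PowerSeries.coeff_monomial]
  split_ifs <;> simp

end FormalGroup

namespace Lazard

open MvPolynomial

/-- The series `∑ ℓ b_m X^m`, where `m` runs through the multiples of `ℓ`: the part of
`ℓ log (X)` which involves only powers of `X ^ ℓ`. -/
def multisectionLog (ℓ : ℕ) : PowerSeries (MvPolynomial ℕ ℤ) :=
  PowerSeries.mk fun m => if ℓ ∣ m then ℓ * PowerSeries.coeff m (genericLog ℤ) else 0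

theorem coeff_multisectionLog (ℓ m : ℕ) : PowerSeries.coeff m (multisectionLog ℓ) =
    if ℓ ∣ m then ℓ * PowerSeries.coeff m (genericLog ℤ) else 0 := PowerSeries.coeff_mk _ _

theorem hasSubst_multisectionLog (ℓ : ℕ) : PowerSeries.HasSubst (multisectionLog ℓ) := by
  refine PowerSeries.HasSubst.of_constantCoeff_zero' ?_
  rw [← PowerSeries.coeff_zero_eq_constantCoeff_apply, coeff_multisectionLog, coeff_genericLog]
  simp

/-- The image of the curve `v_ℓ f_ℓ (X)` over the coefficient ring of the logarithm. -/
def vfSeries (ℓ : ℕ) : PowerSeries (MvPolynomial ℕ ℤ) :=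
  (FormalGroup.compInv (genericLog ℤ) (coeff_one_genericLog ℤ)).subst (multisectionLog ℓ)

theorem hasSubst_vfSeries (ℓ : ℕ) : PowerSeries.HasSubst (vfSeries ℓ) :=
  FormalGroup.hasSubst_subst (FormalGroup.constantCoeff_compInv _ _) (hasSubst_multisectionLog ℓ)

theorem subst_vfSeries (ℓ : ℕ) : (genericLog ℤ).subst (vfSeries ℓ) = multisectionLog ℓ :=
  FormalGroup.subst_compInv (constantCoeff_genericLog ℤ) _ (hasSubst_multisectionLog ℓ)

/-- Modulo decomposables, the coefficients of the series `vfSeries ℓ` are `ℓ b`. -/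
theorem coeff_single_coeff_vfSeries {ℓ : ℕ} (hℓ : 1 < ℓ) {k : ℕ} (hk : ℓ ∣ k + 2) :
    coeff (Finsupp.single k 1) (PowerSeries.coeff (k + 2) (vfSeries ℓ)) = ℓ := by
  set f : MvPolynomial ℕ ℤ →+* DualNumber ℤ := toDual fun j => if j = k then 1 else 0 with hf
  have hg : (genericLog ℤ).map f =
      PowerSeries.X + (DualNumber.eps : DualNumber ℤ) • PowerSeries.X ^ (k + 2) := by
    ext1 n
    rw [PowerSeries.coeff_map, coeff_genericLog, map_add, map_smul, PowerSeries.coeff_X,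
      PowerSeries.coeff_X_pow]
    rcases n with _ | _ | n
    · simp
    · simp
    · by_cases hn : n = k
      · subst hn
        simp [hf, toDual_X]
      · simp [hf, toDual_X, hn]
  have h := congrArg (PowerSeries.map f) (subst_vfSeries ℓ)
  rw [show PowerSeries.map f ((genericLog ℤ).subst (vfSeries ℓ)) = _ from
    PowerSeries.map_subst (hasSubst_vfSeries ℓ) _, hg] at h
  set W : PowerSeries (DualNumber ℤ) := MvPowerSeries.map f (vfSeries ℓ) with hW
  have hWs : PowerSeries.HasSubst W := by
    change IsNilpotent (MvPowerSeries.constantCoeff _)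
    rw [hW, MvPowerSeries.constantCoeff_map]
    exact IsNilpotent.map (hasSubst_vfSeries ℓ) f
  rw [PowerSeries.subst_add hWs, PowerSeries.subst_smul hWs, PowerSeries.subst_pow hWs,
    PowerSeries.subst_X hWs] at h
  -- As ℓ > 1, the term X of the logarithm drops out and the multisection lies in (ε). So does W,
  -- whence ε W^(k+2) = 0 and W equals the multisection.
  have hV : PowerSeries.map (DualNumber.fstRingHom ℤ) (PowerSeries.map f (multisectionLog ℓ)) =
      0 := by
    ext1 n
    rw [PowerSeries.coeff_map, PowerSeries.coeff_map, coeff_multisectionLog, coeff_genericLog]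
    rcases n with _ | _ | n
    · simp
    · simp [hℓ.ne']
    · rw [map_zero, if_neg (by omega : ¬ n + 1 + 1 = 0), if_neg (by omega : ¬ n + 1 + 1 = 1)]
      have hX : DualNumber.fstRingHom ℤ (f (X (n + 1 + 1 - 2))) = 0 := by
        rw [hf, toDual_X, DualNumber.fstRingHom_apply, TrivSqZeroExt.fst_inr]
      split_ifs
      · rw [map_mul, map_mul, hX, mul_zero]
      · simp
  have hW0 : MvPowerSeries.map (DualNumber.fstRingHom ℤ) W = 0 := by
    have h0 : DualNumber.fstRingHom ℤ DualNumber.eps = 0 := by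
      simp [DualNumber.fstRingHom_apply]
    have h' := congrArg (MvPowerSeries.map (DualNumber.fstRingHom ℤ)) h
    rw [map_add, MvPowerSeries.smul_eq_C_mul, map_mul, MvPowerSeries.map_C, h0, map_zero,
      zero_mul, add_zero] at h'
    exact h'.trans hV
  have h2 : (DualNumber.eps : DualNumber ℤ) • W ^ (k + 2) = 0 := by
    rw [← smul_zero (DualNumber.eps : DualNumber ℤ)]
    refine DualNumber.eps_smul_congr ?_
    rw [map_pow, hW0, zero_pow (by omega), map_zero]
  rw [h2, add_zero] at h
  have h3 := congrArg (PowerSeries.coeff (k + 2)) h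
  rw [PowerSeries.coeff_map, coeff_multisectionLog, if_pos hk, coeff_genericLog, if_neg (by omega),
    if_neg (by omega)] at h3
  have h4 : PowerSeries.coeff (k + 2) W = f (PowerSeries.coeff (k + 2) (vfSeries ℓ)) :=
    PowerSeries.coeff_map _ _ _
  rw [h4] at h3
  rw [← snd_toDual_single, ← hf, h3]
  simp [hf, toDual_X]

end Lazard

/-! ### Lazard's theorem and the criterion for polynomial generators. -/

namespace MU

open Lazard MvPolynomial

instance : Nontrivial MU := (toLog ℤ).domain_nontrivial

/-- The map `MU_*[ζ] → ℤ[b₀, b₁, …][ζ]`. -/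
def cyclotomicToLog (ℓ : ℕ+) :
    Cyclotomic ℓ →+* AdjoinRoot (Polynomial.cyclotomic ℓ (MvPolynomial ℕ ℤ)) :=
  AdjoinRoot.cyclotomicMap ℓ (toLog ℤ)

theorem isLog_map_cyclotomicF (ℓ : ℕ+) : ((cyclotomicF ℓ).map (cyclotomicToLog ℓ)).IsLog
    ((genericLog ℤ).map (AdjoinRoot.of _)) := by
  have h := (isLog_map_toLog ℤ).map (AdjoinRoot.of (Polynomial.cyclotomic ℓ (MvPolynomial ℕ ℤ)))
  rw [← map_comp] at h
  rw [cyclotomicF, ← map_comp]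
  convert! h using 2
  ext1 x
  exact AdjoinRoot.cyclotomicMap_of _ _ _

/-- Logarithms are compared: ∑_i log(ζ^i X) = ∑_n m_n (∑_i ζ^(i n)) X^n, and the inner sum is ℓ or 0
according to whether ℓ divides n. -/
theorem map_verschiebungFrobenius {ℓ : ℕ+} (hℓ : ℓ.Prime) :
    MvPowerSeries.map (cyclotomicToLog ℓ) (verschiebungFrobenius ℓ).val =
      PowerSeries.map (AdjoinRoot.of _) (vfSeries ℓ) := by
  have hlog := isLog_map_cyclotomicF ℓ
  refine hlog.subst_injective ?_ ?_ ?_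
  · change IsNilpotent (MvPowerSeries.constantCoeff _)
    rw [MvPowerSeries.constantCoeff_map]
    exact IsNilpotent.map (verschiebungFrobenius ℓ).prop _
  · change IsNilpotent (MvPowerSeries.constantCoeff (MvPowerSeries.map _ _))
    rw [MvPowerSeries.constantCoeff_map]
    exact IsNilpotent.map (hasSubst_vfSeries ℓ) _
  · have h1 := PowerSeries.map_subst (hasSubst_vfSeries ℓ)
      (h := AdjoinRoot.of (Polynomial.cyclotomic ℓ (MvPolynomial ℕ ℤ))) (genericLog ℤ)
    refine Eq.trans ?_ h1
    rw [subst_vfSeries, verschiebungFrobenius, hlog.subst_map_sum]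
    change _ = PowerSeries.map _ _
    ext m
    rw [map_sum, PowerSeries.coeff_map, coeff_multisectionLog]
    have hterm (i : ℕ) : PowerSeries.coeff m (PowerSeries.subst (MvPowerSeries.map
        (cyclotomicToLog ℓ) ((cyclotomicF ℓ).monomialPoint
          (AdjoinRoot.root (Polynomial.cyclotomic ℓ MU) ^ i) 1).val)
        (PowerSeries.map (AdjoinRoot.of (Polynomial.cyclotomic ℓ (MvPolynomial ℕ ℤ)))
          (genericLog ℤ))) = AdjoinRoot.of _ (PowerSeries.coeff m (genericLog ℤ)) *
            (AdjoinRoot.root _ ^ i) ^ m := by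
      rw [FormalGroup.map_monomialPoint_val, map_pow, cyclotomicToLog,
        AdjoinRoot.cyclotomicMap_root, PNat.one_coe, FormalGroup.coeff_subst_monomial _ one_ne_zero,
        if_pos (one_dvd _), Nat.div_one, PowerSeries.coeff_map]
    simp only [hterm]
    rw [← Finset.mul_sum, AdjoinRoot.sum_root_cyclotomic_pow hℓ]
    split_ifs
    · rw [map_mul, map_natCast, mul_comm]
    · simp

/-- The unconditional half supplies the elements from which injectivity of `toLog ℤ` is proved. The
conditional half then descends the curve itself to `MU`. -/
theorem exists_toLog_eq_coeff_vfSeries {ℓ : ℕ+} (hℓ : ℓ.Prime) (n : ℕ) :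
    ∃ x : MU, toLog ℤ x = PowerSeries.coeff n (vfSeries ℓ) ∧
      (Function.Injective (toLog ℤ) →
        PowerSeries.coeff n (verschiebungFrobenius ℓ).val = AdjoinRoot.of _ x) := by
  refine AdjoinRoot.exists_of_cyclotomicMap_eq_of ℓ.pos (toLog ℤ) ?_
  have := congrArg (PowerSeries.coeff n) (map_verschiebungFrobenius hℓ)
  rw [PowerSeries.coeff_map] at this
  exact this

theorem weightedHomogeneousComponent_toLog_mk (n : ℕ) (q : MvPolynomial (ℕ × ℕ) ℤ) :
    weightedHomogeneousComponent logWeight n (toLog ℤ (mk q)) =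
      toLog ℤ (mk (weightedHomogeneousComponent Lazard.weight n q)) := by
  induction q using MvPolynomial.induction_on' with
  | monomial d r =>
    have h := isWeightedHomogeneous_monomial (R := ℤ) Lazard.weight d r rfl
    by_cases hd : Finsupp.weight Lazard.weight d = n
    · rw [hd] at h
      rw [h.weightedHomogeneousComponent_same,
        (isWeightedHomogeneous_toLog_mk h).weightedHomogeneousComponent_same]
    · rw [h.weightedHomogeneousComponent_ne _ (Ne.symm hd),
        (isWeightedHomogeneous_toLog_mk h).weightedHomogeneousComponent_ne _ (Ne.symm hd), map_zero, map_zero]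
  | add p q hp hq => simp only [map_add, hp, hq]

theorem slope_eq_coeff (k : ℕ) (x : MU) :
    slope k x = coeff (Finsupp.single k 1) (toLog ℤ x) := by
  rw [← snd_toDual_single]
  rfl

/-- Before injectivity is known, a preimage of a coefficient need not be homogeneous. The slope only
sees its component of weight k + 1, so that component is taken. -/
theorem exists_isHomogeneous_slope_eq {ℓ : ℕ+} (hℓ : ℓ.Prime) {k : ℕ} (hk : (ℓ : ℕ) ∣ k + 2) :
    ∃ x : MU, IsHomogeneous (k + 1) x ∧ slope k x = ℓ := by
  obtain ⟨x, hx, -⟩ := exists_toLog_eq_coeff_vfSeries hℓ (k + 2)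
  obtain ⟨q, rfl⟩ := mk_surjective x
  refine ⟨mk (weightedHomogeneousComponent Lazard.weight (k + 1) q), ⟨_,
    weightedHomogeneousComponent_isWeightedHomogeneous _ _, rfl⟩, ?_⟩
  classical
  rw [slope_eq_coeff, ← weightedHomogeneousComponent_toLog_mk, coeff_weightedHomogeneousComponent,
    if_pos, hx, coeff_single_coeff_vfSeries (Nat.Prime.one_lt hℓ) hk]
  rw [Finsupp.weight_single, one_smul]

theorem IsHomogeneous.add {n : ℕ} {x y : MU} (hx : IsHomogeneous n x) (hy : IsHomogeneous n y) :
    IsHomogeneous n (x + y) := by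
  obtain ⟨p, hp, rfl⟩ := hx
  obtain ⟨q, hq, rfl⟩ := hy
  exact ⟨p + q, hp.add hq, map_add _ _ _⟩

theorem IsHomogeneous.zsmul {n : ℕ} {x : MU} (hx : IsHomogeneous n x) (a : ℤ) :
    IsHomogeneous n (a • x) := by
  obtain ⟨p, hp, rfl⟩ := hx
  exact ⟨C a * p, hp.C_mul a, by simp⟩

theorem hasGeneratorSlope_of_eq_prime {k ℓ d : ℕ} {x : MU} (hℓ : ℓ.Prime) (hk : k + 2 = ℓ ^ d)
    (hx : slope k x = ℓ) : HasGeneratorSlope k x := by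
  intro p hp hpx
  rw [hx] at hpx ⊢
  obtain rfl := (Nat.prime_dvd_prime_iff_eq hp hℓ).mp (by exact_mod_cast hpx)
  refine ⟨⟨d, hk⟩, fun h => ?_⟩
  have h' : p ^ 2 ∣ p ^ 1 := by rw [pow_one]; exact_mod_cast h
  have := (Nat.pow_dvd_pow_iff_le_right hp.one_lt).mp h'
  omega

theorem hasGeneratorSlope_of_isUnit {k : ℕ} {x : MU} (hx : IsUnit (slope k x)) :
    HasGeneratorSlope k x := fun _ hp hpx =>
  absurd (isUnit_of_dvd_unit hpx hx) (Nat.prime_iff_prime_int.mp hp).not_isUnit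

theorem exists_slope_eq_one {k ℓ₁ ℓ₂ : ℕ} {x₁ x₂ : MU} (h₁ : ℓ₁.Prime) (h₂ : ℓ₂.Prime)
    (hne : ℓ₁ ≠ ℓ₂) (hx₁ : slope k x₁ = ℓ₁) (hx₂ : slope k x₂ = ℓ₂) :
    ∃ a b : ℤ, slope k (a • x₁ + b • x₂) = 1 := by
  have h := Nat.isCoprime_iff_coprime.mpr ((Nat.coprime_primes h₁ h₂).mpr hne)
  obtain ⟨a, b, hab⟩ := h
  refine ⟨a, b, ?_⟩
  rw [slope_add, slope_zsmul, slope_zsmul, hx₁, hx₂, hab]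

/-- If two primes divide k + 2, Bézout combines elements having these slopes into one of slope 1.
Otherwise k + 2 is a prime power, and its prime is itself an admissible slope. -/
theorem exists_hasGeneratorSlope (k : ℕ) :
    ∃ x : MU, IsHomogeneous (k + 1) x ∧ HasGeneratorSlope k x := by
  have hk : k + 2 ≠ 1 := by omega
  have hmin := Nat.minFac_prime hk
  obtain ⟨x, hx, hsx⟩ := exists_isHomogeneous_slope_eq (ℓ := ⟨_, hmin.pos⟩) hmin
    (Nat.minFac_dvd (k + 2))
  by_cases h : ∃ p, p.Prime ∧ p ∣ k + 2 ∧ p ≠ (k + 2).minFac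
  · obtain ⟨p, hp, hpk, hne⟩ := h
    obtain ⟨y, hy, hsy⟩ := exists_isHomogeneous_slope_eq (ℓ := ⟨p, hp.pos⟩) hp hpk
    obtain ⟨a, b, hab⟩ := exists_slope_eq_one hp hmin hne hsy hsx
    exact ⟨_, (hy.zsmul a).add (hx.zsmul b), hasGeneratorSlope_of_isUnit (hab ▸ isUnit_one)⟩
  · push Not at h
    refine ⟨x, hx, hasGeneratorSlope_of_eq_prime hmin
      (Nat.eq_prime_pow_of_unique_prime_dvd (by omega) fun {p} hp hpk => h p hp hpk) hsx⟩

theorem HasGeneratorSlope.slope_ne_zero {k : ℕ} {x : MU} (h : HasGeneratorSlope k x) :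
    slope k x ≠ 0 := fun h0 =>
  (h 2 Nat.prime_two (h0 ▸ dvd_zero _)).2 (h0 ▸ dvd_zero _)

theorem algebraicIndependent_toLog {x : ℕ → MU} (hx : ∀ k, IsHomogeneous (k + 1) (x k))
    (hs : ∀ k, slope k (x k) ≠ 0) : AlgebraicIndependent ℤ fun k => toLog ℤ (x k) :=
  algebraicIndependent_of_coeff_ne_zero (fun k => (hx k).toLog)
    fun k => by rw [← slope_eq_coeff]; exact hs k

/-- `MU` is generated by elements with algebraically independent images, so a polynomial in them
with image 0 is the zero polynomial. -/
theorem toLog_injective : Function.Injective (toLog ℤ) := by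
  choose x hx hs using exists_hasGeneratorSlope
  have hind := algebraicIndependent_toLog hx fun k => (hs k).slope_ne_zero
  refine (injective_iff_map_eq_zero _).mpr fun y hy => ?_
  have hy' : y ∈ Algebra.adjoin ℤ (Set.range x) := adjoin_eq_top hx hs ▸ Algebra.mem_top
  rw [Algebra.adjoin_range_eq_range_aeval] at hy'
  obtain ⟨q, rfl⟩ := hy'
  have h : toLog ℤ (aeval x q) = aeval (fun k => toLog ℤ (x k)) q :=
    (comp_aeval_apply x (toLog ℤ).toIntAlgHom q).symm ▸ rfl
  change aeval x q = 0
  rw [(algebraicIndependent_iff.mp hind) q (h.symm.trans hy), map_zero]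

theorem isPolynomialSystem {y : ℕ+ → MU} (hy : ∀ n : ℕ+, IsHomogeneous n (y n))
    (hs : ∀ n : ℕ+, HasGeneratorSlope n.natPred (y n)) : IsPolynomialSystem y := by
  have hx (k : ℕ) : IsHomogeneous (k + 1) (y k.succPNat) := hy k.succPNat
  have hxs (k : ℕ) : HasGeneratorSlope k (y k.succPNat) := by
    simpa using hs k.succPNat
  have he : (fun k : ℕ => y k.succPNat) ∘ Equiv.pnatEquivNat = y := by
    funext n
    simp
  refine ⟨hy, ?_, ?_⟩
  · have hind := algebraicIndependent_toLog hx fun k => (hxs k).slope_ne_zero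
    have hind' : AlgebraicIndependent ℤ fun k : ℕ => y k.succPNat :=
      AlgebraicIndependent.of_comp (toLog ℤ).toIntAlgHom hind
    rw [← he]
    exact hind'.comp _ Equiv.pnatEquivNat.injective
  · rw [← adjoin_eq_top hx hxs, ← EquivLike.range_comp _ Equiv.pnatEquivNat, he]

/-- The slope criterion is imposed degree by degree, so x can be inserted into any admissible
family. -/
theorem isPolynomialGenerator {n : ℕ+} {x : MU} (hx : IsHomogeneous n x)
    (hs : HasGeneratorSlope n.natPred x) : IsPolynomialGenerator n x := by
  choose z hz hzs using exists_hasGeneratorSlope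
  refine ⟨fun m => if m = n then x else z m.natPred, isPolynomialSystem (fun m => ?_)
    (fun m => ?_), if_pos rfl⟩
  · split_ifs with h
    · rwa [h]
    · simpa using hz m.natPred
  · split_ifs with h
    · rwa [h]
    · exact hzs _

theorem isHomogeneous_of_toLog {n : ℕ} {x : MU}
    (hx : IsWeightedHomogeneous logWeight (toLog ℤ x) n) : IsHomogeneous n x := by
  obtain ⟨q, rfl⟩ := mk_surjective x
  refine ⟨_, weightedHomogeneousComponent_isWeightedHomogeneous n q, toLog_injective ?_⟩
  rw [← weightedHomogeneousComponent_toLog_mk, hx.weightedHomogeneousComponent_same]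

end MU
end

/-! ### Formal sum expansions; existence and recursion of the elements T. -/

noncomputable section

namespace FormalGroup

variable {R : Type*} [CommRing R] {S : Type*} [CommRing S]

/-! ### Expansion of a point as an infinite formal group sum -/

/-- The cross term is divisible by X^(k+2), so through degree k + 1 formal addition of a monomial of
degree k + 1 is ordinary addition. -/
theorem coeff_add_monomial_add_mul {a b : PowerSeries R} (ha : a.constantCoeff = 0) (c : R)
    {k m : ℕ} (hm : m ≤ k + 1) : PowerSeries.coeff m (a + PowerSeries.monomial (k + 1) c +
      a * PowerSeries.monomial (k + 1) c * b) =
        PowerSeries.coeff m a + if m = k + 1 then c else 0 := by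
  have hdvd : (PowerSeries.X : PowerSeries R) ^ (k + 2) ∣
      a * PowerSeries.monomial (k + 1) c * b := by
    refine Dvd.dvd.mul_right ?_ _
    rw [pow_succ']
    refine mul_dvd_mul (PowerSeries.X_dvd_iff.mpr ha) ⟨PowerSeries.C c, ?_⟩
    rw [PowerSeries.monomial_eq_C_mul_X_pow, mul_comm]
  rw [map_add, map_add, PowerSeries.X_pow_dvd_iff.mp hdvd m (by omega), PowerSeries.coeff_monomial,
    _root_.add_zero]

/-- The partial sums of the expansion of a point as a formal group sum of monomials. -/
def partialExpansion (F : FormalGroup R) (s : PowerSeries R) : ℕ → F.Point Unit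
  | 0 => 0
  | k + 1 => partialExpansion F s k + F.monomialPoint (PowerSeries.coeff (k + 1) s -
      PowerSeries.coeff (k + 1) (partialExpansion F s k).val) k.succPNat

theorem coeff_partialExpansion (F : FormalGroup R) {s : PowerSeries R}
    (hs : s.constantCoeff = 0) (k m : ℕ) (hm : m ≤ k) :
    PowerSeries.coeff m (F.partialExpansion s k).val = PowerSeries.coeff m s := by
  have h0 : PowerSeries.coeff 0 s = 0 := by
    rwa [PowerSeries.coeff_zero_eq_constantCoeff_apply]
  induction k generalizing m with
  | zero =>
    obtain rfl : m = 0 := by omega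
    rw [h0]
    exact map_zero _
  | succ k ih =>
    set a : PowerSeries R := (F.partialExpansion s k).val with ha
    set c := PowerSeries.coeff (k + 1) s - PowerSeries.coeff (k + 1) a with hc
    have ha0 : a.constantCoeff = 0 := by
      rw [← PowerSeries.coeff_zero_eq_constantCoeff_apply, ih 0 (Nat.zero_le _), h0]
    obtain ⟨b, hb⟩ := F.exists_subst_eq (F.partialExpansion s k).prop
      (F.monomialPoint c k.succPNat).prop
    refine (congrArg (PowerSeries.coeff m) hb).trans
      ((coeff_add_monomial_add_mul ha0 c hm).trans ?_)
    split_ifs with h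
    · rw [h, hc]
      ring
    · rw [ih m (by omega)]
      ring

theorem _root_.PNat.Icc_one_add_one (N : ℕ+) :
    Finset.Icc 1 (N + 1) = insert (N + 1) (Finset.Icc 1 N) := by
  ext k
  simp only [Finset.mem_Icc, Finset.mem_insert, one_le, true_and]
  rw [le_iff_eq_or_lt, PNat.lt_add_one_iff]

/-- The expansion is greedy: the k-th monomial corrects the coefficient of X^k in the preceding
partial sum and leaves the lower ones alone. -/
theorem exists_hasFormalSum (F : FormalGroup R) [F.IsComm] (s : F.Point Unit)
    (hs : PowerSeries.constantCoeff s.val = 0) :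
    ∃ t : ℕ+ → R, F.HasFormalSum (fun k => F.monomialPoint (t k) k) s := by
  refine ⟨fun k => PowerSeries.coeff k s.val -
    PowerSeries.coeff k (F.partialExpansion s.val k.natPred).val, fun n => ?_⟩
  have hsum (N : ℕ+) : ∑ k ∈ Finset.Icc 1 N, F.monomialPoint (PowerSeries.coeff k s.val -
      PowerSeries.coeff k (F.partialExpansion s.val k.natPred).val) k =
        F.partialExpansion s.val N := by
    have hstep (k : ℕ) : F.partialExpansion s.val (k + 1) = F.partialExpansion s.val k +
      F.monomialPoint (PowerSeries.coeff (k + 1) s.val -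
        PowerSeries.coeff (k + 1) (F.partialExpansion s.val k).val) k.succPNat := rfl
    induction N using PNat.recOn with
    | one =>
      rw [Finset.Icc_self, Finset.sum_singleton]
      exact ((hstep 0).trans (_root_.zero_add _)).symm
    | succ N ih =>
      rw [PNat.Icc_one_add_one, Finset.sum_insert (by simp), ih, add_comm, PNat.add_coe,
        PNat.one_coe, hstep]
      rfl
  filter_upwards [Filter.eventually_ge_atTop n.succPNat] with N hN
  rw [hsum]
  refine F.coeff_partialExpansion hs N n ?_
  have : n + 1 ≤ N := hN
  omega

theorem coeff_subst_X_pow_eq (s : PowerSeries R) {m : ℕ} (hm : m ≠ 0) (n : ℕ) :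
    PowerSeries.coeff n (s.subst (PowerSeries.X ^ m : PowerSeries R)) =
      if m ∣ n then PowerSeries.coeff (n / m) s else 0 := by
  rw [PowerSeries.coeff_subst_X_pow hm, Algebra.algebraMap_self, RingHom.id_apply]

/-- Base change along `f` followed by the substitution of `X ^ m` for `X` is additive on points. -/
theorem val_sum_eq_subst_X_pow (F : FormalGroup R) [F.IsComm] (f : R →+* S) {m : ℕ} (hm : m ≠ 0)
    {ι : Type*} (s : Finset ι) (x : ι → F.Point Unit) (y : ι → (F.map f).Point Unit)
    (hxy : ∀ i, (y i).val = (PowerSeries.map f (x i).val).subst (PowerSeries.X ^ m : PowerSeries S)) :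
    (∑ i ∈ s, y i).val =
      (PowerSeries.map f (∑ i ∈ s, x i : F.Point Unit).val).subst
        (PowerSeries.X ^ m : PowerSeries S) := by
  classical
  have hX := PowerSeries.HasSubst.X_pow (R := S) hm
  induction s using Finset.induction_on with
  | empty =>
    have h : (0 : PowerSeries S).subst (PowerSeries.X ^ m : PowerSeries S) = (0 : PowerSeries S) := by
      rw [← PowerSeries.coe_substAlgHom hX, map_zero]
    refine h.symm.trans (congrArg (PowerSeries.subst _) ?_)
    exact (map_zero (PowerSeries.map f)).symm
  | insert i s hi ih =>
    rw [Finset.sum_insert hi, Finset.sum_insert hi]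
    have h1 := F.map_subst_pair f (x i).prop (∑ i ∈ s, x i).prop
    have hmap (z : F.Point Unit) : PowerSeries.HasSubst (MvPowerSeries.map f z.val) := by
      change IsNilpotent (MvPowerSeries.constantCoeff _)
      rw [MvPowerSeries.constantCoeff_map]
      exact IsNilpotent.map z.prop f
    have h2 := MvPowerSeries.subst_comp_subst_apply
      (hasSubst_pair' (hmap (x i)) (hmap (∑ i ∈ s, x i))) hX.const (F.map f).toPowerSeries
    rw [← h1] at h2
    refine Eq.trans ?_ h2.symm
    change MvPowerSeries.subst ![(y i).val, (∑ i ∈ s, y i).val] (F.map f).toPowerSeries = _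
    congr 1
    funext j
    fin_cases j
    · exact hxy i
    · exact ih

theorem coeff_subst_eq_of_X_pow_dvd_sub (g : PowerSeries R) {a b : PowerSeries R}
    (ha : PowerSeries.HasSubst a) (hb : PowerSeries.HasSubst b) {n : ℕ}
    (hab : PowerSeries.X ^ n ∣ a - b) {m : ℕ} (hm : m < n) :
    PowerSeries.coeff m (g.subst a) = PowerSeries.coeff m (g.subst b) := by
  rw [PowerSeries.coeff_subst' ha, PowerSeries.coeff_subst' hb]
  refine finsum_congr fun d => ?_
  congr 1
  have := PowerSeries.X_pow_dvd_iff.mp (hab.trans (sub_dvd_pow_sub_pow a b d)) m hm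
  rwa [map_sub, sub_eq_zero] at this

end FormalGroup

namespace Lazard

open MvPolynomial

/-- The logarithm of the curve is a series in X^ℓ, hence so is the curve. -/
theorem coeff_vfSeries_of_not_dvd {ℓ : ℕ} (hℓ : ℓ ≠ 0) {n : ℕ} (hn : ¬ ℓ ∣ n) :
    PowerSeries.coeff n (vfSeries ℓ) = 0 := by
  set V : PowerSeries (MvPolynomial ℕ ℤ) :=
    PowerSeries.mk fun k => ℓ * PowerSeries.coeff (k * ℓ) (genericLog ℤ) with hV
  have hX := PowerSeries.HasSubst.X_pow (R := MvPolynomial ℕ ℤ) hℓ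
  have h : multisectionLog ℓ = V.subst (PowerSeries.X ^ ℓ : PowerSeries (MvPolynomial ℕ ℤ)) := by
    ext1 m
    rw [coeff_multisectionLog, FormalGroup.coeff_subst_X_pow_eq _ hℓ]
    split_ifs with h
    · rw [hV, PowerSeries.coeff_mk, Nat.div_mul_cancel h]
    · rfl
  have hVs : PowerSeries.HasSubst V := by
    refine PowerSeries.HasSubst.of_constantCoeff_zero' ?_
    rw [← PowerSeries.coeff_zero_eq_constantCoeff_apply, hV, PowerSeries.coeff_mk, coeff_genericLog]
    simp
  rw [vfSeries, h, ← PowerSeries.subst_comp_subst_apply hVs hX,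
    FormalGroup.coeff_subst_X_pow_eq _ hℓ, if_neg hn]

end Lazard

namespace MU

open Lazard MvPolynomial

/-- The curve is G(X^ℓ) with G defined over `MU`. Expanding G over `MU` first and substituting X^ℓ
afterwards gives coefficients in `MU` rather than MU[ζ]. -/
theorem exists_isVFCoefficients {ℓ : ℕ+} (hℓ : ℓ.Prime) : ∃ T, IsVFCoefficients ℓ T := by
  choose x hx hx' using exists_toLog_eq_coeff_vfSeries hℓ
  have hcoeff (n : ℕ) := hx' n toLog_injective
  have hℓ0 : (ℓ : ℕ) ≠ 0 := ℓ.ne_zero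
  have hzero {n : ℕ} (hn : PowerSeries.coeff n (vfSeries ℓ) = 0) : x n = 0 :=
    toLog_injective (by rw [hx, hn, map_zero])
  set G : PowerSeries MU := PowerSeries.mk fun k => x (k * ℓ) with hG
  have hG0 : G.constantCoeff = 0 := by
    rw [← PowerSeries.coeff_zero_eq_constantCoeff_apply, hG, PowerSeries.coeff_mk, zero_mul]
    refine hzero ?_
    rw [PowerSeries.coeff_zero_eq_constantCoeff_apply, vfSeries]
    refine PowerSeries.constantCoeff_subst_eq_zero ?_ _ (FormalGroup.constantCoeff_compInv _ _)
    change PowerSeries.constantCoeff (multisectionLog ℓ) = 0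
    rw [← PowerSeries.coeff_zero_eq_constantCoeff_apply, coeff_multisectionLog, coeff_genericLog]
    simp
  obtain ⟨T, hT⟩ := F.exists_hasFormalSum ⟨G, PowerSeries.HasSubst.of_constantCoeff_zero' hG0⟩ hG0
  have hvf (n : ℕ) : PowerSeries.coeff n (verschiebungFrobenius ℓ).val =
      if (ℓ : ℕ) ∣ n then AdjoinRoot.of _ (PowerSeries.coeff (n / ℓ) G) else 0 := by
    rw [hcoeff]
    split_ifs with h
    · rw [hG, PowerSeries.coeff_mk, Nat.div_mul_cancel h]
    · rw [hzero (coeff_vfSeries_of_not_dvd hℓ0 h), map_zero]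
  refine ⟨T, fun n => ?_⟩
  have hsum (N : ℕ+) := F.val_sum_eq_subst_X_pow
    (AdjoinRoot.of (Polynomial.cyclotomic ℓ MU)) hℓ0 (Finset.Icc 1 N)
    (fun k => F.monomialPoint (T k) k)
    (fun k => (cyclotomicF ℓ).monomialPoint (AdjoinRoot.of _ (T k)) (k * ℓ)) (fun k => by
      change PowerSeries.monomial ((k * ℓ : ℕ+) : ℕ) (AdjoinRoot.of _ (T k)) =
        PowerSeries.subst (PowerSeries.X ^ (ℓ : ℕ)) (PowerSeries.map _
          (PowerSeries.monomial (k : ℕ) (T k)))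
      ext m
      rw [FormalGroup.coeff_subst_X_pow_eq _ hℓ0, PowerSeries.coeff_map, PowerSeries.coeff_monomial,
        PowerSeries.coeff_monomial, PNat.mul_coe]
      by_cases h : (ℓ : ℕ) ∣ m
      · obtain ⟨j, rfl⟩ := h
        rw [if_pos (dvd_mul_right _ _), Nat.mul_div_cancel_left _ ℓ.pos, mul_comm (k : ℕ)]
        simp only [Nat.mul_right_inj hℓ0]
        split_ifs <;> simp
      · rw [if_neg h, if_neg]
        rintro rfl
        exact h (dvd_mul_left _ _))
  filter_upwards [hT (n / ℓ)] with N hN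
  rw [hvf]
  refine (congrArg (PowerSeries.coeff n) (hsum N)).trans ?_
  rw [FormalGroup.coeff_subst_X_pow_eq _ hℓ0, PowerSeries.coeff_map, hN]

/-- The recursive formula for the images of the elements `T k` over the coefficient ring of the
logarithm. -/
theorem IsVFCoefficients.toLog_eq {ℓ : ℕ+} (hℓ : ℓ.Prime) {T : ℕ+ → MU}
    (hT : IsVFCoefficients ℓ T) (n : ℕ+) : toLog ℤ (T n) =
      ℓ * PowerSeries.coeff (n * ℓ) (genericLog ℤ) -
        ∑ k ∈ Finset.Ico 1 n, if (k : ℕ) ∣ n then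
          PowerSeries.coeff (n / k) (genericLog ℤ) * toLog ℤ (T k) ^ ((n : ℕ) / k) else 0 := by
  have hlog := isLog_map_cyclotomicF ℓ
  -- Through degree nℓ the infinite sum may be replaced by one finite partial sum; N ≥ n ensures
  -- that it contains the term of T n.
  have hev : ∀ᶠ N : ℕ+ in Filter.atTop, ∀ i ∈ Finset.range (n * ℓ + 1), PowerSeries.coeff i
      (∑ k ∈ Finset.Icc 1 N, (cyclotomicF ℓ).monomialPoint (AdjoinRoot.of _ (T k)) (k * ℓ) :
        (cyclotomicF ℓ).Point Unit).val =
      PowerSeries.coeff i (verschiebungFrobenius ℓ).val :=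
    (Filter.eventually_all_finset _).mpr fun i _ => hT i
  obtain ⟨N, hN, hnN⟩ := (hev.and (Filter.eventually_ge_atTop n)).exists
  have hmap (z : (cyclotomicF ℓ).Point Unit) :
      PowerSeries.HasSubst (MvPowerSeries.map (cyclotomicToLog ℓ) z.val) := by
    change IsNilpotent (MvPowerSeries.constantCoeff _)
    rw [MvPowerSeries.constantCoeff_map]
    exact IsNilpotent.map z.prop _
  have h1 := hlog.subst_map_sum (Finset.Icc 1 N)
    fun k => (cyclotomicF ℓ).monomialPoint (AdjoinRoot.of _ (T k)) (k * ℓ)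
  have h2 := FormalGroup.coeff_subst_eq_of_X_pow_dvd_sub
    ((genericLog ℤ).map (AdjoinRoot.of (Polynomial.cyclotomic ℓ (MvPolynomial ℕ ℤ))))
    (hmap (∑ k ∈ Finset.Icc 1 N,
      (cyclotomicF ℓ).monomialPoint (AdjoinRoot.of _ (T k)) (k * ℓ)))
    (hmap (verschiebungFrobenius ℓ)) (n := n * ℓ + 1) (PowerSeries.X_pow_dvd_iff.mpr
      fun i hi => by
        rw [map_sub, sub_eq_zero]
        exact congrArg (cyclotomicToLog ℓ) (hN i (Finset.mem_range.mpr hi)))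
    (m := n * ℓ) (Nat.lt_succ_self _)
  rw [h1, map_verschiebungFrobenius hℓ, map_sum] at h2
  have h3 := PowerSeries.map_subst (hasSubst_vfSeries ℓ)
    (h := AdjoinRoot.of (Polynomial.cyclotomic ℓ (MvPolynomial ℕ ℤ))) (genericLog ℤ)
  rw [subst_vfSeries] at h3
  have h4 := h2.trans (congrArg (PowerSeries.coeff (n * ℓ : ℕ)) h3.symm)
  have h5 : PowerSeries.coeff (n * ℓ : ℕ) (MvPowerSeries.map (AdjoinRoot.of
      (Polynomial.cyclotomic ℓ (MvPolynomial ℕ ℤ))) (multisectionLog ℓ)) =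
      AdjoinRoot.of _ (ℓ * PowerSeries.coeff (n * ℓ : ℕ) (genericLog ℤ)) := by
    refine (PowerSeries.coeff_map _ _ _).trans ?_
    rw [coeff_multisectionLog, if_pos (dvd_mul_left _ _)]
  rw [h5] at h4
  have hterm (k : ℕ+) : PowerSeries.coeff (n * ℓ : ℕ) (PowerSeries.subst (MvPowerSeries.map
      (cyclotomicToLog ℓ) ((cyclotomicF ℓ).monomialPoint (AdjoinRoot.of _ (T k)) (k * ℓ)).val)
      ((genericLog ℤ).map (AdjoinRoot.of (Polynomial.cyclotomic ℓ (MvPolynomial ℕ ℤ))))) =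
      AdjoinRoot.of _ (if (k : ℕ) ∣ n then
          PowerSeries.coeff (n / k) (genericLog ℤ) * toLog ℤ (T k) ^ ((n : ℕ) / k) else 0) := by
    rw [FormalGroup.map_monomialPoint_val, FormalGroup.coeff_subst_monomial _ (PNat.ne_zero _),
      PNat.mul_coe, if_congr (Nat.mul_dvd_mul_iff_right ℓ.pos) rfl rfl,
      Nat.mul_div_mul_right _ _ ℓ.pos,
      PowerSeries.coeff_map, cyclotomicToLog, AdjoinRoot.cyclotomicMap_of]
    split_ifs <;> simp
  simp only [hterm] at h4
  rw [← map_sum] at h4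
  have h6 := AdjoinRoot.of_cyclotomic_injective ℓ.pos h4
  -- Only divisors of n contribute to the coefficient of X^(nℓ), and k = n contributes T n itself
  -- because m_1 = 1.
  have hsub : insert n (Finset.Ico 1 n) ⊆ Finset.Icc 1 N := by
    intro k hk
    rcases Finset.mem_insert.mp hk with rfl | hk
    · exact Finset.mem_Icc.mpr ⟨_root_.one_le, hnN⟩
    · exact Finset.mem_Icc.mpr ⟨_root_.one_le, (Finset.mem_Ico.mp hk).2.le.trans hnN⟩
  rw [← Finset.sum_subset hsub, Finset.sum_insert (by simp), if_pos dvd_rfl, Nat.div_self n.pos,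
    pow_one, coeff_one_genericLog, one_mul] at h6
  · exact eq_sub_of_add_eq h6
  · intro k _ hk
    rw [if_neg]
    intro hkn
    refine hk ?_
    have hle : k ≤ n := Nat.le_of_dvd n.pos hkn
    rcases hle.eq_or_lt with rfl | hlt
    · exact Finset.mem_insert_self _ _
    · exact Finset.mem_insert_of_mem (Finset.mem_Ico.mpr ⟨_root_.one_le, hlt⟩)

end MU
end

/-! ### The odd part; degrees, slopes and parity of the elements T and X. -/

noncomputable section

namespace Lazard

open MvPolynomial

theorem isWeightedHomogeneous_coeff_genericLog {n : ℕ} (hn : n ≠ 0) : IsWeightedHomogeneous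
    logWeight (PowerSeries.coeff n (genericLog ℤ)) (n - 1) := by
  rw [coeff_genericLog, if_neg hn]
  split_ifs with h1
  · rw [h1]
    exact isWeightedHomogeneous_one _ _
  · convert! isWeightedHomogeneous_X ℤ logWeight (n - 2) using 1
    simp only [logWeight]
    omega

/-- The endomorphism which kills the coefficients of the even powers of `X` in the generic
logarithm. -/
def oddPart (K : Type*) [CommRing K] : MvPolynomial ℕ K →ₐ[K] MvPolynomial ℕ K :=
  aeval fun k => if Even k then 0 else X k

theorem oddPart_coeff_genericLog (K : Type*) [CommRing K] (n : ℕ) :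
    oddPart K (PowerSeries.coeff n (genericLog K)) =
      if Odd n then PowerSeries.coeff n (genericLog K) else 0 := by
  rw [coeff_genericLog]
  rcases n with _ | _ | n
  · simp
  · simp
  · have h : Odd (n + 1 + 1) ↔ ¬ Even n := by
      rw [← Nat.not_even_iff_odd, Nat.even_add_one, Nat.even_add_one, not_not]
    rw [if_neg (by omega), if_neg (by omega), if_congr h rfl rfl, ite_not]
    simp [oddPart]

/-- Variable k has weight k + 1, so a monomial of odd weight contains a variable with k even, which
is killed. -/
theorem oddPart_eq_zero {K : Type*} [CommRing K] {q : MvPolynomial ℕ K} {n : ℕ} (hn : Odd n)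
    (hq : IsWeightedHomogeneous logWeight q n) : oddPart K q = 0 := by
  rw [q.as_sum, map_sum]
  refine Finset.sum_eq_zero fun d hd => ?_
  have hdn := hq (mem_support_iff.mp hd)
  rw [oddPart, aeval_monomial]
  obtain ⟨k, hk, hk'⟩ : ∃ k ∈ d.support, Even k := by
    by_contra! h
    refine Nat.not_even_iff_odd.mpr hn ?_
    rw [← hdn, Finsupp.weight_apply, Finsupp.sum]
    refine Finset.even_sum _ fun k hk => ?_
    rw [smul_eq_mul]
    exact ((Nat.not_even_iff_odd.mp (h k hk)).add_odd odd_one).mul_left _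
  rw [Finsupp.prod, Finset.prod_eq_zero hk, mul_zero]
  rw [if_pos hk', zero_pow (Finsupp.mem_support_iff.mp hk)]

end Lazard

namespace MU

open Lazard MvPolynomial

theorem slope_eq_zero {k n : ℕ} (hn : n ≠ k + 1) {x : MU} (hx : IsHomogeneous n x) :
    slope k x = 0 := by
  rw [slope_eq_coeff]
  refine hx.toLog.coeff_eq_zero _ ?_
  rw [Finsupp.weight_single, one_smul]
  exact hn.symm

theorem slope_mul (k : ℕ) (x y : MU) :
    slope k (x * y) = (linearize k x).fst * slope k y + (linearize k y).fst * slope k x := by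
  simp [slope, mul_comm]

/-- `slope` is a derivation over the augmentation and vanishes in all other degrees. On the ring
generated by y it therefore takes only multiples of its value at `y n`. -/
theorem IsPolynomialSystem.slope_dvd {y : ℕ+ → MU} (hy : IsPolynomialSystem y) (n : ℕ+) (z : MU) :
    slope n.natPred (y n) ∣ slope n.natPred z := by
  have hz : z ∈ Algebra.adjoin ℤ (Set.range y) := hy.adjoin_eq_top ▸ Algebra.mem_top
  induction hz using Algebra.adjoin_induction with
  | mem z hz =>
    obtain ⟨m, rfl⟩ := hz
    by_cases h : m = n
    · rw [h]
    · rw [slope_eq_zero (n := m) _ (hy.homogeneous m)]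
      · exact dvd_zero _
      · rw [PNat.natPred_add_one]
        exact fun h' => h (PNat.coe_injective h')
  | algebraMap r => simp [slope]
  | add a b _ _ ha hb =>
    rw [slope_add]
    exact dvd_add ha hb
  | mul a b _ _ ha hb =>
    rw [slope_mul]
    exact dvd_add (Dvd.dvd.mul_left hb _) (Dvd.dvd.mul_left ha _)

theorem IsPolynomialGenerator.isHomogeneous {n : ℕ+} {x : MU} (hx : IsPolynomialGenerator n x) :
    IsHomogeneous n x := by
  obtain ⟨y, hy, rfl⟩ := hx
  exact hy.homogeneous n

/-- This recovers the slope of a chosen X n when n + 1 is not a prime power, where the hypothesis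
only says that it is a generator. -/
theorem IsPolynomialGenerator.isUnit_slope {n : ℕ+} {x z : MU} (hx : IsPolynomialGenerator n x)
    (hz : slope n.natPred z = 1) : IsUnit (slope n.natPred x) := by
  obtain ⟨y, hy, rfl⟩ := hx
  exact isUnit_of_dvd_one (hz ▸ hy.slope_dvd n z)

namespace IsVFCoefficients

variable {ℓ : ℕ+} {T : ℕ+ → MU}

theorem unique (hℓ : ℓ.Prime) {T' : ℕ+ → MU} (hT : IsVFCoefficients ℓ T)
    (hT' : IsVFCoefficients ℓ T') : T = T' := by
  funext n
  induction n using PNat.strongInductionOn with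
  | _ n ih =>
    refine toLog_injective ?_
    rw [hT.toLog_eq hℓ, hT'.toLog_eq hℓ]
    congr 1
    refine Finset.sum_congr rfl fun k hk => ?_
    rw [ih k (Finset.mem_Ico.mp hk).2]

/-- In the recursion, with j = n / k, the weights add up: (j - 1) + j (kℓ - 1) = nℓ - 1. -/
theorem isWeightedHomogeneous_toLog (hℓ : ℓ.Prime) (hT : IsVFCoefficients ℓ T) (n : ℕ+) :
    IsWeightedHomogeneous logWeight (toLog ℤ (T n)) (n * ℓ - 1) := by
  induction n using PNat.strongInductionOn with
  | _ n ih =>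
    rw [hT.toLog_eq hℓ]
    refine IsWeightedHomogeneous.sub ?_ (IsWeightedHomogeneous.sum _ _ _ fun k hk => ?_)
    · have := (isWeightedHomogeneous_coeff_genericLog (n := n * ℓ)
        (mul_ne_zero n.ne_zero ℓ.ne_zero)).C_mul (ℓ : ℤ)
      simpa using this
    · split_ifs with h
      · obtain ⟨j, hj⟩ := h
        have hj0 : j ≠ 0 := by
          rintro rfl
          exact n.ne_zero hj
        rw [hj, Nat.mul_div_cancel_left _ k.pos]
        have h1 := (isWeightedHomogeneous_coeff_genericLog hj0).mul
          ((ih k (Finset.mem_Ico.mp hk).2).pow j)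
        convert! h1 using 1
        rw [smul_eq_mul]
        obtain ⟨i, rfl⟩ := Nat.exists_eq_succ_of_ne_zero hj0
        obtain ⟨r, hr⟩ := Nat.exists_eq_succ_of_ne_zero (mul_ne_zero k.ne_zero ℓ.ne_zero)
        rw [mul_right_comm, hr]
        simp only [Nat.succ_eq_add_one, Nat.add_sub_cancel]
        have : (r + 1) * (i + 1) = i + (i + 1) * r + 1 := by ring
        omega
      · exact isWeightedHomogeneous_zero _ _ _

theorem isHomogeneous (hℓ : ℓ.Prime) (hT : IsVFCoefficients ℓ T) {n k : ℕ+} (hn : n + 1 = ℓ * k) :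
    IsHomogeneous n (T k) := by
  refine isHomogeneous_of_toLog ?_
  convert! hT.isWeightedHomogeneous_toLog hℓ k using 1
  have h : (n : ℕ) + 1 = ℓ * k := by exact_mod_cast congrArg PNat.val hn
  rw [mul_comm, ← h, Nat.add_sub_cancel]

/-- In the recursion for T k every correction term contains some T m to a power at least 2, which
vanishes because T m maps into (ε). The leading term contributes ℓ. -/
theorem slope_eq (hℓ : ℓ.Prime) (hT : IsVFCoefficients ℓ T) {n k : ℕ+} (hn : n + 1 = ℓ * k) :
    slope n.natPred (T k) = ℓ := by
  have h : n.natPred + 2 = k * ℓ := by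
    have h' : (n : ℕ) + 1 = ℓ * k := by exact_mod_cast congrArg PNat.val hn
    rw [mul_comm, ← h', ← PNat.natPred_add_one n]
  rw [slope, linearize, RingHom.comp_apply, hT.toLog_eq hℓ, map_sub, map_sum, Finset.sum_eq_zero,
    ← h, coeff_genericLog, if_neg (by omega), if_neg (by omega), map_mul, Nat.add_sub_cancel,
    toDual_X]
  · simp
  · intro m hm
    split_ifs with hmk
    · obtain ⟨j, hj⟩ := hmk
      have hmk' : (m : ℕ) < k := (Finset.mem_Ico.mp hm).2
      obtain ⟨i, rfl⟩ : ∃ i, j = i + 2 := by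
        refine Nat.exists_eq_add_of_le' ?_
        by_contra! hj2
        interval_cases j
        · omega
        · omega
      rw [hj, Nat.mul_div_cancel_left _ m.pos, map_mul, map_pow]
      have hpos : 0 < (m : ℕ) * ℓ - 1 := by
        have h1 : 1 * 2 ≤ (m : ℕ) * ℓ := Nat.mul_le_mul m.pos hℓ.two_le
        omega
      have h2 : (toDual (fun j => if j = n.natPred then (1 : ℤ) else 0) (toLog ℤ (T m))) ^ 2 = 0 := by
        have h0 := fst_toDual_of_pos (fun j => if j = n.natPred then (1 : ℤ) else 0) hpos
          (hT.isWeightedHomogeneous_toLog hℓ m)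
        rw [pow_two]
        ext <;> simp [h0]
      rw [pow_add, h2, mul_zero, mul_zero]
    · exact map_zero _

/-- Divisors of an odd number are odd, so the recursion meets no coefficient of even index. -/
theorem oddPart_toLog (hℓ : ℓ.Prime) (hT : IsVFCoefficients ℓ T) {n : ℕ+}
    (hn : Odd (n * ℓ : ℕ)) : oddPart ℤ (toLog ℤ (T n)) = toLog ℤ (T n) := by
  induction n using PNat.strongInductionOn with
  | _ n ih =>
    rw [hT.toLog_eq hℓ, map_sub, map_mul, oddPart_coeff_genericLog, if_pos hn, map_natCast, map_sum]
    congr 1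
    refine Finset.sum_congr rfl fun k hk => ?_
    split_ifs with h
    · obtain ⟨j, hj⟩ := h
      rw [hj, mul_right_comm, Nat.odd_mul] at hn
      rw [hj, Nat.mul_div_cancel_left _ k.pos, map_mul, map_pow, oddPart_coeff_genericLog,
        if_pos hn.2, ih k (Finset.mem_Ico.mp hk).2 hn.1]
    · exact map_zero _

theorem hasGeneratorSlope (hℓ : ℓ.Prime) (hT : IsVFCoefficients ℓ T) {d : ℕ} {n : ℕ+}
    (hn : n + 1 = ℓ ^ (d + 1)) : HasGeneratorSlope n.natPred (T (ℓ ^ d)) := by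
  refine hasGeneratorSlope_of_eq_prime (d := d + 1) hℓ ?_ (hT.slope_eq hℓ (hn.trans (pow_succ' _ _)))
  have h : (n : ℕ) + 1 = ℓ ^ (d + 1) := by exact_mod_cast congrArg PNat.val hn
  rw [← h, ← PNat.natPred_add_one n]

end IsVFCoefficients

namespace IsKozmaChoice

variable {T : ℕ+ → ℕ+ → MU} {X : ℕ+ → MU}

theorem exists_eq_pow {n : ℕ+} (h : IsPrimePow ((n : ℕ) + 1)) :
    ∃ (ℓ : ℕ+) (d : ℕ), ℓ.Prime ∧ n + 1 = ℓ ^ (d + 1) := by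
  obtain ⟨p, d, hp, hd, h⟩ := (isPrimePow_nat_iff _).mp h
  lift p to ℕ+ using hp.pos
  refine ⟨p, d - 1, hp, PNat.coe_injective ?_⟩
  rw [Nat.sub_add_cancel hd, PNat.pow_coe]
  exact h.symm

theorem isHomogeneous (hT : ∀ ℓ : ℕ+, ℓ.Prime → IsVFCoefficients ℓ (T ℓ)) (hX : IsKozmaChoice T X)
    (n : ℕ+) : IsHomogeneous n (X n) := by
  by_cases h : IsPrimePow ((n : ℕ) + 1)
  · obtain ⟨ℓ, d, hℓ, hn⟩ := exists_eq_pow h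
    rw [hX.primePow ℓ d n hℓ hn]
    exact (hT ℓ hℓ).isHomogeneous hℓ (hn.trans (pow_succ' _ _))
  · exact (hX.generator n h).isHomogeneous

/-- When n + 1 is not a prime power, Bézout for the two given primes produces an element of slope 1.
The generator X n then has unit slope, whatever integers appear in its own combination. -/
theorem hasGeneratorSlope (hT : ∀ ℓ : ℕ+, ℓ.Prime → IsVFCoefficients ℓ (T ℓ))
    (hX : IsKozmaChoice T X) (n : ℕ+) : HasGeneratorSlope n.natPred (X n) := by
  by_cases h : IsPrimePow ((n : ℕ) + 1)
  · obtain ⟨ℓ, d, hℓ, hn⟩ := exists_eq_pow h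
    rw [hX.primePow ℓ d n hℓ hn]
    exact (hT ℓ hℓ).hasGeneratorSlope hℓ hn
  · obtain ⟨ℓ₁, ℓ₂, k₁, k₂, a, b, h₁, h₂, hne, hn₁, hn₂, -⟩ := hX.combination n h
    obtain ⟨a, b, hab⟩ := exists_slope_eq_one h₁ h₂ (fun h => hne (PNat.coe_injective h))
      ((hT ℓ₁ h₁).slope_eq h₁ hn₁) ((hT ℓ₂ h₂).slope_eq h₂ hn₂)
    exact hasGeneratorSlope_of_isUnit ((hX.generator n h).isUnit_slope hab)

theorem isPolynomialSystem (hT : ∀ ℓ : ℕ+, ℓ.Prime → IsVFCoefficients ℓ (T ℓ))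
    (hX : IsKozmaChoice T X) : IsPolynomialSystem X :=
  MU.isPolynomialSystem (hX.isHomogeneous hT) (hX.hasGeneratorSlope hT)

theorem oddPart_toLog (hT : ∀ ℓ : ℕ+, ℓ.Prime → IsVFCoefficients ℓ (T ℓ))
    (hX : IsKozmaChoice T X) {n : ℕ+} (hn : Even (n : ℕ)) :
    oddPart ℤ (toLog ℤ (X n)) = toLog ℤ (X n) := by
  have hodd {ℓ k : ℕ+} (h : n + 1 = ℓ * k) : Odd (k * ℓ : ℕ) := by
    have h' : (n : ℕ) + 1 = ℓ * k := by exact_mod_cast congrArg PNat.val h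
    rw [mul_comm, ← h']
    exact hn.add_one
  by_cases h : IsPrimePow ((n : ℕ) + 1)
  · obtain ⟨ℓ, d, hℓ, hn⟩ := exists_eq_pow h
    rw [hX.primePow ℓ d n hℓ hn]
    exact (hT ℓ hℓ).oddPart_toLog hℓ (hodd (hn.trans (pow_succ' _ _)))
  · obtain ⟨ℓ₁, ℓ₂, k₁, k₂, a, b, h₁, h₂, -, hn₁, hn₂, hX⟩ := hX.combination n h
    rw [hX, map_add, map_zsmul, map_zsmul, map_add, map_zsmul, map_zsmul,
      (hT ℓ₁ h₁).oddPart_toLog h₁ (hodd hn₁), (hT ℓ₂ h₂).oddPart_toLog h₂ (hodd hn₂)]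

end IsKozmaChoice

end MU
end

/-! ### Base change, and the logarithm of F'. -/

noncomputable section

/-- Algebraically independent generators of an algebra remain such after base change. -/
theorem MvPolynomial.bijective_aeval_one_tmul {R A B ι : Type*} [CommRing R] [CommRing A]
    [CommRing B] [Algebra R A] [Algebra R B] [Module.Flat R A] {x : ι → B}
    (hx : Function.Bijective (aeval (R := R) x)) :
    Function.Bijective (aeval (R := A) fun i => (1 : A) ⊗ₜ[R] x i) := by
  have h : (aeval (R := A) fun i => (1 : A) ⊗ₜ[R] x i) =
      (Algebra.TensorProduct.map (AlgHom.id A A) (aeval (R := R) x)).comp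
        (algebraTensorAlgEquiv R A).symm.toAlgHom := by
    ext i
    simp
  rw [h]
  refine Function.Bijective.comp (g := Algebra.TensorProduct.map (AlgHom.id A A) (aeval (R := R) x))
    ⟨?_, ?_⟩ (algebraTensorAlgEquiv R A).symm.bijective
  · exact Module.Flat.lTensor_preserves_injective_linearMap (aeval (R := R) x).toLinearMap hx.1
  · exact LinearMap.lTensor_surjective A (g := (aeval (R := R) x).toLinearMap) hx.2

namespace FormalGroup

variable {R : Type*} [CommRing R] {S : Type*} [CommRing S]

/-- The series f is an isomorphism from the conjugated law to F, so a logarithm of F composed with f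
is one of the new law. The base change h is carried along because a logarithm is only assumed over
S. -/
theorem IsLog.map_conj {F : FormalGroup R} {h : R →+* S} {g : PowerSeries S}
    (hg : (F.map h).IsLog g) {f : PowerSeries R} (hf0 : f.constantCoeff = 0)
    (hf : PowerSeries.coeff 1 f = 1) : ((F.conj f hf0 hf).map h).IsLog (g.subst (f.map h)) := by
  have hf0' : (f.map h).constantCoeff = 0 := by
    rw [← PowerSeries.coeff_zero_eq_constantCoeff_apply, PowerSeries.coeff_map,
      PowerSeries.coeff_zero_eq_constantCoeff_apply, hf0, map_zero]
  have hfs : PowerSeries.HasSubst (f.map h) := PowerSeries.HasSubst.of_constantCoeff_zero' hf0'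
  have hX (i : Fin 2) : PowerSeries.HasSubst (MvPowerSeries.X i : MvPowerSeries (Fin 2) R) :=
    PowerSeries.HasSubst.X i
  have hX' (i : Fin 2) : PowerSeries.HasSubst (MvPowerSeries.X i : MvPowerSeries (Fin 2) S) :=
    PowerSeries.HasSubst.X i
  have hfX (i : Fin 2) := hasSubst_subst hf0 (hX i)
  have hfX' (i : Fin 2) := hasSubst_subst hf0' (hX' i)
  have hmap (i : Fin 2) : MvPowerSeries.map h (f.subst (MvPowerSeries.X i)) =
      (f.map h).subst (MvPowerSeries.X i : MvPowerSeries (Fin 2) S) := by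
    rw [PowerSeries.map_subst (hX i), MvPowerSeries.map_X]
  refine ⟨constantCoeff_subst_zero hg.constantCoeff hf0', ?_, ?_⟩
  · rw [coeff_one_subst hf0', hg.coeff_one, PowerSeries.coeff_map, hf, map_one, mul_one]
  · have h1 : f.subst (F.conj f hf0 hf).toPowerSeries = _ :=
      subst_compInv hf0 hf (F.hasSubst_add (hfX 0) (hfX 1))
    have h2 := congrArg (MvPowerSeries.map h) h1
    rw [PowerSeries.map_subst (hasSubst_toPowerSeries _), F.map_subst_pair h (hfX 0) (hfX 1), hmap,
      hmap] at h2
    rw [PowerSeries.subst_comp_subst_apply hfs (hX' 0),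
      PowerSeries.subst_comp_subst_apply hfs (hX' 1),
      PowerSeries.subst_comp_subst_apply hfs (hasSubst_toPowerSeries _),
      ← hg.subst_add (hfX' 0) (hfX' 1)]
    exact congrArg (fun a => g.subst a) h2

/-- Doubling undoes the half in the definition of φ. On logarithms this will read 2 log φ(X) = log X
- log(-X). -/
theorem subst_pair_oddCoordinate (F : FormalGroup R) (h2 : IsUnit (2 : R)) :
    F.toPowerSeries.subst ![F.oddCoordinate h2, F.oddCoordinate h2] = F.subNegSeries := by
  have hsub : PowerSeries.HasSubst F.subNegSeries :=
    PowerSeries.HasSubst.of_constantCoeff_zero' F.constantCoeff_subNegSeries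
  have hodd : PowerSeries.HasSubst (F.oddCoordinate h2) :=
    PowerSeries.HasSubst.of_constantCoeff_zero' (F.constantCoeff_oddCoordinate h2)
  have hhalf : PowerSeries.HasSubst (F.halfSeries h2) :=
    PowerSeries.HasSubst.of_constantCoeff_zero' (by simp [halfSeries])
  have h : F.twoSeries.subst (F.oddCoordinate h2) = F.subNegSeries := by
    rw [oddCoordinate, ← PowerSeries.subst_comp_subst_apply hhalf hsub, twoSeries_subst_halfSeries,
      PowerSeries.subst_X hsub]
  rw [← h, twoSeries, PowerSeries.subst, MvPowerSeries.subst_comp_subst_apply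
    (hasSubst_pair (by simp) (by simp)) hodd.const]
  congr 1
  funext i
  fin_cases i <;> exact (PowerSeries.subst_X hodd).symm

theorem subst_neg_X (g : PowerSeries R) (n : ℕ) :
    PowerSeries.coeff n (g.subst (-PowerSeries.X : PowerSeries R)) =
      (-1) ^ n * PowerSeries.coeff n g := by
  rw [← PowerSeries.coeff_rescale, PowerSeries.rescale_eq_subst]
  simp

/-- The logarithm of `F'` is the odd part of the logarithm of `F`. -/
theorem IsLog.two_mul_coeff_subst_oddCoordinate {F : FormalGroup R} (h2 : IsUnit (2 : R))
    {h : R →+* S} {g : PowerSeries S} (hg : (F.map h).IsLog g) (n : ℕ) :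
    2 * PowerSeries.coeff n (g.subst ((F.oddCoordinate h2).map h)) =
      PowerSeries.coeff n g - (-1) ^ n * PowerSeries.coeff n g := by
  have hmap {f : PowerSeries R} (hf : f.constantCoeff = 0) :
      PowerSeries.HasSubst (MvPowerSeries.map h f) := by
    change IsNilpotent (MvPowerSeries.constantCoeff _)
    rw [MvPowerSeries.constantCoeff_map]
    exact IsNilpotent.map (PowerSeries.HasSubst.of_constantCoeff_zero' hf) h
  have hX := PowerSeries.HasSubst.X' (R := R)
  have hX' := PowerSeries.HasSubst.X' (R := S)
  have hnX : PowerSeries.HasSubst (-PowerSeries.X : PowerSeries R) :=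
    PowerSeries.HasSubst.of_constantCoeff_zero' (by simp)
  have hnX' : PowerSeries.HasSubst (-PowerSeries.X : PowerSeries S) :=
    PowerSeries.HasSubst.of_constantCoeff_zero' (by simp)
  have hneg : PowerSeries.HasSubst F.negSeries :=
    PowerSeries.HasSubst.of_constantCoeff_zero' F.constantCoeff_negSeries
  have hodd : PowerSeries.HasSubst (F.oddCoordinate h2) :=
    PowerSeries.HasSubst.of_constantCoeff_zero' (F.constantCoeff_oddCoordinate h2)
  have hX1 : MvPowerSeries.map h (PowerSeries.X : PowerSeries R) = (PowerSeries.X : PowerSeries S) :=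
    MvPowerSeries.map_X _ _
  -- the logarithm of `[-1]_F(X)`
  have h1 := congrArg (MvPowerSeries.map h) F.subst_negSeries
  rw [F.map_subst_pair h hX hneg, map_zero, hX1] at h1
  have h3 := hg.subst_add hX' (hmap F.constantCoeff_negSeries)
  rw [h1, PowerSeries.subst_zero_of_constantCoeff_zero hg.constantCoeff] at h3
  have h4 : g.subst (MvPowerSeries.map h F.negSeries) = -g := by
    rw [← PowerSeries.map_algebraMap_eq_subst_X] at h3
    have h5 : g + g.subst (MvPowerSeries.map h F.negSeries) = 0 := h3.symm
    exact (neg_eq_of_add_eq_zero_right h5).symm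
  -- the logarithm of `F(X, [-1]_F(-X))`
  have h5 := congrArg (MvPowerSeries.map h) (F.subst_pair_oddCoordinate h2)
  have hns := hasSubst_subst F.constantCoeff_negSeries hnX
  have hnn : MvPowerSeries.map h (F.negSeries.subst (-PowerSeries.X : PowerSeries R)) =
      (F.negSeries.map h).subst (-PowerSeries.X : PowerSeries S) := by
    rw [PowerSeries.map_subst hnX, map_neg, hX1]
  rw [subNegSeries, F.map_subst_pair h hX hns, F.map_subst_pair h hodd hodd, hX1, hnn] at h5
  have h6 := congrArg (fun a => PowerSeries.coeff n (g.subst a)) h5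
  have hns' : PowerSeries.HasSubst ((F.negSeries.map h).subst (-PowerSeries.X : PowerSeries S)) := by
    rw [← hnn]
    exact hmap (constantCoeff_subst_zero F.constantCoeff_negSeries (by simp))
  have hod := hmap (F.constantCoeff_oddCoordinate h2)
  have h7 : (g.subst ((F.negSeries.map h).subst (-PowerSeries.X : PowerSeries S))) =
      -g.subst (-PowerSeries.X : PowerSeries S) := by
    have h8 := PowerSeries.subst_comp_subst_apply (hmap F.constantCoeff_negSeries) hnX' g
    refine h8.symm.trans ?_
    rw [h4, ← PowerSeries.coe_substAlgHom hnX', map_neg]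
  rw [hg.subst_add hod hod, hg.subst_add hX' hns', h7, ← PowerSeries.map_algebraMap_eq_subst_X,
    Algebra.algebraMap_self, map_add, map_add, map_neg, subst_neg_X] at h6
  rw [two_mul, sub_eq_add_neg]
  refine h6.trans (congrArg (fun a => PowerSeries.coeff n a + _) ?_)
  exact congrFun PowerSeries.map_id g

end FormalGroup
end

/-! ### The action of ε₂ on logarithm coefficients, and its image. -/

noncomputable section

namespace Lazard

open MvPolynomial

variable {K L : Type*} [CommRing K] [CommRing L]

theorem map_genericLog (f : K →+* L) :
    (genericLog K).map (MvPolynomial.map f) = genericLog L := by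
  ext1 n
  rw [PowerSeries.coeff_map, coeff_genericLog, coeff_genericLog]
  split_ifs <;> simp

theorem oddPart_map (f : K →+* L) (q : MvPolynomial ℕ K) :
    oddPart L (MvPolynomial.map f q) = MvPolynomial.map f (oddPart K q) := by
  have h : (oddPart L).toRingHom.comp (MvPolynomial.map f) =
      (MvPolynomial.map f).comp (oddPart K).toRingHom :=
    MvPolynomial.ringHom_ext (by simp [oddPart]) fun k => by
      simp only [RingHom.comp_apply, oddPart, AlgHom.toRingHom_eq_coe, RingHom.coe_coe, map_X,
        aeval_X]
      split_ifs <;> simp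
  exact RingHom.congr_fun h q

end Lazard

namespace MU

open Lazard MvPolynomial

instance : Module.Flat ℤ ZHalf := IsLocalization.flat ZHalf (Submonoid.powers (2 : ℤ))

/-- The map from `MU[1/2]_*` to the coefficient ring of the generic logarithm. -/
def halfToLog : Half →ₐ[ZHalf] MvPolynomial ℕ ZHalf :=
  (algebraTensorAlgEquiv ℤ ZHalf).toAlgHom.comp
    (Algebra.TensorProduct.map (AlgHom.id ZHalf ZHalf) (toLog ℤ).toIntAlgHom)

theorem halfToLog_toHalf (x : MU) :
    halfToLog (toHalf x) = MvPolynomial.map (algebraMap ℤ ZHalf) (toLog ℤ x) := by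
  have h : toHalf x = (1 : ZHalf) ⊗ₜ[ℤ] x := rfl
  rw [h]
  change algebraTensorAlgEquiv ℤ ZHalf ((1 : ZHalf) ⊗ₜ[ℤ] (toLog ℤ x)) = _
  rw [algebraTensorAlgEquiv_tmul, one_smul]

theorem halfToLog_injective : Function.Injective halfToLog := by
  have h : Function.Injective
      (Algebra.TensorProduct.map (AlgHom.id ZHalf ZHalf) (toLog ℤ).toIntAlgHom) :=
    Module.Flat.lTensor_preserves_injective_linearMap (M := ZHalf)
      (toLog ℤ).toIntAlgHom.toLinearMap toLog_injective
  exact (algebraTensorAlgEquiv ℤ ZHalf).injective.comp h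

theorem isLog_map_halfToLog :
    ((F.map toHalf).map halfToLog.toRingHom).IsLog (genericLog ZHalf) := by
  have h := (isLog_map_toLog ℤ).map (MvPolynomial.map (algebraMap ℤ ZHalf))
  rw [map_genericLog, ← map_comp] at h
  rw [← map_comp]
  convert! h using 2
  ext1 x
  exact halfToLog_toHalf x

/-- A homomorphism out of `MU` is determined by the law it classifies, and a law by its logarithm.
Both sides yield the odd part of the generic logarithm. -/
theorem halfToLog_classify_oddF (x : MU) :
    halfToLog (classify oddF x) = oddPart ZHalf (halfToLog (toHalf x)) := by
  have h : halfToLog.toRingHom.comp (classify oddF) =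
      ((oddPart ZHalf).toRingHom.comp halfToLog.toRingHom).comp toHalf := by
    refine hom_ext ?_
    have hlog := isLog_map_halfToLog
    have h1 := hlog.map_conj ((F.map toHalf).constantCoeff_oddCoordinate isUnit_two)
      ((F.map toHalf).coeff_one_oddCoordinate isUnit_two)
    have h2 := hlog.map (oddPart ZHalf).toRingHom
    rw [map_comp, map_classify, map_comp]
    refine h1.unique ?_
    convert! h2 using 1
    ext1 n
    have hunit : IsUnit (2 : MvPolynomial ℕ ZHalf) := by
      have h3 := isUnit_two.map halfToLog
      rwa [map_ofNat] at h3
    refine hunit.mul_left_cancel ?_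
    rw [hlog.two_mul_coeff_subst_oddCoordinate isUnit_two, PowerSeries.coeff_map]
    change _ = 2 * oddPart ZHalf _
    rw [oddPart_coeff_genericLog]
    split_ifs with hn
    · rw [hn.neg_one_pow]
      ring
    · rw [(Nat.not_odd_iff_even.mp hn).neg_one_pow]
      ring
  exact RingHom.congr_fun h x

theorem halfToLog_epsilon_toHalf (x : MU) : halfToLog (epsilon (toHalf x)) =
    MvPolynomial.map (algebraMap ℤ ZHalf) (oddPart ℤ (toLog ℤ x)) := by
  have h : epsilon (toHalf x) = classify oddF x := by
    refine (Algebra.TensorProduct.lift_tmul _ _ _ (1 : ZHalf) x).trans ?_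
    rw [map_one, one_mul]
    rfl
  rw [h, halfToLog_classify_oddF, halfToLog_toHalf, oddPart_map]

theorem epsilon_toHalf_of_odd {n : ℕ} (hn : Odd n) {x : MU} (hx : IsHomogeneous n x) :
    epsilon (toHalf x) = 0 := by
  refine halfToLog_injective ?_
  rw [halfToLog_epsilon_toHalf, oddPart_eq_zero hn hx.toLog, map_zero, map_zero]

theorem epsilon_toHalf_of_oddPart_eq {x : MU} (hx : oddPart ℤ (toLog ℤ x) = toLog ℤ x) :
    epsilon (toHalf x) = toHalf x := by
  refine halfToLog_injective ?_
  rw [halfToLog_epsilon_toHalf, hx, halfToLog_toHalf]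

theorem IsPolynomialSystem.bijective_aeval_toHalf {y : ℕ+ → MU} (hy : IsPolynomialSystem y) :
    Function.Bijective (aeval (R := ZHalf) fun n => toHalf (y n)) := by
  refine bijective_aeval_one_tmul ⟨hy.algebraicIndependent, ?_⟩
  rw [← AlgHom.range_eq_top, ← Algebra.adjoin_range_eq_range_aeval, hy.adjoin_eq_top]

namespace IsKozmaChoice

variable {T : ℕ+ → ℕ+ → MU} {X : ℕ+ → MU}

theorem algebraicIndependent_toHalf (hT : ∀ ℓ : ℕ+, ℓ.Prime → IsVFCoefficients ℓ (T ℓ))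
    (hX : IsKozmaChoice T X) :
    AlgebraicIndependent ZHalf fun m : ℕ+ => toHalf (X (2 * m)) :=
  AlgebraicIndependent.comp (x := fun n => toHalf (X n))
    (hX.isPolynomialSystem hT).bijective_aeval_toHalf.1 (fun m : ℕ+ => 2 * m)
    fun _ _ h => mul_left_cancel h

/-- Among the generators X n, ε₂ kills those with n odd and fixes those with n even, so their images
are the even ones and 0. -/
theorem adjoin_eq_ev (hT : ∀ ℓ : ℕ+, ℓ.Prime → IsVFCoefficients ℓ (T ℓ))
    (hX : IsKozmaChoice T X) :
    Algebra.adjoin ZHalf (Set.range fun m : ℕ+ => toHalf (X (2 * m))) = ev := by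
  have htop : Algebra.adjoin ZHalf (Set.range fun n => toHalf (X n)) = ⊤ := by
    rw [Algebra.adjoin_range_eq_range_aeval, AlgHom.range_eq_top]
    exact (hX.isPolynomialSystem hT).bijective_aeval_toHalf.2
  have heven (m : ℕ+) : epsilon (toHalf (X (2 * m))) = toHalf (X (2 * m)) :=
    epsilon_toHalf_of_oddPart_eq (hX.oddPart_toLog hT (by simp))
  rw [ev, ← Algebra.map_top, ← htop, AlgHom.map_adjoin]
  refine le_antisymm (Algebra.adjoin_mono ?_) (Algebra.adjoin_le ?_)
  · rintro _ ⟨m, rfl⟩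
    exact ⟨_, ⟨2 * m, rfl⟩, heven m⟩
  · rintro _ ⟨_, ⟨n, rfl⟩, rfl⟩
    change epsilon (toHalf (X n)) ∈ _
    rcases Nat.even_or_odd (n : ℕ) with ⟨m, hm⟩ | hn
    · have hm0 : 0 < m := by
        have := n.pos
        omega
      lift m to ℕ+ using hm0
      obtain rfl : n = 2 * m := PNat.coe_injective (hm.trans (two_mul _).symm)
      rw [heven]
      exact Algebra.subset_adjoin ⟨m, rfl⟩
    · rw [epsilon_toHalf_of_odd hn (hX.isHomogeneous hT n)]
      exact Subalgebra.zero_mem _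

end IsKozmaChoice

end MU

end

/-! ### Assembly of the theorem. -/

theorem theorem2p1 :
    (∀ ℓ : ℕ+, ℓ.Prime → ∃! T : ℕ+ → MU, MU.IsVFCoefficients ℓ T) ∧
    ∀ T : ℕ+ → ℕ+ → MU, (∀ ℓ : ℕ+, ℓ.Prime → MU.IsVFCoefficients ℓ (T ℓ)) →
      (∀ ℓ k n : ℕ+, ℓ.Prime → n + 1 = ℓ * k → MU.IsHomogeneous n (T ℓ k)) ∧
      (∀ (ℓ : ℕ+) (d : ℕ) (n : ℕ+), ℓ.Prime → n + 1 = ℓ ^ (d + 1) →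
        MU.IsPolynomialGenerator n (T ℓ (ℓ ^ d))) ∧
      (∀ ℓ₁ ℓ₂ k₁ k₂ n : ℕ+, ℓ₁.Prime → ℓ₂.Prime → ℓ₁ ≠ ℓ₂ → n + 1 = ℓ₁ * k₁ → n + 1 = ℓ₂ * k₂ →
        ∃ a b : ℤ, MU.IsPolynomialGenerator n (a • T ℓ₁ k₁ + b • T ℓ₂ k₂)) ∧
      ∀ X : ℕ+ → MU, MU.IsKozmaChoice T X →
        AlgebraicIndependent MU.ZHalf (fun m : ℕ+ => MU.toHalf (X (2 * m))) ∧
        Algebra.adjoin MU.ZHalf (Set.range fun m : ℕ+ => MU.toHalf (X (2 * m))) = MU.ev := by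
  refine ⟨fun ℓ hℓ => ?_, fun T hT => ⟨fun ℓ k n hℓ hn => (hT ℓ hℓ).isHomogeneous hℓ hn,
    fun ℓ d n hℓ hn => ?_, fun ℓ₁ ℓ₂ k₁ k₂ n h₁ h₂ hne hn₁ hn₂ => ?_,
    fun X hX => ⟨hX.algebraicIndependent_toHalf hT, hX.adjoin_eq_ev hT⟩⟩⟩
  · obtain ⟨T, hT⟩ := MU.exists_isVFCoefficients hℓ
    exact ⟨T, hT, fun T' hT' => hT'.unique hℓ hT⟩
  · exact MU.isPolynomialGenerator ((hT ℓ hℓ).isHomogeneous hℓ (hn.trans (pow_succ' _ _)))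
      ((hT ℓ hℓ).hasGeneratorSlope hℓ hn)
  · obtain ⟨a, b, hab⟩ := MU.exists_slope_eq_one h₁ h₂ (fun h => hne (PNat.coe_injective h))
      ((hT ℓ₁ h₁).slope_eq h₁ hn₁) ((hT ℓ₂ h₂).slope_eq h₂ hn₂)
    exact ⟨a, b, MU.isPolynomialGenerator
      ((((hT ℓ₁ h₁).isHomogeneous h₁ hn₁).zsmul a).add (((hT ℓ₂ h₂).isHomogeneous h₂ hn₂).zsmul b))
      (MU.hasGeneratorSlope_of_isUnit (hab ▸ isUnit_one))⟩
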